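/- Let $k$ be a field and let $X$ be a variety over $k$, i.e. an integral scheme of finite type over $k$, with normalization $\pi\colon\widehat X\to X$. Let $Z_*X$ be the group of algebraic cycles, let $W_*X=\bigoplus_{V\subseteq X}k(V)^*$ (sum over all subvarieties, i.e. integral closed subschemes) be the group of rational equivalences, and let $\partial\colon W_*X\to Z_*X$ send $r\in k(V)^*$ to its Weil divisor on $V$. For a closed subset $T\subseteq X$, $W_*(T)\subseteq W_*X$ is the sum over the subvarieties contained in $T$. The pushforward $\pi_*\colon W_*\widehat X\to W_*X$ sends $r\in k(V)^*$ to its norm in $k(\pi(V))^*$. A $P$-divisor $D$ on $X$ is a triple $(U,U',x)$ where $U,U'$ are nonempty open subschemes with $U\cup U'=X$, $x\in k(X)^*$ (the local defining function) restricts to an element of $\mathcal O^*(U\cap U')$, and the Cartier divisor given by $x$ on $U$ and $1$ on $U'$, also denoted $D$, has support $|D|=X\setminus U'$. Here $|\pi^*D|\subseteq\widehat X$ is the union of the prime divisors $V$ of $\widehat X$ with $\operatorname{ord}_V\pi^*D\neq0$, and $|D|=\pi(|\pi^*D|)$. Let $[D]$ be the associated Weil divisor. For a subvariety $V\subseteq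 X$ put $D\cdot[V]=[D|_V]$ if $V\not\subseteq|D|$ and $D\cdot[V]=0$ if $V\subseteq|D|$, and extend linearly to $Z_*X$. A superscript $0$ denotes the set of irreducible components. Let $D$ and $E$ be $P$-divisors on $X$ with local defining functions $x$ and $y$. For a set $S$ of prime divisors of $\widehat X$ write $$\omega_S=\sum_{V\in S}\pi_*\bigl(y^{\operatorname{ord}_Vx}/x^{\operatorname{ord}_Vy}\,|_V\bigr).$$ (1) Let $S$ be the set of prime divisors $V$ of $\widehat X$ with $\pi(V)\subseteq|D|\cap|E|$. Then $S$ is finite, $\omega_S\in W_*(|D|\cap|E|)$, and $$D\cdot[E]-E\cdot[D]=\partial\,\omega_S .$$ (2) Suppose that every prime divisor $V$ of $\widehat X$ with $\pi(V)\subseteq|D|$ satisfies $\operatorname{ord}_V\pi^*D\ne0$, and likewise for $E$. Then the same conclusions hold for $S=|\pi^*D|^0\cap|\pi^*E|^0$, that is, $D\cdot[E]-E\cdot[D]=\partial\,\omega$ with $$\omega=\sum_{V\in|\pi^*D|^0\cap|\pi^*E|^0}\pi_*\bigl(y^{\operatorname{ord}_Vx}/x^{\operatorname{ord}_Vy}\,|_V\bigr)\in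 W_*(|D|\cap|E|).$$ -/

import Mathlib

open AlgebraicGeometry CategoryTheory TopologicalSpace

universe u

namespace CycleIntersection

noncomputable section

/-! ### Orders of vanishing -/

open Classical in
/-- The order of `f ∈ Kˣ` with respect to a subring `R` of the field `K`: write `f = a / b` with
`a, b ∈ R` nonzero and take `length (R / a) - length (R / b)`. It is used only for
one-dimensional Noetherian local domains `R` with fraction field `K`, where both lengths are
finite and the value does not depend on the choice of `a` and `b`. -/
def fracOrd {K : Type*} [Field K] (R : Subring K) (f : K) : ℤ :=
  if h : ∃ p : R × R, p.1 ≠ 0 ∧ p.2 ≠ 0 ∧ f * p.2 = p.1 then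
    ((Ring.ord R h.choose.1).toNat : ℤ) - ((Ring.ord R h.choose.2).toNat : ℤ)
  else 0

lemma fracOrd_eq_zero {K : Type*} [Field K] (R : Subring K) {f : K}
    (hf : f ∈ R) (hf' : f⁻¹ ∈ R) : fracOrd R f = 0 := by
  unfold fracOrd
  split_ifs with h
  · obtain ⟨h1, h2, h3⟩ := h.choose_spec
    have hf0 : f ≠ 0 := by
      rintro rfl
      rw [zero_mul] at h3
      exact h1 (Subtype.ext h3.symm)
    have : Associated h.choose.2 h.choose.1 := by
      refine ⟨⟨⟨f, hf⟩, ⟨f⁻¹, hf'⟩, ?_, ?_⟩, ?_⟩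
      · exact Subtype.ext (mul_inv_cancel₀ hf0)
      · exact Subtype.ext (inv_mul_cancel₀ hf0)
      · exact Subtype.ext (by simpa [mul_comm] using h3)
    rw [Ring.ord_eq_of_associated this, sub_self]
  · rfl

/-- The order of a rational function on an integral scheme along the closure of the point `v`
(used only when this closure has codimension one). -/
def ordAlong {X : Scheme.{u}} [IsIntegral X] (v : X) (f : X.functionField) : ℤ :=
  fracOrd (algebraMap (X.presheaf.stalk v) X.functionField).range f

/-- For `v ⤳ w`, the local ring at `w` of the integral closed subscheme `V` with generic point
`v`, as a subring of the function field `κ(v)` of `V`: it is the image of `𝒪_{X,w}`. -/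
def localSubring (X : Scheme.{u}) {v w : X} (h : v ⤳ w) : Subring (X.residueField v) :=
  (X.presheaf.stalkSpecializes h ≫ X.residue v).hom.range

open Classical in
/-- The order of `r ∈ k(V)ˣ` along the subvariety `W` of `V`, where `v` and `w` are the generic
points of `V` and `W`; it is set to `0` unless `W` has codimension one in `V`, that is,
unless `w` is an immediate specialization of `v`. -/
def divCoeff {X : Scheme.{u}} (v : X) (r : (X.residueField v)ˣ) (w : X) : ℤ :=
  if h : w ⋖ v then fracOrd (localSubring X (v := v) (w := w) h.le) r else 0

/-- Outside an open neighbourhood of `v`, only finitely many points are immediate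
specializations of `v`. -/
lemma finite_covBy_notMem {X : Scheme.{u}} [NoetherianSpace X] (v : X) (N : X.Opens)
    (hN : v ∈ N) : {w : X | w ⋖ v ∧ w ∉ N}.Finite := by
  have hcl : IsClosed (closure {v} ∩ (N : Set X)ᶜ) :=
    isClosed_closure.inter N.isOpen.isClosed_compl
  obtain ⟨S, hS, hSc, hSi, hSU⟩ := NoetherianSpace.exists_finite_set_isClosed_irreducible hcl
  have key : ∀ w : X, w ⋖ v → w ∉ N → ∃ Z ∈ S, closure {w} = Z := by
    intro w hw hwN
    have hwv : v ⤳ w := hw.le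
    have hmem : w ∈ ⋃₀ S := hSU ▸ ⟨hwv.mem_closure, hwN⟩
    obtain ⟨Z, hZ, hwZ⟩ := hmem
    obtain ⟨z, hz⟩ := QuasiSober.sober (hSi Z hZ) (hSc Z hZ)
    have hzZ : z ∈ Z := hz.mem
    have hz' : z ∈ closure {v} ∩ (N : Set X)ᶜ := hSU ▸ ⟨Z, hZ, hzZ⟩
    have hvz : v ⤳ z := specializes_iff_mem_closure.mpr hz'.1
    have hzw : z ⤳ w := hz.specializes hwZ
    refine ⟨Z, hZ, ?_⟩
    by_contra hne
    have hnwz : ¬ w ⤳ z := fun h => hne (by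
      rw [(h.antisymm hzw).eq]; exact hz)
    have hlt1 : w < z := lt_of_le_not_ge (show w ≤ z from hzw) hnwz
    have hlt2 : z < v := by
      refine lt_of_le_not_ge (show z ≤ v from hvz) fun h => ?_
      have h' : z ⤳ v := h
      exact hz'.2 (by rw [(h'.antisymm hvz).eq]; exact hN)
    exact hw.2 hlt1 hlt2
  refine Set.Finite.of_finite_image (f := fun w : X => closure {w}) (hS.subset ?_) ?_
  · rintro _ ⟨w, ⟨hw, hwN⟩, rfl⟩
    obtain ⟨Z, hZ, h⟩ := key w hw hwN
    simpa [h] using hZ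
  · intro a _ b _ hab
    exact ((specializes_iff_closure_subset.mpr hab.ge).antisymm
      (specializes_iff_closure_subset.mpr hab.le)).eq

lemma finite_divCoeff {X : Scheme.{u}} [NoetherianSpace X] (v : X) (r : (X.residueField v)ˣ) :
    (Function.support (divCoeff v r)).Finite := by
  have key : ∀ t : X.residueField v, ∃ N : X.Opens, v ∈ N ∧
      ∀ w ∈ N, ∀ h : v ⤳ w, t ∈ localSubring X h := by
    intro t
    obtain ⟨a, rfl⟩ := X.residue_surjective v t
    obtain ⟨N, hN, a', rfl⟩ := X.presheaf.exists_germ_eq a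
    refine ⟨N, hN, fun w hw h => ⟨X.presheaf.germ N w hw a', ?_⟩⟩
    rw [← X.presheaf.germ_stalkSpecializes hw h]
    rfl
  obtain ⟨N₁, h₁, k₁⟩ := key r
  obtain ⟨N₂, h₂, k₂⟩ := key ((r : X.residueField v)⁻¹)
  refine (finite_covBy_notMem v (N₁ ⊓ N₂) ⟨h₁, h₂⟩).subset fun w hw => ?_
  rw [Function.mem_support, divCoeff] at hw
  split_ifs at hw with h
  · exact ⟨h, fun hN => hw (fracOrd_eq_zero _ (k₁ w hN.1 _) (k₂ w hN.2 _))⟩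
  · exact absurd rfl hw

lemma covBy_genericPoint {X : Scheme.{u}} [IsIntegral X] {v : X} (hv : Order.coheight v = 1) :
    v ⋖ genericPoint X := by
  have hle : ∀ z : X, z ≤ genericPoint X := fun z => genericPoint_specializes z
  refine ⟨lt_of_le_not_ge (hle v) fun h => ?_, fun z hvz hz => ?_⟩
  · have : IsMax v := fun z _ => (hle z).trans h
    rw [Order.coheight_eq_zero.mpr this] at hv
    exact zero_ne_one hv
  · have h1 := Order.coheight_add_one_le hvz
    have h2 := Order.coheight_add_one_le hz
    rw [hv] at h1
    have h3 : Order.coheight z = 0 := by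
      generalize Order.coheight z = c at *
      cases c with
      | top => simp at h1
      | coe n => norm_cast at *; omega
    rw [h3] at h2
    simp at h2

open Classical in
lemma finite_ordAlong {X : Scheme.{u}} [IsIntegral X] [NoetherianSpace X] (f : X.functionFieldˣ) :
    (Function.support fun v : X => if Order.coheight v = 1 then
      ordAlong v (f : X.functionField) else 0).Finite := by
  have key : ∀ t : X.functionField, ∃ N : X.Opens, genericPoint X ∈ N ∧
      ∀ v ∈ N, t ∈ (algebraMap (X.presheaf.stalk v) X.functionField).range := by
    intro t
    obtain ⟨N, hN, a, rfl⟩ := X.presheaf.exists_germ_eq t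
    refine ⟨N, hN, fun v hv => ⟨X.presheaf.germ N v hv a, ?_⟩⟩
    have : Nonempty N := ⟨⟨_, hN⟩⟩
    exact X.algebraMap_germ_eq_germToFunctionField hv a
  obtain ⟨N₁, h₁, k₁⟩ := key f
  obtain ⟨N₂, h₂, k₂⟩ := key ((f : X.functionField)⁻¹)
  refine (finite_covBy_notMem (genericPoint X) (N₁ ⊓ N₂) ⟨h₁, h₂⟩).subset fun v hv => ?_
  rw [Function.mem_support] at hv
  split_ifs at hv with h
  · exact ⟨covBy_genericPoint h, fun hN => hv (fracOrd_eq_zero _ (k₁ v hN.1) (k₂ v hN.2))⟩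
  · exact absurd rfl hv

/-! ### Cycles, rational equivalences and the boundary map -/

/-- The group `Z_*(X)` of algebraic cycles: subvarieties of `X` are represented by their generic
points. -/
abbrev Cycles (X : Scheme.{u}) : Type u := X →₀ ℤ

/-- The group `W_*(X)` of rational equivalences: the direct sum of the multiplicative groups
`k(V)ˣ` over all subvarieties `V` of `X`. The point `v` is the generic point of `V`, so that
`k(V)` is the residue field at `v`. -/
abbrev RatEquivs (X : Scheme.{u}) : Type u :=
  DirectSum X fun v => Additive (X.residueField v)ˣ

/-- `W_*(T)` as a subgroup of `W_*(X)`, for a closed subset `T` of `X`. -/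
def ratEquivsOn {X : Scheme.{u}} (T : Set X) : AddSubgroup (RatEquivs X) where
  carrier := {ω | ∀ v ∉ T, ω v = 0}
  zero_mem' _ _ := rfl
  add_mem' {a b} ha hb v hv := by rw [DirectSum.add_apply, ha v hv, hb v hv, add_zero]
  neg_mem' {a} ha v hv := by
    change -(a v) = 0
    rw [ha v hv, neg_zero]

/-- The cycle of a nonzero rational function `r` on the subvariety with generic point `v`. -/
def divCycle {X : Scheme.{u}} [NoetherianSpace X] (v : X) (r : (X.residueField v)ˣ) : Cycles X :=
  Finsupp.ofSupportFinite (divCoeff v r) (finite_divCoeff v r)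

open Classical in
/-- The boundary map `∂ : W_*(X) → Z_*(X)`. -/
def boundary {X : Scheme.{u}} [NoetherianSpace X] (ω : RatEquivs X) : Cycles X :=
  ∑ v ∈ DFinsupp.support ω, divCycle v (ω v).toMul

open Classical in
/-- Pushforward of rational equivalences: a rational function on a subvariety `V` is sent to its
norm, a rational function on the closure of the image of `V` (and to `1` if the extension of
function fields is not finite). -/
def pushforward {X Y : Scheme.{u}} (f : X ⟶ Y) : RatEquivs X →+ RatEquivs Y :=
  DirectSum.toAddMonoid fun v =>
    letI : Algebra (Y.residueField (f v)) (X.residueField v) :=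
      (f.residueFieldMap v).hom.toAlgebra
    (DirectSum.of (fun w => Additive (Y.residueField w)ˣ) (f v)).comp
      (Units.map (Algebra.norm (Y.residueField (f v)) (S := X.residueField v))).toAdditive

open Classical in
/-- The Weil divisor of a nonzero rational function on an integral scheme. -/
def weilDivisor {X : Scheme.{u}} [IsIntegral X] [NoetherianSpace X] (f : X.functionFieldˣ) :
    Cycles X :=
  Finsupp.ofSupportFinite _ (finite_ordAlong f)

open Classical in
/-- The restriction of a rational function `f` to the subvariety with generic point `v`. It is
used only when `f` is a unit of `𝒪_{X,v}`, and it is then the class of `f` in `κ(v)ˣ`. -/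
def restrict {X : Scheme.{u}} [IsIntegral X] (f : X.functionFieldˣ) (v : X) :
    (X.residueField v)ˣ :=
  if h : ∃ a : (X.presheaf.stalk v)ˣ, algebraMap (X.presheaf.stalk v) X.functionField a = f then
    Units.map (X.residue v).hom.toMonoidHom h.choose
  else 1

/-! ### Normalization -/

/-- The inclusion of the generic point into an integral scheme. -/
abbrev genericInclusion (X : Scheme.{u}) [IsIntegral X] : Spec X.functionField ⟶ X :=
  X.fromSpecStalk (genericPoint X)

/-- The normalization of an integral scheme `X`, that is, the relative normalization of `X` in
the spectrum of its function field. -/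
abbrev normalization (X : Scheme.{u}) [IsIntegral X] : Scheme.{u} :=
  (genericInclusion X).normalization

/-- The normalization map. -/
abbrev normalizationMap (X : Scheme.{u}) [IsIntegral X] : normalization X ⟶ X :=
  (genericInclusion X).fromNormalization

lemma normalizationMap_genericPoint (X : Scheme.{u}) [IsIntegral X] :
    normalizationMap X (genericPoint (normalization X)) = genericPoint X := by
  let p : ↥(Spec X.functionField) := IsLocalRing.closedPoint X.functionField
  have h1 : normalizationMap X ((genericInclusion X).toNormalization p) = genericPoint X := by
    rw [← Scheme.Hom.comp_apply, Scheme.Hom.toNormalization_fromNormalization]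
    exact Scheme.fromSpecStalk_closedPoint
  have h2 := (genericPoint_specializes ((genericInclusion X).toNormalization p)).map
    (normalizationMap X).continuous
  rw [h1] at h2
  exact (h2.antisymm (genericPoint_specializes _)).eq

/-- The identification `π^* : k(X) → k(X̂)` of function fields given by the normalization map. -/
def pullbackFunction (X : Scheme.{u}) [IsIntegral X] :
    X.functionField →+* (normalization X).functionField :=
  (X.presheaf.stalkSpecializes (specializes_of_eq (normalizationMap_genericPoint X)) ≫
    (normalizationMap X).stalkMap (genericPoint (normalization X))).hom

/-- `π^* f` as an invertible rational function. -/
def pullbackUnit {X : Scheme.{u}} [IsIntegral X] (f : X.functionFieldˣ) :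
    (normalization X).functionFieldˣ :=
  Units.map (pullbackFunction X).toMonoidHom f

/-! ### Cartier divisors with two charts and their supports

Let `U, U'` be open with `U ∪ U' = X`, and let `x` be a nonzero rational function which is
invertible on `U ∩ U'`. The data `(x on U, 1 on U')` specify a Cartier divisor `D`. -/

open Classical in
/-- The order of `π^* D` along the closure of the point `V` of the normalization. -/
def pullbackOrd {X : Scheme.{u}} [IsIntegral X] (U : X.Opens) (x : X.functionFieldˣ)
    (V : normalization X) : ℤ :=
  if normalizationMap X V ∈ U then
    ordAlong V (pullbackUnit x : (normalization X).functionField)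
  else 0

/-- The support `|π^* D|` on the normalization: the union of the subvarieties of codimension one
along which `π^* D` has nonzero order. -/
def pullbackSupport {X : Scheme.{u}} [IsIntegral X] (U : X.Opens) (x : X.functionFieldˣ) :
    Set (normalization X) :=
  ⋃ V ∈ {V : normalization X | Order.coheight V = 1 ∧ pullbackOrd U x V ≠ 0}, closure {V}

/-- The support `|D| = π(|π^* D|)`. -/
def cartierSupport {X : Scheme.{u}} [IsIntegral X] (U : X.Opens) (x : X.functionFieldˣ) :
    Set X :=
  normalizationMap X '' pullbackSupport U x

/-- A `P`-divisor `(U, U', x)` on the integral scheme `X`. -/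
structure PDivisor (X : Scheme.{u}) [IsIntegral X] where
  U : X.Opens
  U' : X.Opens
  nonempty_U : (U : Set X).Nonempty
  nonempty_U' : (U' : Set X).Nonempty
  cover : U ⊔ U' = ⊤
  /-- The local defining function. -/
  x : X.functionFieldˣ
  isUnit : ∃ (h : genericPoint X ∈ U ⊓ U') (a : Γ(X, U ⊓ U')ˣ),
    X.presheaf.germ (U ⊓ U') (genericPoint X) h (a : Γ(X, U ⊓ U')) = (x : X.functionField)
  support_eq : cartierSupport U x = (U' : Set X)ᶜ

namespace PDivisor

variable {X : Scheme.{u}} [IsIntegral X] (D E : PDivisor X)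

/-- The support `|D|`. -/
def support : Set X := cartierSupport D.U D.x

/-- `|π^* D|`, a closed subset of the normalization. -/
def normSupport : Set (normalization X) := pullbackSupport D.U D.x

/-- `ord_V x`, the order of the local defining function along the prime divisor of the
normalization with generic point `V`. -/
def ordX (V : normalization X) : ℤ :=
  ordAlong V (pullbackUnit D.x : (normalization X).functionField)

open Classical in
/-- The Weil divisor `[D]`. -/
def cycle [NoetherianSpace X] : Cycles X :=
  (weilDivisor D.x).filter (· ∈ D.U)

open Classical in
/-- `D · [V]`, where `v` is the generic point of `V`. It is `0` if `V ⊆ |D|`. Otherwise `x` is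
invertible at `v` if `V` meets `U`, and `D · [V]` is the Weil divisor of the Cartier divisor
`D|_V`, which is given by `x|_V` on `U ∩ V` and by `1` on `U' ∩ V`. -/
def interSubvariety [NoetherianSpace X] (v : X) : Cycles X :=
  if v ∈ D.support then 0 else (divCycle v (restrict D.x v)).filter (· ∈ D.U)

/-- The cycle-level intersection `D · α`. -/
def inter [NoetherianSpace X] (α : Cycles X) : Cycles X :=
  α.sum fun v n => n • D.interSubvariety v

/-- The rational function `y ^ (ord_V x) / x ^ (ord_V y)` restricted to the prime divisor `V` of
the normalization, as an element of `k(V)ˣ`; here `x` and `y` are the local defining functions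
of `D` and `E`. -/
def tame (V : normalization X) : ((normalization X).residueField V)ˣ :=
  restrict (pullbackUnit E.x ^ D.ordX V / pullbackUnit D.x ^ E.ordX V) V

open Classical in
/-- The sum over `V ∈ S` of the rational equivalences `π_* (y ^ (ord_V x) / x ^ (ord_V y) |_V)`,
for a finite set `S` of prime divisors of the normalization. -/
def tameSum (S : Set (normalization X)) : RatEquivs X :=
  ∑ᶠ V ∈ S, pushforward (normalizationMap X)
    (DirectSum.of (fun V => Additive ((normalization X).residueField V)ˣ) V
      (Additive.ofMul (D.tame E V)))

/-- Every prime divisor of the normalization lying over `|D|` occurs in `π^* D`. -/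
def PullsBack : Prop :=
  ∀ V : normalization X, Order.coheight V = 1 → normalizationMap X V ∈ D.support →
    V ∈ D.normSupport

end PDivisor

/-- The generic points of the irreducible components of a closed subset `T`: the points of `T`
that are maximal for the order in which `v ≤ w` means that `v` is a specialization of `w`. -/
def componentPoints {X : Scheme.{u}} (T : Set X) : Set X :=
  {v | Maximal (· ∈ T) v}

/-- A variety over the field `k`: an integral scheme of finite type over `k`. -/
structure Variety (k : Type u) [Field k] where
  toScheme : Scheme.{u}
  structureMap : toScheme ⟶ Spec (CommRingCat.of k)
  [isIntegral : IsIntegral toScheme]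
  [locallyOfFiniteType : LocallyOfFiniteType structureMap]
  [quasiCompact : QuasiCompact structureMap]

attribute [instance] Variety.isIntegral Variety.locallyOfFiniteType Variety.quasiCompact

instance {k : Type u} [Field k] (X : Variety k) : IsNoetherian X.toScheme :=
  { toIsLocallyNoetherian := LocallyOfFiniteType.isLocallyNoetherian X.structureMap
    toCompactSpace := QuasiCompact.compactSpace_of_compactSpace X.structureMap }

end

end CycleIntersection

/-!
The coefficients of the two sides are compared at a point `w` of `X`. Only prime divisors `V` of the
normalization `X̂` matter for which `w` is an immediate specialization of `π(V)`. For these, write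
`ord_V` for the valuation and, for a rational function `z`, write `r_V(z)` for the order at `w` of
the norm to `κ(π(V))` of the residue of the unit part of `z`, taken with respect to a chosen
uniformizer at `V` (`Place.residueOrd`). The theorem rests on the reciprocity law

  `∑ (ord_V x * r_V y - ord_V y * r_V x) = 0`,

the sum being over all `V` with `w` in the closure of `π(V)` (`IsDivisorial.reciprocity`). The
summand is the order at `w` of the norm of the tame symbol `y ^ ord_V x / x ^ ord_V y`
(`Place.exists_tame`, `divCoeff_norm_tame`), and is therefore independent of the uniformizer.

The reciprocity law is proved by counting lengths over the local ring `A` at `w`. For a divisor `n`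
let `I_n` be the fractional ideal of functions `f` with `ord_V f ≥ n_V` for all `V` (`divisorial`).
Its leading coefficients at `V` form an `A`-lattice in `κ(V)` (`leadingLattice`), and the index of
this lattice is a function of `n` and `V`, that is, a function on the edges `n → n + V` of the
lattice of divisors. The step `n → n + W` changes it, at `V ≠ W`, by the length of
`I_n / (I_(n+V) + I_(n+W))`, which is symmetric in `V` and `W`; hence the edge function is closed
(`leadingIndex_closed`). Translation of `n` by the divisor of `z` multiplies the lattice by the
residue of the unit part of `z`, and so changes the index by `r_V z` (`leadingIndex_add_div`); this
is the formula that the index of `g L` in a lattice `L` is the order of the determinant of `g`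
(`submoduleIndex_map_eq_fracOrd_det`). For `x` and `y` without poles, the sums along the two paths
from `0` to `div x + div y`, through `div x` and through `div y`, agree, and their difference is the
reciprocity law (`sum_eq_sum_of_closed`). The general case follows because the law is multiplicative
in `x` and in `y`.

The same count in dimension one shows that the divisor of a rational function on `X` is the
pushforward of its divisor on `X̂` (`IsDivisorial.fracOrd_det_eq_finsum`, `weilDivisor_eq_sum`).
Thus `D · [E] - E · [D]` is a sum over prime divisors of `X̂` as well. Where `x` or `y` is a unit at
`π(V)`, the contribution of `V` is the negative of the summand in the reciprocity law; where `π(V)`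
lies in both supports it is zero. What remains is the sum of the summands over the `V` with
`π(V) ⊆ |D| ∩ |E|`, which is the coefficient of the boundary (`PDivisor.inter_cycle_sub_apply`). If `D` and
`E` have nonzero order along all prime divisors lying over their supports, these `V` are the common
components of `|π^* D|` and `|π^* E|` (`PDivisor.commonDivisors_eq_of_pullsBack`).

Commutative algebra enters through the hypotheses of the reciprocity law (`isDivisorial_place`): the
normalization of a variety is finite (`finite_integralClosure`), a normal Noetherian domain is the
intersection of its localizations at primes of height one (`exists_bot_covBy_of_notMem_range`), and
finitely generated algebras over a field are catenary (`primeDim_add_one`), so that `w` has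
codimension one in every prime divisor through it as soon as it has in one (`covBy_of_specializes`),
and prime divisors of `X̂` map to prime divisors of `X` (`coheight_normalizationMap`).
-/

namespace CycleIntersection

/-! ### Lengths of quotients of submodules -/

section QuotLength

variable {A : Type*} [CommRing A] {M M' : Type*} [AddCommGroup M] [Module A M]
  [AddCommGroup M'] [Module A M']

/-- The length of `N / L`, for submodules `L ≤ N` of a module. -/
noncomputable def quotLength (L N : Submodule A M) : ℕ∞ :=
  Module.length A (N ⧸ L.submoduleOf N)

lemma quotLength_eq_of_surjective {L N : Submodule A M} {Q : Type*} [AddCommGroup Q] [Module A Q]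
    (g : N →ₗ[A] Q) (hg : Function.Surjective g) (hk : LinearMap.ker g = L.submoduleOf N) :
    quotLength L N = Module.length A Q := by
  rw [quotLength, ← hk]
  exact (g.quotKerEquivOfSurjective hg).length_eq

lemma quotLength_map (f : M →ₗ[A] M') {S N : Submodule A M} (hSN : S ≤ N) :
    quotLength (S.map f) (N.map f) = quotLength (S ⊔ (LinearMap.ker f ⊓ N)) N := by
  symm
  refine quotLength_eq_of_surjective
    (((S.map f).submoduleOf (N.map f)).mkQ ∘ₗ (f.restrict (p := N) (q := N.map f)
      fun x hx => Submodule.mem_map_of_mem hx)) ?_ ?_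
  · refine (Submodule.mkQ_surjective _).comp ?_
    rintro ⟨_, x, hx, rfl⟩
    exact ⟨⟨x, hx⟩, rfl⟩
  · rw [LinearMap.ker_comp, Submodule.ker_mkQ]
    ext ⟨x, hx⟩
    simp only [Submodule.mem_comap, Submodule.submoduleOf, Submodule.subtype_apply,
      LinearMap.coe_restrict_apply, Submodule.mem_map, Submodule.mem_sup]
    constructor
    · rintro ⟨y, hy, hxy⟩
      exact ⟨y, hy, x - y, ⟨by simp [hxy], N.sub_mem hx (hSN hy)⟩, by abel⟩
    · rintro ⟨y, hy, z, hz, h⟩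
      refine ⟨y, hy, ?_⟩
      rw [← h, map_add, LinearMap.mem_ker.mp hz.1, add_zero]

lemma quotLength_map_of_injective (f : M →ₗ[A] M') (hf : Function.Injective f)
    {S N : Submodule A M} (hSN : S ≤ N) :
    quotLength (S.map f) (N.map f) = quotLength S N := by
  rw [quotLength_map f hSN, LinearMap.ker_eq_bot.mpr hf, bot_inf_eq, sup_bot_eq]

lemma quotLength_add {L M₁ N : Submodule A M} (h₁ : L ≤ M₁) (h₂ : M₁ ≤ N) :
    quotLength L N = quotLength L M₁ + quotLength M₁ N := by
  have e₁ : L.submoduleOf M₁ = (L.submoduleOf N).comap (Submodule.inclusion h₂) := rfl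
  have e₂ : L.submoduleOf N ≤ M₁.submoduleOf N := Submodule.comap_mono h₁
  refine Module.length_eq_add_of_exact
    ((L.submoduleOf M₁).mapQ (L.submoduleOf N) (Submodule.inclusion h₂) e₁.le)
    (Submodule.factor e₂) ?_ (Submodule.factor_surjective _) ?_
  · rw [← LinearMap.ker_eq_bot]
    exact Submodule.ker_liftQ_eq_bot' _ _ (by rw [LinearMap.ker_comp, Submodule.ker_mkQ]; exact e₁)
  · intro y
    obtain ⟨⟨y, hy⟩, rfl⟩ := Submodule.Quotient.mk_surjective _ y
    have e₃ : Submodule.factor e₂ (Submodule.Quotient.mk ⟨y, hy⟩) = 0 ↔ y ∈ M₁ :=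
      Submodule.Quotient.mk_eq_zero (M₁.submoduleOf N)
    rw [e₃]
    constructor
    · intro h
      exact ⟨Submodule.Quotient.mk ⟨y, h⟩, rfl⟩
    · rintro ⟨x, hx⟩
      obtain ⟨⟨x, hx'⟩, rfl⟩ := Submodule.Quotient.mk_surjective _ x
      have h2 : x - y ∈ L := (Submodule.Quotient.eq (L.submoduleOf N)).mp hx
      have h3 := M₁.sub_mem hx' (h₁ h2)
      rw [sub_sub_cancel] at h3
      exact h3

@[simp]
lemma quotLength_self (N : Submodule A M) : quotLength N N = 0 := by
  rw [quotLength, Submodule.submoduleOf_self]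
  exact Module.length_eq_zero

lemma quotLength_mono_left {L M₁ N : Submodule A M} (h₁ : L ≤ M₁) (h₂ : M₁ ≤ N) :
    quotLength M₁ N ≤ quotLength L N := by
  rw [quotLength_add h₁ h₂]
  exact le_add_self

/-- The second isomorphism theorem. -/
lemma quotLength_inf_eq_sup (S N : Submodule A M) :
    quotLength (S ⊓ N) N = quotLength S (S ⊔ N) := by
  rw [inf_comm, quotLength, quotLength, sup_comm]
  refine LinearEquiv.length_eq ?_
  refine (Submodule.quotEquivOfEq _ _ ?_).trans (LinearMap.quotientInfEquivSupQuotient N S)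
  rw [Submodule.submoduleOf, Submodule.comap_inf, Submodule.comap_subtype_self, top_inf_eq]

lemma quotLength_sup_le {S N T : Submodule A M} (h : S ≤ N) :
    quotLength (S ⊔ T) (N ⊔ T) ≤ quotLength S N := by
  have h1 : N ⊔ T = (S ⊔ T) ⊔ N := by
    rw [sup_right_comm, sup_eq_right.mpr h]
  rw [h1, ← quotLength_inf_eq_sup]
  exact quotLength_mono_left (le_inf le_sup_left h) inf_le_right

lemma quotLength_map_le (f : M →ₗ[A] M') {S N : Submodule A M} (hSN : S ≤ N) :
    quotLength (S.map f) (N.map f) ≤ quotLength S N := by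
  rw [quotLength_map f hSN]
  exact quotLength_mono_left le_sup_left (sup_le hSN inf_le_right)

lemma quotLength_pi {n : Type*} [Fintype n] (S N : n → Submodule A M) :
    quotLength (Submodule.pi Set.univ S) (Submodule.pi Set.univ N) =
      ∑ i, quotLength (S i) (N i) := by
  let g : Submodule.pi Set.univ N →ₗ[A] ((i : n) → N i ⧸ (S i).submoduleOf (N i)) :=
    LinearMap.pi fun i => ((S i).submoduleOf (N i)).mkQ ∘ₗ
      ((LinearMap.proj i).restrict (p := Submodule.pi Set.univ N) (q := N i)
        fun x hx => hx i (Set.mem_univ i))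
  rw [quotLength_eq_of_surjective g, Module.length_pi_of_fintype]
  · rfl
  · intro y
    choose z hz using fun i => Submodule.Quotient.mk_surjective _ (y i)
    exact ⟨⟨fun i => z i, fun i _ => (z i).2⟩, funext hz⟩
  · ext x
    rw [LinearMap.mem_ker, funext_iff]
    constructor
    · intro hx i _
      exact (Submodule.Quotient.mk_eq_zero ((S i).submoduleOf (N i))).mp (hx i)
    · intro hx i
      exact (Submodule.Quotient.mk_eq_zero ((S i).submoduleOf (N i))).mpr (hx i (Set.mem_univ i))

/-- The index of two commensurable submodules: `length (L / L ∩ L') - length (L' / L ∩ L')`. -/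
noncomputable def submoduleIndex (L L' : Submodule A M) : ℤ :=
  ((quotLength (L ⊓ L') L).toNat : ℤ) - ((quotLength (L ⊓ L') L').toNat : ℤ)

lemma submoduleIndex_eq {N L L' : Submodule A M} (h : N ≤ L) (h' : N ≤ L')
    (hf : quotLength N L ≠ ⊤) (hf' : quotLength N L' ≠ ⊤) :
    submoduleIndex L L' = ((quotLength N L).toNat : ℤ) - ((quotLength N L').toNat : ℤ) := by
  have h1 := quotLength_add (le_inf h h') (inf_le_left : L ⊓ L' ≤ L)
  have h2 := quotLength_add (le_inf h h') (inf_le_right : L ⊓ L' ≤ L')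
  rw [h1, Ne, ENat.add_eq_top, not_or] at hf
  rw [h2, Ne, ENat.add_eq_top, not_or] at hf'
  rw [submoduleIndex, h1, h2, ENat.toNat_add hf.1 hf.2, ENat.toNat_add hf'.1 hf'.2]
  push_cast
  ring

lemma submoduleIndex_of_le {L L' : Submodule A M} (h : L' ≤ L) :
    submoduleIndex L L' = (quotLength L' L).toNat := by
  rw [submoduleIndex, inf_eq_right.mpr h]
  simp

@[simp]
lemma submoduleIndex_self (L : Submodule A M) : submoduleIndex L L = 0 := by
  simp [submoduleIndex]

lemma submoduleIndex_map (f : M →ₗ[A] M') (hf : Function.Injective f) (L L' : Submodule A M) :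
    submoduleIndex (L.map f) (L'.map f) = submoduleIndex L L' := by
  rw [submoduleIndex, submoduleIndex, ← Submodule.map_inf f hf,
    quotLength_map_of_injective f hf inf_le_left, quotLength_map_of_injective f hf inf_le_right]

end QuotLength

/-! ### Lattices over one-dimensional domains -/

section Lattice

/-- The image of `A` in the field `κ` is a ring with fraction field `κ` all of whose quotients by
nonzero principal ideals have finite length. -/
structure IsOrderRing (A κ : Type*) [CommRing A] [Field κ] [Algebra A κ] : Prop where
  frac : ∀ z : κ, ∃ a b : A, algebraMap A κ b ≠ 0 ∧ z * algebraMap A κ b = algebraMap A κ a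
  finite : ∀ a : A, algebraMap A κ a ≠ 0 →
    quotLength (Submodule.span A {algebraMap A κ a}) (Submodule.span A {(1 : κ)}) ≠ ⊤

variable {A κ W : Type*} [CommRing A] [Field κ] [Algebra A κ] [AddCommGroup W] [Module κ W]
  [Module A W] [IsScalarTower A κ W]

variable (κ) in
/-- A finitely generated `A`-submodule of a `κ`-vector space that spans it. -/
structure IsLattice (L : Submodule A W) : Prop where
  fg : L.FG
  span_eq_top : Submodule.span κ (L : Set W) = ⊤

variable (A W) in
/-- Multiplication by `c ∈ κ` on a `κ`-vector space, as an `A`-linear map. -/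
def scale (c : κ) : W →ₗ[A] W := (c • (LinearMap.id : W →ₗ[κ] W)).restrictScalars A

@[simp]
lemma scale_apply (c : κ) (x : W) : scale A W c x = c • x := rfl

lemma scale_injective {c : κ} (hc : c ≠ 0) : Function.Injective (scale A W c) :=
  fun x y h => by simpa [hc] using congr(c⁻¹ • $h)

lemma map_scale_le (a : A) (L : Submodule A W) : L.map (scale A W (algebraMap A κ a)) ≤ L := by
  rintro _ ⟨x, hx, rfl⟩
  rw [scale_apply, algebraMap_smul]
  exact L.smul_mem a hx

lemma map_scale_mul (c d : κ) (L : Submodule A W) :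
    L.map (scale A W (c * d)) = (L.map (scale A W d)).map (scale A W c) := by
  rw [← Submodule.map_comp]
  congr 1
  ext x
  simp [mul_smul]

lemma IsLattice.map {W' : Type*} [AddCommGroup W'] [Module κ W'] [Module A W']
    [IsScalarTower A κ W'] {L : Submodule A W} (hL : IsLattice κ L)
    (g : W →ₗ[κ] W') (hg : Function.Surjective g) :
    IsLattice κ (L.map (g.restrictScalars A)) where
  fg := hL.fg.map _
  span_eq_top := by
    change Submodule.span κ (g '' L) = ⊤
    rw [Submodule.span_image, hL.span_eq_top, Submodule.map_top, LinearMap.range_eq_top.mpr hg]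

lemma IsLattice.map_scale {L : Submodule A W} (hL : IsLattice κ L) {c : κ} (hc : c ≠ 0) :
    IsLattice κ (L.map (scale A W c)) :=
  hL.map _ fun x => ⟨c⁻¹ • x, by simp [hc]⟩

variable (A κ) in
lemma isLattice_span_one : IsLattice κ (Submodule.span A {(1 : κ)}) where
  fg := Submodule.fg_span_singleton _
  span_eq_top := by
    rw [Submodule.span_span_of_tower]
    exact Ideal.span_singleton_one

lemma IsLattice.of_le {L L' : Submodule A W} (hL : IsLattice κ L) (h : L ≤ L') (hfg : L'.FG) :
    IsLattice κ L' :=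
  ⟨hfg, top_le_iff.mp (hL.span_eq_top.ge.trans (Submodule.span_mono h))⟩

lemma IsOrderRing.quotLength_scale_ne_top (H : IsOrderRing A κ) {L : Submodule A W} (hL : L.FG)
    {a : A} (ha : algebraMap A κ a ≠ 0) :
    quotLength (L.map (scale A W (algebraMap A κ a))) L ≠ ⊤ := by
  induction L, hL using Submodule.fg_induction with
  | singleton x =>
    let f : κ →ₗ[A] W := (LinearMap.toSpanSingleton κ W x).restrictScalars A
    have h1 : Submodule.span A {x} = (Submodule.span A {(1 : κ)}).map f := by
      rw [Submodule.map_span, Set.image_singleton]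
      simp [f]
    have h2 : (Submodule.span A {x}).map (scale A W (algebraMap A κ a)) =
        (Submodule.span A {algebraMap A κ a}).map f := by
      rw [Submodule.map_span, Set.image_singleton, Submodule.map_span, Set.image_singleton]
      simp [f]
    have h3 : Submodule.span A {algebraMap A κ a} ≤ Submodule.span A {(1 : κ)} := by
      rw [Submodule.span_singleton_le_iff_mem, Submodule.mem_span_singleton]
      exact ⟨a, (Algebra.algebraMap_eq_smul_one a).symm⟩
    rw [h2, h1]
    exact ne_top_of_le_ne_top (H.finite a ha) (quotLength_map_le f h3)
  | sup N₁ N₂ _ _ h₁ h₂ =>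
    have e₁ := map_scale_le (κ := κ) a N₁
    have e₂ := map_scale_le (κ := κ) a N₂
    rw [Submodule.map_sup, quotLength_add (sup_le_sup_right e₁ _) (sup_le_sup_left e₂ _)]
    rw [Ne, ENat.add_eq_top, not_or]
    refine ⟨ne_top_of_le_ne_top h₁ (quotLength_sup_le e₁), ?_⟩
    rw [sup_comm, sup_comm N₁]
    exact ne_top_of_le_ne_top h₂ (quotLength_sup_le e₂)

lemma IsOrderRing.exists_smul_mem (H : IsOrderRing A κ) {L : Submodule A W} (hL : IsLattice κ L)
    (x : W) : ∃ a : A, algebraMap A κ a ≠ 0 ∧ a • x ∈ L := by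
  have hx : x ∈ Submodule.span κ (L : Set W) := hL.span_eq_top ▸ Submodule.mem_top
  induction hx using Submodule.span_induction with
  | mem x h => exact ⟨1, by simp, by simpa using h⟩
  | zero => exact ⟨1, by simp, by simp⟩
  | add x y _ _ hx hy =>
    obtain ⟨a, ha, hax⟩ := hx
    obtain ⟨b, hb, hby⟩ := hy
    refine ⟨a * b, by simp [ha, hb], ?_⟩
    rw [smul_add, mul_comm, mul_smul, mul_comm, mul_smul]
    exact L.add_mem (L.smul_mem _ hax) (L.smul_mem _ hby)
  | smul c x _ hx =>
    obtain ⟨a, ha, hax⟩ := hx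
    obtain ⟨p, q, hq, h⟩ := H.frac c
    refine ⟨q * a, by simp [ha, hq], ?_⟩
    have : (q * a) • c • x = p • a • x := by
      rw [← algebraMap_smul κ (q * a), ← algebraMap_smul κ p, ← algebraMap_smul κ a, smul_smul,
        smul_smul, ← h, map_mul]
      ring_nf
    rw [this]
    exact L.smul_mem _ hax

lemma IsOrderRing.exists_map_scale_le (H : IsOrderRing A κ) {L L' : Submodule A W} (hL : L.FG)
    (hL' : IsLattice κ L') :
    ∃ a : A, algebraMap A κ a ≠ 0 ∧ L.map (scale A W (algebraMap A κ a)) ≤ L' := by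
  induction L, hL using Submodule.fg_induction with
  | singleton x =>
    obtain ⟨a, ha, h⟩ := H.exists_smul_mem hL' x
    refine ⟨a, ha, ?_⟩
    rw [Submodule.map_span, Set.image_singleton, Submodule.span_singleton_le_iff_mem, scale_apply,
      algebraMap_smul]
    exact h
  | sup N₁ N₂ _ _ h₁ h₂ =>
    obtain ⟨a, ha, h1⟩ := h₁
    obtain ⟨b, hb, h2⟩ := h₂
    refine ⟨a * b, by simp [ha, hb], ?_⟩
    rw [Submodule.map_sup]
    refine sup_le ?_ ?_
    · rw [mul_comm, map_mul, map_scale_mul]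
      exact (map_scale_le b _).trans h1
    · rw [map_mul, map_scale_mul]
      exact (map_scale_le a _).trans h2

lemma IsOrderRing.quotLength_ne_top (H : IsOrderRing A κ) {L L' : Submodule A W} (hL : L.FG)
    (hL' : IsLattice κ L') (h : L' ≤ L) : quotLength L' L ≠ ⊤ := by
  obtain ⟨a, ha, hle⟩ := H.exists_map_scale_le hL hL'
  exact ne_top_of_le_ne_top (H.quotLength_scale_ne_top hL ha) (quotLength_mono_left hle h)

/-- Two lattices contain a common lattice. -/
lemma IsOrderRing.exists_isLattice_le (H : IsOrderRing A κ) {L L' : Submodule A W}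
    (hL : IsLattice κ L) (hL' : IsLattice κ L') :
    ∃ N : Submodule A W, IsLattice κ N ∧ N ≤ L ∧ N ≤ L' := by
  obtain ⟨a, ha, h⟩ := H.exists_map_scale_le hL.fg hL'
  exact ⟨_, hL.map_scale ha, map_scale_le a L, h⟩

lemma IsOrderRing.submoduleIndex_eq (H : IsOrderRing A κ) {N L L' : Submodule A W}
    (hN : IsLattice κ N) (hL : IsLattice κ L) (hL' : IsLattice κ L') (h : N ≤ L) (h' : N ≤ L') :
    submoduleIndex L L' = ((quotLength N L).toNat : ℤ) - ((quotLength N L').toNat : ℤ) :=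
  CycleIntersection.submoduleIndex_eq h h' (H.quotLength_ne_top hL.fg hN h)
    (H.quotLength_ne_top hL'.fg hN h')

lemma IsOrderRing.submoduleIndex_add (H : IsOrderRing A κ) {L₁ L₂ L₃ : Submodule A W}
    (h₁ : IsLattice κ L₁) (h₂ : IsLattice κ L₂) (h₃ : IsLattice κ L₃) :
    submoduleIndex L₁ L₂ + submoduleIndex L₂ L₃ = submoduleIndex L₁ L₃ := by
  obtain ⟨M, hM, hM₁, hM₂⟩ := H.exists_isLattice_le h₁ h₂
  obtain ⟨N, hN, hNM, hN₃⟩ := H.exists_isLattice_le hM h₃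
  rw [H.submoduleIndex_eq hN h₁ h₂ (hNM.trans hM₁) (hNM.trans hM₂),
    H.submoduleIndex_eq hN h₂ h₃ (hNM.trans hM₂) hN₃,
    H.submoduleIndex_eq hN h₁ h₃ (hNM.trans hM₁) hN₃]
  ring

/-- The index of `g L` in `L` does not depend on the lattice `L`. -/
lemma IsOrderRing.submoduleIndex_map_eq (H : IsOrderRing A κ) {L L' : Submodule A W}
    (hL : IsLattice κ L) (hL' : IsLattice κ L') (g : W →ₗ[κ] W) (hg : Function.Bijective g) :
    submoduleIndex L (L.map (g.restrictScalars A)) =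
      submoduleIndex L' (L'.map (g.restrictScalars A)) := by
  have h1 := H.submoduleIndex_add hL hL' (hL'.map g hg.2)
  have h2 := H.submoduleIndex_add hL (hL.map g hg.2) (hL'.map g hg.2)
  rw [submoduleIndex_map (g.restrictScalars A) hg.1] at h2
  linarith

lemma IsOrderRing.submoduleIndex_map_comp (H : IsOrderRing A κ) {L : Submodule A W}
    (hL : IsLattice κ L) (g h : W →ₗ[κ] W) (hg : Function.Bijective g) (hh : Function.Bijective h) :
    submoduleIndex L (L.map ((g ∘ₗ h).restrictScalars A)) =
      submoduleIndex L (L.map (g.restrictScalars A)) +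
        submoduleIndex L (L.map (h.restrictScalars A)) := by
  have e : L.map ((g ∘ₗ h).restrictScalars A) =
      (L.map (h.restrictScalars A)).map (g.restrictScalars A) :=
    SetLike.coe_injective (Set.image_comp g h L)
  rw [e, ← H.submoduleIndex_add hL (hL.map g hg.2) ((hL.map h hh.2).map g hg.2),
    submoduleIndex_map (g.restrictScalars A) hg.1]

end Lattice

section Determinant

variable {A κ W : Type*} [CommRing A] [Field κ] [Algebra A κ] [AddCommGroup W] [Module κ W]
  [Module A W] [IsScalarTower A κ W]

lemma mem_span_one_iff {x : κ} :
    x ∈ Submodule.span A {(1 : κ)} ↔ ∃ a : A, algebraMap A κ a = x := by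
  simp [Submodule.mem_span_singleton, Algebra.algebraMap_eq_smul_one]

/-- The order of vanishing of an element of the image of `A` in `κ`, expressed through
`A`-submodules of `κ`. -/
lemma ord_range_eq_quotLength (p : (algebraMap A κ).range) :
    Ring.ord (algebraMap A κ).range p =
      quotLength (Submodule.span A {(p : κ)}) (Submodule.span A {(1 : κ)}) := by
  let : Algebra A (algebraMap A κ).range := (algebraMap A κ).rangeRestrict.toAlgebra
  have : IsScalarTower A (algebraMap A κ).range κ := IsScalarTower.of_algebraMap_eq fun _ => rfl
  have hs : Function.Surjective (algebraMap A (algebraMap A κ).range) :=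
    (algebraMap A κ).rangeRestrict_surjective
  rw [Ring.ord, ← Module.length_eq_of_surjective hs]
  symm
  let e : Submodule.span A {(1 : κ)} →ₗ[A] (algebraMap A κ).range :=
    { toFun x := ⟨x, mem_span_one_iff.mp x.2⟩
      map_add' _ _ := rfl
      map_smul' a x := Subtype.ext (Algebra.smul_def a (x : κ)) }
  refine quotLength_eq_of_surjective
    ((Ideal.Quotient.mkₐ A (Ideal.span {p})).toLinearMap ∘ₗ e) ?_ ?_
  · refine Ideal.Quotient.mk_surjective.comp ?_
    rintro ⟨_, a, rfl⟩
    exact ⟨⟨algebraMap A κ a, mem_span_one_iff.mpr ⟨a, rfl⟩⟩, rfl⟩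
  · ext x
    have hx : x ∈ LinearMap.ker ((Ideal.Quotient.mkₐ A (Ideal.span {p})).toLinearMap ∘ₗ e) ↔
      e x ∈ Ideal.span {p} := Ideal.Quotient.eq_zero_iff_mem
    rw [hx, Ideal.mem_span_singleton', Submodule.submoduleOf, Submodule.mem_comap,
      Submodule.mem_span_singleton]
    constructor
    · rintro ⟨⟨_, a, rfl⟩, h⟩
      exact ⟨a, by rw [Algebra.smul_def]; exact congrArg Subtype.val h⟩
    · rintro ⟨a, h⟩
      refine ⟨⟨_, a, rfl⟩, Subtype.ext ?_⟩
      rw [Algebra.smul_def] at h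
      exact h

lemma map_scale_span_singleton (c x : κ) :
    (Submodule.span A {x}).map (scale A κ c) = Submodule.span A {c * x} := by
  rw [Submodule.map_span, Set.image_singleton, scale_apply, smul_eq_mul]

/-- The order of an element `f` of `κ` is the index of `f O` in `O`, where `O` is the image of `A`.
In particular the order is independent of the way `f` is written as a fraction. -/
lemma fracOrd_eq_submoduleIndex (H : IsOrderRing A κ) {f : κ} (hf : f ≠ 0) :
    fracOrd (algebraMap A κ).range f =
      submoduleIndex (Submodule.span A {(1 : κ)})
        ((Submodule.span A {(1 : κ)}).map (scale A κ f)) := by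
  have hex : ∃ p : (algebraMap A κ).range × (algebraMap A κ).range,
      p.1 ≠ 0 ∧ p.2 ≠ 0 ∧ f * p.2 = p.1 := by
    obtain ⟨a, b, hb, h⟩ := H.frac f
    refine ⟨⟨⟨_, a, rfl⟩, ⟨_, b, rfl⟩⟩, ?_, ?_, h⟩
    · intro h0
      have : algebraMap A κ a = 0 := congrArg Subtype.val h0
      rw [this] at h
      exact (mul_ne_zero hf hb) h
    · intro h0
      exact hb (congrArg Subtype.val h0)
  rw [fracOrd, dif_pos hex]
  obtain ⟨h1, h2, h3⟩ := hex.choose_spec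
  generalize hex.choose = p at h1 h2 h3
  obtain ⟨p, q⟩ := p
  simp only at h1 h2 h3
  have hp : (p : κ) ≠ 0 := fun h => h1 (Subtype.ext h)
  have hq : (q : κ) ≠ 0 := fun h => h2 (Subtype.ext h)
  have hO := isLattice_span_one A κ
  have hle : ∀ r : (algebraMap A κ).range,
      Submodule.span A {(r : κ)} ≤ Submodule.span A {(1 : κ)} := fun r => by
    rw [Submodule.span_singleton_le_iff_mem]
    exact mem_span_one_iff.mpr r.2
  have e₁ : Submodule.span A {(p : κ)} =
      (Submodule.span A {(q : κ)}).map (scale A κ f) := by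
    rw [map_scale_span_singleton, h3]
  have e₂ : Submodule.span A {(p : κ)} = (Submodule.span A {(1 : κ)}).map (scale A κ (p : κ)) := by
    rw [map_scale_span_singleton, mul_one]
  rw [H.submoduleIndex_eq (e₂ ▸ hO.map_scale hp) hO (hO.map_scale hf) (hle p)
    (e₁ ▸ Submodule.map_mono (hle q)), ord_range_eq_quotLength, ord_range_eq_quotLength]
  congr 3
  rw [e₁, quotLength_map_of_injective _ (scale_injective hf) (hle q)]

variable (A) in
/-- The index of `z O` in `O`, where `O` is the image of `A` in the line `κ`. -/
noncomputable def latticeOrd (z : κ) : ℤ :=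
  submoduleIndex (Submodule.span A {(1 : κ)}) ((Submodule.span A {(1 : κ)}).map (scale A κ z))

lemma latticeOrd_mul (H : IsOrderRing A κ) {y z : κ} (hy : y ≠ 0) (hz : z ≠ 0) :
    latticeOrd A (y * z) = latticeOrd A y + latticeOrd A z := by
  have hO := isLattice_span_one A κ
  rw [latticeOrd, latticeOrd, latticeOrd, map_scale_mul,
    ← H.submoduleIndex_add hO (hO.map_scale hy) ((hO.map_scale hz).map_scale hy),
    submoduleIndex_map _ (scale_injective hy)]

@[simp]
lemma latticeOrd_one : latticeOrd A (1 : κ) = 0 := by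
  have : scale A κ (1 : κ) = LinearMap.id := by ext; simp
  rw [latticeOrd, this, Submodule.map_id, submoduleIndex_self]

lemma latticeOrd_prod (H : IsOrderRing A κ) {n : Type*} (s : Finset n) (D : n → κ)
    (hD : ∀ i, D i ≠ 0) :
    latticeOrd A (∏ i ∈ s, D i) = ∑ i ∈ s, latticeOrd A (D i) := by
  classical
  induction s using Finset.induction_on with
  | empty => simp
  | insert i s hi ih =>
    rw [Finset.prod_insert hi, Finset.sum_insert hi,
      latticeOrd_mul H (hD i) (Finset.prod_ne_zero_iff.mpr fun j _ => hD j), ih]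

section Pi

variable {n : Type*} [Fintype n]

lemma isLattice_pi {L : n → Submodule A κ} (hL : ∀ i, IsLattice κ (L i)) :
    IsLattice κ (Submodule.pi Set.univ L) where
  fg := by
    classical
    rw [← Submodule.iSup_map_single]
    exact Submodule.fg_iSup _ fun i => (hL i).fg.map _
  span_eq_top := by
    classical
    refine eq_top_iff.mpr fun x _ => ?_
    rw [← Finset.univ_sum_single x]
    refine Submodule.sum_mem _ fun i _ => ?_
    have h : (Submodule.span κ (L i : Set κ)).map (LinearMap.single κ (fun _ : n => κ) i) ≤
        Submodule.span κ (Submodule.pi Set.univ L : Submodule A (n → κ)) := by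
      rw [Submodule.map_span]
      refine Submodule.span_mono ?_
      rintro _ ⟨y, hy, rfl⟩ j _
      by_cases hj : j = i
      · subst hj
        simpa using hy
      · simp [hj]
    exact h ⟨x i, (hL i).span_eq_top ▸ Submodule.mem_top, rfl⟩

/-- For a diagonal matrix the index is computed on the standard lattice, one coordinate at a time.
-/
lemma submoduleIndex_diagonal [DecidableEq n] (H : IsOrderRing A κ) (D : n → κ)
    (hD : ∀ i, D i ≠ 0) {L : Submodule A (n → κ)} (hL : IsLattice κ L) :
    submoduleIndex L (L.map ((Matrix.toLin' (Matrix.diagonal D)).restrictScalars A)) =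
      latticeOrd A (∏ i, D i) := by
  have hO := isLattice_span_one A κ
  have hbij : Function.Bijective (Matrix.toLin' (Matrix.diagonal D)) := by
    refine ⟨fun x y h => funext fun i => ?_, fun y => ⟨fun i => (D i)⁻¹ * y i, funext fun i => ?_⟩⟩
    · have := congrFun h i
      simpa [Matrix.mulVec_diagonal, hD i] using this
    · simp [Matrix.mulVec_diagonal, hD i]
  set O : Submodule A κ := Submodule.span A {(1 : κ)}
  have hOn := isLattice_pi (n := n) (L := fun _ => O) fun _ => hO
  rw [H.submoduleIndex_map_eq hL hOn _ hbij, latticeOrd_prod H _ _ hD]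
  have e : (Submodule.pi Set.univ fun _ : n => O).map
      ((Matrix.toLin' (Matrix.diagonal D)).restrictScalars A) =
      Submodule.pi Set.univ fun i => O.map (scale A κ (D i)) := by
    ext x
    simp only [Submodule.mem_map, Submodule.mem_pi]
    constructor
    · rintro ⟨y, hy, rfl⟩ i _
      exact ⟨y i, hy i trivial, by simp [Matrix.mulVec_diagonal]⟩
    · intro h
      choose y hy hyx using fun i => h i trivial
      exact ⟨y, fun i _ => hy i, funext fun i => by simpa [Matrix.mulVec_diagonal] using hyx i⟩
  rw [e]
  choose N hN hN₁ hN₂ using fun i => H.exists_isLattice_le hO (hO.map_scale (hD i))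
  have hNi : ∀ i, latticeOrd A (D i) = _ := fun i =>
    H.submoduleIndex_eq (hN i) hO (hO.map_scale (hD i)) (hN₁ i) (hN₂ i)
  rw [H.submoduleIndex_eq (isLattice_pi hN) hOn (isLattice_pi fun i => hO.map_scale (hD i))
    (Submodule.pi_mono fun i _ => hN₁ i) (Submodule.pi_mono fun i _ => hN₂ i),
    quotLength_pi, quotLength_pi, ENat.toNat_sum, ENat.toNat_sum]
  · push_cast
    rw [← Finset.sum_sub_distrib]
    exact Finset.sum_congr rfl fun i _ => (hNi i).symm
  · exact fun i _ => H.quotLength_ne_top (hO.map_scale (hD i)).fg (hN i) (hN₂ i)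
  · exact fun i _ => H.quotLength_ne_top hO.fg (hN i) (hN₁ i)

/-- A transvection maps some lattice onto itself, so that its index is zero on every lattice. -/
lemma submoduleIndex_transvection [DecidableEq n] (H : IsOrderRing A κ)
    (t : Matrix.TransvectionStruct n κ) {L : Submodule A (n → κ)} (hL : IsLattice κ L) :
    submoduleIndex L (L.map ((Matrix.toLin' t.toMatrix).restrictScalars A)) = 0 := by
  have hO := isLattice_span_one A κ
  set O : Submodule A κ := Submodule.span A {(1 : κ)}
  -- a lattice that is stable under the transvection and its inverse
  set M : n → Submodule A κ := fun i => if i = t.i then O ⊔ O.map (scale A κ t.c) else O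
  have hM : ∀ i, IsLattice κ (M i) := by
    intro i
    by_cases h : i = t.i
    · simp only [M, if_pos h]
      exact hO.of_le le_sup_left (hO.fg.sup (hO.fg.map _))
    · simpa only [M, if_neg h] using hO
  have hstab : ∀ c : κ, O.map (scale A κ c) ≤ M t.i → ∀ y ∈ Submodule.pi Set.univ M,
      Matrix.toLin' (Matrix.transvection t.i t.j c) y ∈ Submodule.pi Set.univ M := by
    intro c hc y hy i _
    rw [Matrix.transvection, Matrix.toLin'_apply, Matrix.add_mulVec, Matrix.one_mulVec,
      Pi.add_apply]
    refine (M i).add_mem (hy i trivial) ?_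
    by_cases hi : i = t.i
    · subst hi
      have hj := hy t.j trivial
      simp only [M, if_neg t.hij.symm] at hj
      rw [Matrix.single_mulVec]
      simpa using hc ⟨_, hj, rfl⟩
    · rw [Matrix.single_mulVec]
      simp [hi]
  have hc : O.map (scale A κ t.c) ≤ M t.i := by simp [M]
  have hc' : O.map (scale A κ (-t.c)) ≤ M t.i := by
    rintro _ ⟨y, hy, rfl⟩
    have := (M t.i).neg_mem (hc ⟨y, hy, rfl⟩)
    simpa using this
  have hinv : ∀ (c : κ) (y : n → κ), Matrix.toLin' (Matrix.transvection t.i t.j c)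
      (Matrix.toLin' (Matrix.transvection t.i t.j (-c)) y) = y := by
    intro c y
    rw [← LinearMap.comp_apply, ← Matrix.toLin'_mul, Matrix.transvection_mul_transvection_same
      _ _ t.hij]
    simp
  have hbij : Function.Bijective (Matrix.toLin' t.toMatrix) :=
    ⟨Function.LeftInverse.injective (g := Matrix.toLin' (Matrix.transvection t.i t.j (-t.c)))
      fun y => by
      have := hinv (-t.c) y
      rwa [neg_neg] at this, fun y => ⟨_, hinv t.c y⟩⟩
  rw [H.submoduleIndex_map_eq hL (isLattice_pi hM) _ hbij]
  have : (Submodule.pi Set.univ M).map ((Matrix.toLin' t.toMatrix).restrictScalars A) =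
      Submodule.pi Set.univ M := by
    refine le_antisymm ?_ fun y hy => ⟨_, hstab _ hc' y hy, hinv t.c y⟩
    rintro _ ⟨y, hy, rfl⟩
    exact hstab _ hc y hy
  rw [this, submoduleIndex_self]

/-- The determinant formula for matrices: both sides are multiplicative, and the invertible
matrices are generated by diagonal matrices and transvections. -/
lemma submoduleIndex_toLin' [DecidableEq n] (H : IsOrderRing A κ) (g : Matrix n n κ)
    (hg : g.det ≠ 0) :
    ∀ L : Submodule A (n → κ), IsLattice κ L →
    submoduleIndex L (L.map ((Matrix.toLin' g).restrictScalars A)) = latticeOrd A g.det := by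
  have hbij : ∀ B : Matrix n n κ, B.det ≠ 0 → Function.Bijective (Matrix.toLin' B) := fun B hB =>
    (Matrix.toLin'OfInv (Matrix.mul_nonsing_inv B hB.isUnit)
      (Matrix.nonsing_inv_mul B hB.isUnit)).symm.bijective
  refine Matrix.diagonal_transvection_induction_of_det_ne_zero (fun g => ∀ L : Submodule A (n → κ),
    IsLattice κ L → submoduleIndex L (L.map ((Matrix.toLin' g).restrictScalars A)) =
      latticeOrd A g.det) g hg ?_ ?_ ?_
  · intro D hD L hL
    rw [Matrix.det_diagonal] at hD ⊢
    exact submoduleIndex_diagonal H D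
      (fun i => Finset.prod_ne_zero_iff.mp hD i (Finset.mem_univ i)) hL
  · intro t L hL
    rw [submoduleIndex_transvection H t hL]
    simp
  · intro B C hB hC h₁ h₂ L hL
    rw [Matrix.toLin'_mul, H.submoduleIndex_map_comp hL _ _ (hbij B hB) (hbij C hC), h₁ L hL,
      h₂ L hL, Matrix.det_mul, latticeOrd_mul H hB hC]

end Pi

/-- The index of `g L` in a lattice `L` is the order of the determinant of `g`. -/
theorem submoduleIndex_map_eq_fracOrd_det [FiniteDimensional κ W] (H : IsOrderRing A κ)
    {L : Submodule A W} (hL : IsLattice κ L) (g : W →ₗ[κ] W) (hg : LinearMap.det g ≠ 0) :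
    submoduleIndex L (L.map (g.restrictScalars A)) =
      fracOrd (algebraMap A κ).range (LinearMap.det g) := by
  classical
  rw [fracOrd_eq_submoduleIndex H hg]
  let b := Module.finBasis κ W
  let e : W ≃ₗ[κ] (Fin (Module.finrank κ W) → κ) := b.equivFun
  have hdet : (LinearMap.toMatrix b b g).det = LinearMap.det g := LinearMap.det_toMatrix b g
  have h := submoduleIndex_toLin' H (LinearMap.toMatrix b b g) (hdet ▸ hg) _
    (hL.map e.toLinearMap e.surjective)
  rw [hdet] at h
  change _ = latticeOrd A (LinearMap.det g)
  rw [← h]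
  have h2 : (L.map (e.toLinearMap.restrictScalars A)).map
      ((Matrix.toLin' (LinearMap.toMatrix b b g)).restrictScalars A) =
      (L.map (g.restrictScalars A)).map (e.toLinearMap.restrictScalars A) := by
    rw [← Submodule.map_comp, ← Submodule.map_comp]
    congr 1
    ext x i
    have := LinearMap.toMatrix_mulVec_repr b b g x
    exact congrFun this i
  rw [h2, submoduleIndex_map (e.toLinearMap.restrictScalars A) e.injective]

end Determinant

noncomputable section

/-! ### Discrete valuations and the divisorial filtration -/

/-- A discrete valuation ring `O` of the field `K` over the base ring `A`, given with a uniformizer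
and its residue field `κ`. The field `κ₀` lies between `A` and `κ`; in the geometric
situation it is the residue field of the image of the centre of `O`. That `O` is a discrete
valuation ring with fraction field `K` is encoded by `exists_eq`: every nonzero element of `K` is a
power of the uniformizer times a unit of `O`. Together with `res_unif`, it makes the kernel of
`res` the maximal ideal of `O`. -/
structure Place (A K : Type u) [CommRing A] [Field K] [Algebra A K] where
  O : Type u
  κ₀ : Type u
  κ : Type u
  [commRing : CommRing O]
  [algebra : Algebra A O]
  [field₀ : Field κ₀]
  [field : Field κ]
  [algebra₀ : Algebra A κ₀]
  [algebra' : Algebra A κ]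
  [algebra₀' : Algebra κ₀ κ]
  [tower : IsScalarTower A κ₀ κ]
  toField : O →ₐ[A] K
  toField_injective : Function.Injective toField
  res : O →ₐ[A] κ
  unif : O
  unif_ne_zero : unif ≠ 0
  res_unif : res unif = 0
  exists_eq : ∀ z : K, z ≠ 0 → ∃ (n : ℤ) (v : Oˣ), z = toField unif ^ n * toField v

namespace Place

attribute [instance] Place.commRing Place.algebra Place.field₀ Place.field Place.algebra₀
  Place.algebra' Place.algebra₀' Place.tower

variable {A K : Type u} [CommRing A] [Field K] [Algebra A K] (P : Place A K)

lemma toField_unif_ne_zero : P.toField P.unif ≠ 0 :=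
  (map_ne_zero_iff _ P.toField_injective).mpr P.unif_ne_zero

lemma toField_unit_ne_zero (v : P.Oˣ) : P.toField v ≠ 0 := (v.map P.toField.toMonoidHom).ne_zero

lemma res_unit_ne_zero (v : P.Oˣ) : P.res v ≠ 0 := (v.map P.res.toMonoidHom).ne_zero

/-- Multiplication by the `n`-th power of the uniformizer, as a map from `O` to `K`. -/
def mulPow (n : ℤ) : P.O →ₗ[A] K :=
  (LinearMap.mulLeft A (P.toField P.unif ^ n)) ∘ₗ P.toField.toLinearMap

@[simp]
lemma mulPow_apply (n : ℤ) (x : P.O) : P.mulPow n x = P.toField P.unif ^ n * P.toField x := rfl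

lemma mulPow_injective (n : ℤ) : Function.Injective (P.mulPow n) := fun _ _ h =>
  P.toField_injective (mul_left_cancel₀ (zpow_ne_zero n P.toField_unif_ne_zero) h)

lemma mulPow_add_nat (n : ℤ) (k : ℕ) (x : P.O) :
    P.mulPow (n + k) x = P.mulPow n (P.unif ^ k * x) := by
  simp [zpow_add₀ P.toField_unif_ne_zero, mul_assoc]

lemma eq_of_mulPow_unit_eq {n m : ℤ} {v w : P.Oˣ} (h : P.mulPow n v = P.mulPow m w) :
    n = m ∧ v = w := by
  have key : ∀ {n m : ℤ} {v w : P.Oˣ}, P.mulPow n v = P.mulPow m w → ¬ n < m := by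
    intro n m v w h hlt
    obtain ⟨k, hk⟩ := Int.le.dest hlt.le
    rw [← hk, mulPow_add_nat] at h
    have h1 := P.mulPow_injective n h
    have h2 : k ≠ 0 := by omega
    refine P.res_unit_ne_zero v ?_
    rw [h1, map_mul, map_pow, P.res_unif, zero_pow h2, zero_mul]
  have hnm : n = m := le_antisymm (not_lt.mp (key h.symm)) (not_lt.mp (key h))
  subst hnm
  exact ⟨rfl, Units.ext (P.mulPow_injective n h)⟩

open Classical in
/-- The normalized valuation; its value at `0` is set to `0`. -/
def ord (z : K) : ℤ := if h : z ≠ 0 then (P.exists_eq z h).choose else 0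

open Classical in
/-- The unit `z / π ^ ord z`; its value at `0` is set to `1`. -/
def unitPart (z : K) : P.Oˣ := if h : z ≠ 0 then (P.exists_eq z h).choose_spec.choose else 1

lemma mulPow_ord_unitPart {z : K} (hz : z ≠ 0) : P.mulPow (P.ord z) (P.unitPart z) = z := by
  rw [ord, unitPart, dif_pos hz, dif_pos hz]
  exact (P.exists_eq z hz).choose_spec.choose_spec.symm

lemma ord_unitPart_mulPow (n : ℤ) (v : P.Oˣ) :
    P.ord (P.mulPow n v) = n ∧ P.unitPart (P.mulPow n v) = v := by
  have hz : P.mulPow n v ≠ 0 :=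
    mul_ne_zero (zpow_ne_zero n P.toField_unif_ne_zero) (P.toField_unit_ne_zero v)
  exact P.eq_of_mulPow_unit_eq (P.mulPow_ord_unitPart hz)

lemma mulPow_mul (n m : ℤ) (v w : P.O) :
    P.mulPow n v * P.mulPow m w = P.mulPow (n + m) (v * w) := by
  simp only [mulPow_apply, zpow_add₀ P.toField_unif_ne_zero, map_mul]
  ring

lemma ord_unitPart_mul {y z : K} (hy : y ≠ 0) (hz : z ≠ 0) :
    P.ord (y * z) = P.ord y + P.ord z ∧ P.unitPart (y * z) = P.unitPart y * P.unitPart z := by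
  have : y * z = P.mulPow (P.ord y + P.ord z) ↑(P.unitPart y * P.unitPart z) := by
    rw [Units.val_mul, ← mulPow_mul, mulPow_ord_unitPart _ hy, mulPow_ord_unitPart _ hz]
  rw [this]
  exact P.ord_unitPart_mulPow _ _

lemma ord_mul {y z : K} (hy : y ≠ 0) (hz : z ≠ 0) : P.ord (y * z) = P.ord y + P.ord z :=
  (P.ord_unitPart_mul hy hz).1

lemma unitPart_mul {y z : K} (hy : y ≠ 0) (hz : z ≠ 0) :
    P.unitPart (y * z) = P.unitPart y * P.unitPart z :=
  (P.ord_unitPart_mul hy hz).2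

@[simp]
lemma ord_one : P.ord 1 = 0 := by
  have h := P.ord_mul (one_ne_zero (α := K)) one_ne_zero
  rw [mul_one] at h
  linarith

lemma ord_inv (z : K) : P.ord z⁻¹ = - P.ord z := by
  by_cases hz : z = 0
  · simp [hz, ord]
  have h := P.ord_mul hz (inv_ne_zero hz)
  rw [mul_inv_cancel₀ hz, ord_one] at h
  linarith

lemma ord_pow (z : K) (hz : z ≠ 0) (n : ℕ) : P.ord (z ^ n) = n * P.ord z := by
  induction n with
  | zero => simp
  | succ n ih =>
    rw [pow_succ, P.ord_mul (pow_ne_zero n hz) hz, ih]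
    push_cast
    ring

/-- The fractional ideal of elements of valuation at least `n`. -/
def fil (n : ℤ) : Submodule A K := LinearMap.range (P.mulPow n)

lemma mem_fil {n : ℤ} {z : K} (hz : z ≠ 0) : z ∈ P.fil n ↔ n ≤ P.ord z := by
  constructor
  · rintro ⟨x, rfl⟩
    by_contra! hlt
    obtain ⟨k, hk⟩ := Int.le.dest hlt.le
    set m := P.ord (P.mulPow n x) with hm
    have h := P.mulPow_ord_unitPart hz
    rw [← hm, ← hk, mulPow_add_nat] at h
    have h1 := P.mulPow_injective m h
    have h2 : k ≠ 0 := by omega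
    refine P.res_unit_ne_zero _ (?_ : P.res (P.unitPart (P.mulPow n x)) = 0)
    have h3 : P.unitPart (P.mulPow n x) = P.unif ^ k * x := by
      rw [← h1, ← mulPow_add_nat, hk]
    rw [h3, map_mul, map_pow, P.res_unif, zero_pow h2, zero_mul]
  · intro h
    obtain ⟨k, hk⟩ := Int.le.dest h
    refine ⟨P.unif ^ k * P.unitPart z, ?_⟩
    rw [← mulPow_add_nat, hk, P.mulPow_ord_unitPart hz]

lemma fil_antitone {n m : ℤ} (h : n ≤ m) : P.fil m ≤ P.fil n := by
  intro z hz
  by_cases h0 : z = 0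
  · exact h0 ▸ zero_mem _
  · exact (P.mem_fil h0).mpr (h.trans ((P.mem_fil h0).mp hz))

lemma map_mulPow_comap {n : ℤ} {M : Submodule A K} (h : M ≤ P.fil n) :
    (M.comap (P.mulPow n)).map (P.mulPow n) = M := by
  rw [Submodule.map_comap_eq]
  exact inf_eq_right.mpr h

/-- An element of `O` has residue zero if and only if multiplying it by `π ^ n` lands in valuation
at least `n + 1`. -/
lemma res_eq_zero_iff (n : ℤ) (x : P.O) : P.res x = 0 ↔ P.mulPow n x ∈ P.fil (n + 1) := by
  constructor
  · intro hx
    by_cases h0 : x = 0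
    · simp [h0]
    have hz : P.toField x ≠ 0 := (map_ne_zero_iff _ P.toField_injective).mpr h0
    have h1 : P.mulPow 0 x = P.toField x := by simp
    have h2 : 0 ≤ P.ord (P.toField x) := (P.mem_fil hz).mp ⟨x, h1⟩
    have h3 : P.ord (P.toField x) ≠ 0 := by
      intro h
      have h4 := P.mulPow_ord_unitPart hz
      rw [h, ← h1] at h4
      exact P.res_unit_ne_zero _ ((P.mulPow_injective 0 h4) ▸ hx)
    obtain ⟨y, hy⟩ := (P.mem_fil hz).mpr (by omega : 1 ≤ P.ord (P.toField x))
    refine ⟨y, ?_⟩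
    rw [mulPow_apply, mulPow_apply, ← hy, mulPow_apply, ← mul_assoc,
      zpow_add₀ P.toField_unif_ne_zero]
  · rintro ⟨y, hy⟩
    have h := P.mulPow_add_nat n 1 y
    rw [Nat.cast_one, hy] at h
    rw [P.mulPow_injective n h, map_mul, map_pow, P.res_unif]
    simp

/-- The order, in the one-dimensional image of `A` in `κ₀`, of the norm of the residue of the unit
part of `z`. -/
def residueOrd (z : K) : ℤ :=
  fracOrd (algebraMap A P.κ₀).range (Algebra.norm P.κ₀ (P.res (P.unitPart z)))

end Place

variable {A K : Type u} [CommRing A] [Field K] [Algebra A K]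
variable {ι : Type*} (P : ι → Place A K)

/-- The elements of `K` whose valuation at each place is at least the one prescribed by `n`. -/
def divisorial (n : ι →₀ ℤ) : Submodule A K := ⨅ V, (P V).fil (n V)

lemma mem_divisorial {n : ι →₀ ℤ} {z : K} (hz : z ≠ 0) :
    z ∈ divisorial P n ↔ ∀ V, n V ≤ (P V).ord z := by
  simp [divisorial, Submodule.mem_iInf, Place.mem_fil, hz]

lemma divisorial_le (n : ι →₀ ℤ) (V : ι) : divisorial P n ≤ (P V).fil (n V) := iInf_le _ V

lemma divisorial_antitone {n m : ι →₀ ℤ} (h : n ≤ m) : divisorial P m ≤ divisorial P n :=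
  iInf_mono fun V => (P V).fil_antitone (h V)

/-- A family of places that behaves like the prime divisors of a normal scheme near the fibre
over a point with local ring `A`. The submodule `divisorial P 0` plays the role of the ring of
regular functions: it is finitely generated, it contains enough elements to separate the places, and
its residues span each residue field over `κ₀`. -/
structure IsDivisorial : Prop where
  finite_ord : ∀ z : K, z ≠ 0 → {V | (P V).ord z ≠ 0}.Finite
  fg : (divisorial P 0).FG
  separated : ∀ V W, V ≠ W → ∃ b ∈ divisorial P 0, b ≠ 0 ∧ (P V).ord b = 0 ∧ 0 < (P W).ord b
  finiteDimensional : ∀ V, FiniteDimensional (P V).κ₀ (P V).κ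
  span_res : ∀ V, Submodule.span (P V).κ₀
    ((P V).res '' {x | (P V).toField x ∈ divisorial P 0}) = ⊤

namespace IsDivisorial

variable {P} (hP : IsDivisorial P)

/-- The divisor of a nonzero element. -/
def div (z : K) (hz : z ≠ 0) : ι →₀ ℤ :=
  Finsupp.ofSupportFinite (fun V => (P V).ord z) (hP.finite_ord z hz)

@[simp]
lemma div_apply {z : K} (hz : z ≠ 0) (V : ι) : hP.div z hz V = (P V).ord z := rfl

/-- Translating the bounds by a principal divisor multiplies the fractional ideal by the function.
-/
lemma divisorial_add_div (n : ι →₀ ℤ) {z : K} (hz : z ≠ 0) :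
    divisorial P (n + hP.div z hz) = (divisorial P n).map (scale A K z) := by
  ext y
  constructor
  · intro hy
    refine ⟨z⁻¹ * y, ?_, by simp [hz]⟩
    by_cases h0 : y = 0
    · simp [h0]
    refine (mem_divisorial P (by simp [hz, h0])).mpr fun V => ?_
    have := (mem_divisorial P h0).mp hy V
    rw [(P V).ord_mul (inv_ne_zero hz) h0, (P V).ord_inv]
    simp at this
    linarith
  · rintro ⟨y, hy, rfl⟩
    by_cases h0 : y = 0
    · simp [h0]
    rw [scale_apply, smul_eq_mul]
    refine (mem_divisorial P (by simp [hz, h0])).mpr fun V => ?_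
    have := (mem_divisorial P h0).mp hy V
    rw [(P V).ord_mul hz h0]
    simp
    linarith

include hP in
/-- There are elements with prescribed lower bounds for their divisor that attain the bound at a
given place. -/
lemma exists_ord_eq (n : ι →₀ ℤ) (V : ι) :
    ∃ z : K, z ≠ 0 ∧ (P V).ord z = n V ∧ ∀ W, n W ≤ (P W).ord z := by
  classical
  -- The power of the uniformizer at `V` has the right order at `V`, but violates the other bounds
  -- at finitely many places `W`. At each of them it is corrected by a power of an element that is a
  -- unit at `V` and vanishes at `W`.
  set z₀ : K := (P V).mulPow (n V) ((1 : (P V).Oˣ) : (P V).O) with hz₀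
  have h0 : z₀ ≠ 0 :=
    mul_ne_zero (zpow_ne_zero _ (P V).toField_unif_ne_zero) ((P V).toField_unit_ne_zero 1)
  have h1 : (P V).ord z₀ = n V := ((P V).ord_unitPart_mulPow (n V) 1).1
  have key : ∀ s : Finset ι, V ∉ s → ∃ z : K, z ≠ 0 ∧ (P V).ord z = n V ∧
      (∀ W ∈ s, n W ≤ (P W).ord z) ∧ ∀ W, (P W).ord z₀ ≤ (P W).ord z := by
    intro s
    induction s using Finset.induction_on with
    | empty => exact fun _ => ⟨z₀, h0, h1, by simp, fun _ => le_rfl⟩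
    | insert W s hW ih =>
      intro hV
      rw [Finset.mem_insert, not_or] at hV
      obtain ⟨z, hz, hzV, hzs, hzz⟩ := ih hV.2
      obtain ⟨b, hb, hb0, hbV, hbW⟩ := hP.separated V W hV.1
      have hbn := (mem_divisorial P hb0).mp hb
      set k := (n W - (P W).ord z).toNat
      have hord : ∀ U, (P U).ord (b ^ k * z) = k * (P U).ord b + (P U).ord z := fun U => by
        rw [(P U).ord_mul (pow_ne_zero k hb0) hz, (P U).ord_pow b hb0]
      have hle : ∀ U, (P U).ord z ≤ (P U).ord (b ^ k * z) := fun U => by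
        have : 0 ≤ (k : ℤ) * (P U).ord b := mul_nonneg (by positivity) (hbn U)
        rw [hord]
        linarith
      refine ⟨b ^ k * z, mul_ne_zero (pow_ne_zero k hb0) hz, ?_, ?_, fun U => (hzz U).trans (hle U)⟩
      · rw [hord, hbV, hzV]; simp
      · intro U hU
        rcases Finset.mem_insert.mp hU with rfl | hU
        · rw [hord]
          have : (k : ℤ) ≤ k * (P U).ord b := by nlinarith
          have : n U - (P U).ord z ≤ k := Int.self_le_toNat _
          linarith
        · exact (hzs U hU).trans (hle U)
  obtain ⟨z, hz, hzV, hzs, hzz⟩ :=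
    key (((hP.finite_ord z₀ h0).toFinset ∪ n.support).erase V) (Finset.notMem_erase _ _)
  refine ⟨z, hz, hzV, fun W => ?_⟩
  by_cases hWV : W = V
  · exact hWV ▸ hzV.ge
  by_cases hW : W ∈ (hP.finite_ord z₀ h0).toFinset ∪ n.support
  · exact hzs W (Finset.mem_erase.mpr ⟨hWV, hW⟩)
  · simp at hW
    rw [hW.2, ← hW.1]
    exact hzz W

include hP in
lemma exists_mem_divisorial (n : ι →₀ ℤ) : ∃ z ∈ divisorial P n, z ≠ 0 := by
  rcases isEmpty_or_nonempty ι with h | ⟨⟨V⟩⟩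
  · exact ⟨1, (mem_divisorial P one_ne_zero).mpr fun V => h.elim V, one_ne_zero⟩
  · obtain ⟨z, hz, -, h⟩ := hP.exists_ord_eq n V
    exact ⟨z, (mem_divisorial P hz).mpr h, hz⟩

include hP in
lemma divisorial_fg [IsNoetherianRing A] (n : ι →₀ ℤ) : (divisorial P n).FG := by
  obtain ⟨z, hz, hz0⟩ := hP.exists_mem_divisorial (-n)
  refine Submodule.fg_of_fg_map_injective (scale A K z) (scale_injective hz0) ?_
  have hle : (divisorial P n).map (scale A K z) ≤ divisorial P 0 := by
    rw [← hP.divisorial_add_div n hz0]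
    refine divisorial_antitone P fun V => ?_
    have := (mem_divisorial P hz0).mp hz V
    simp at this ⊢
    linarith
  exact Submodule.FG.of_le hP.fg hle

end IsDivisorial

/-- The lattice of leading coefficients at `V` of the elements of `divisorial P n`: the residues
of `π ^ (- n V) f`, for `f` in `divisorial P n` and `π` the uniformizer at `V`. -/
def leadingLattice (n : ι →₀ ℤ) (V : ι) : Submodule A (P V).κ :=
  ((divisorial P n).comap ((P V).mulPow (n V))).map (P V).res.toLinearMap

/-- The elements of `divisorial P n` whose leading coefficient at `V` vanishes are those that
satisfy the bound `n V + 1` at `V`. -/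
lemma map_comap_ker_res (n : ι →₀ ℤ) (V : ι) :
    (LinearMap.ker (P V).res.toLinearMap ⊓ (divisorial P n).comap ((P V).mulPow (n V))).map
      ((P V).mulPow (n V)) = divisorial P (n + Finsupp.single V 1) := by
  classical
  ext z
  simp only [Submodule.mem_map, Submodule.mem_inf, LinearMap.mem_ker, AlgHom.toLinearMap_apply,
    Submodule.mem_comap]
  constructor
  · rintro ⟨x, ⟨hx, hx'⟩, rfl⟩
    rw [(P V).res_eq_zero_iff (n V)] at hx
    refine (Submodule.mem_iInf _).mpr fun W => ?_
    by_cases h : W = V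
    · subst h
      simpa using hx
    · rw [Finsupp.add_apply, Finsupp.single_eq_of_ne h, add_zero]
      exact divisorial_le P n W hx'
  · intro hz
    have h1 : z ∈ divisorial P n := divisorial_antitone P (by simp) hz
    obtain ⟨x, rfl⟩ := divisorial_le P n V h1
    refine ⟨x, ⟨?_, h1⟩, rfl⟩
    rw [(P V).res_eq_zero_iff (n V)]
    simpa using divisorial_le P _ V hz

/-- Raising the bound at `W` shrinks the lattice of leading coefficients at `V` by a quotient that
is symmetric in `V` and `W`. -/
lemma quotLength_leadingLattice (n : ι →₀ ℤ) {V W : ι} (h : W ≠ V) :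
    leadingLattice P (n + Finsupp.single W 1) V ≤ leadingLattice P n V ∧
    quotLength (leadingLattice P (n + Finsupp.single W 1) V) (leadingLattice P n V) =
      quotLength (divisorial P (n + Finsupp.single W 1) ⊔ divisorial P (n + Finsupp.single V 1))
        (divisorial P n) := by
  classical
  have e : (n + Finsupp.single W 1 : ι →₀ ℤ) V = n V := by
    rw [Finsupp.add_apply, Finsupp.single_eq_of_ne h.symm, add_zero]
  have hle := divisorial_antitone P (n := n) (m := n + Finsupp.single W 1) (by simp)
  have h1 := (P V).map_mulPow_comap (divisorial_le P n V)
  have h2 := (P V).map_mulPow_comap (hle.trans (divisorial_le P n V))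
  have h3 := map_comap_ker_res P n V
  rw [leadingLattice, leadingLattice, e]
  set J := (divisorial P n).comap ((P V).mulPow (n V))
  set J' := (divisorial P (n + Finsupp.single W 1)).comap ((P V).mulPow (n V))
  have hJ : J' ≤ J := Submodule.comap_mono hle
  refine ⟨Submodule.map_mono hJ, ?_⟩
  rw [quotLength_map _ hJ, ← quotLength_map_of_injective _ ((P V).mulPow_injective (n V))
    (sup_le hJ inf_le_right), Submodule.map_sup, h1, h2, h3]

/-- The leading coefficient at `V` identifies the quotient of successive fractional ideals with the
lattice of leading coefficients. -/
lemma quotLength_divisorial_single (n : ι →₀ ℤ) (V : ι) :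
    quotLength (divisorial P (n + Finsupp.single V 1)) (divisorial P n) =
      quotLength ⊥ (leadingLattice P n V) := by
  rw [leadingLattice, ← Submodule.map_bot (P V).res.toLinearMap, quotLength_map _ bot_le,
    bot_sup_eq, ← quotLength_map_of_injective _ ((P V).mulPow_injective (n V)) inf_le_right,
    map_comap_ker_res, (P V).map_mulPow_comap (divisorial_le P n V)]

namespace IsDivisorial

variable {P} (hP : IsDivisorial P)

include hP in
lemma isLattice_leadingLattice [IsNoetherianRing A] (n : ι →₀ ℤ) (V : ι) :
    IsLattice (P V).κ₀ (leadingLattice P n V) where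
  fg := by
    refine Submodule.FG.map _ (Submodule.fg_of_fg_map_injective _ ((P V).mulPow_injective (n V)) ?_)
    rw [(P V).map_mulPow_comap (divisorial_le P n V)]
    exact hP.divisorial_fg n
  span_eq_top := by
    -- multiplication by an element that attains the bound at `V` maps `divisorial P 0` into
    -- `divisorial P n`, so that the span contains a translate of the span of the residues
    obtain ⟨z, hz, hzV, hzn⟩ := hP.exists_ord_eq n V
    set v := (P V).unitPart z
    have hv := (P V).res_unit_ne_zero v
    refine eq_top_iff.mpr fun t _ => ?_
    have ht : (P V).res v * ((P V).res v)⁻¹ * t ∈ Submodule.span (P V).κ₀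
        (leadingLattice P n V : Set (P V).κ) := by
      have h1 : ((P V).res v)⁻¹ * t ∈ Submodule.span (P V).κ₀
          ((P V).res '' {x | (P V).toField x ∈ divisorial P 0}) := by
        rw [hP.span_res V]; trivial
      have h2 := Submodule.mem_map_of_mem (f := LinearMap.mulLeft (P V).κ₀ ((P V).res v)) h1
      rw [Submodule.map_span, LinearMap.mulLeft_apply, ← mul_assoc] at h2
      refine Submodule.span_mono ?_ h2
      rintro _ ⟨_, ⟨x, hx, rfl⟩, rfl⟩
      refine ⟨v * x, ?_, by simp⟩
      change (P V).mulPow (n V) (v * x) ∈ divisorial P n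
      have h3 : (P V).mulPow (n V) (v * x) = z * (P V).toField x := by
        have := (P V).mulPow_ord_unitPart hz
        rw [hzV] at this
        rw [← this]
        simp [v, mul_assoc]
      rw [h3]
      by_cases hx0 : (P V).toField x = 0
      · simp [hx0]
      refine (mem_divisorial P (mul_ne_zero hz hx0)).mpr fun W => ?_
      have := (mem_divisorial P hx0).mp hx W
      rw [(P W).ord_mul hz hx0]
      simp at this
      linarith [hzn W]
    rwa [mul_inv_cancel₀ hv, one_mul] at ht

/-- Translating the bounds by the divisor of `z` multiplies the lattice of leading coefficients at
`V` by the residue of the unit part of `z`. -/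
lemma leadingLattice_add_div (n : ι →₀ ℤ) {z : K} (hz : z ≠ 0) (V : ι) :
    leadingLattice P (n + hP.div z hz) V = (leadingLattice P n V).map
      ((LinearMap.mul (P V).κ₀ (P V).κ ((P V).res ((P V).unitPart z))).restrictScalars A) := by
  set v := (P V).unitPart z with hv
  have hzv : (P V).mulPow ((P V).ord z) v = z := (P V).mulPow_ord_unitPart hz
  rw [leadingLattice, leadingLattice, hP.divisorial_add_div n hz]
  ext t
  simp only [Submodule.mem_map, Submodule.mem_comap]
  constructor
  · rintro ⟨x, ⟨y, hy, hxy⟩, rfl⟩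
    refine ⟨(P V).res (↑v⁻¹ * x), ⟨↑v⁻¹ * x, ?_, rfl⟩, ?_⟩
    · have : (P V).mulPow (n V) (↑v⁻¹ * x) = y := by
        refine mul_left_cancel₀ hz ?_
        have h2 : z * y = (P V).mulPow ((n + hP.div z hz) V) x := hxy
        rw [h2]
        conv_lhs => rw [← hzv]
        rw [(P V).mulPow_mul, Units.mul_inv_cancel_left]
        congr 2
        simp [add_comm]
      rwa [this]
    · simp [← map_mul]
  · rintro ⟨_, ⟨x, hx, rfl⟩, rfl⟩
    refine ⟨v * x, ⟨_, hx, ?_⟩, by simp⟩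
    rw [scale_apply, smul_eq_mul]
    conv_lhs => rw [← hzv]
    rw [(P V).mulPow_mul]
    congr 2
    simp [add_comm]

end IsDivisorial

end

noncomputable section

/-! ### Path sums and reciprocity -/

section PathSum

variable {ι : Type*} (d : (ι →₀ ℤ) → ι → ℤ)

/-- The sum of a function `d` on the edges `n → n + e_V` of the lattice `ι →₀ ℤ` along the path
that starts at `n` and whose steps are given by a list. -/
def pathSum : (ι →₀ ℤ) → List ι → ℤ
  | _, [] => 0
  | n, V :: l => d n V + pathSum (n + Finsupp.single V 1) l

/-- The displacement of the path with given steps. -/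
def displacement (l : List ι) : ι →₀ ℤ := (l.map fun V => Finsupp.single V 1).sum

lemma displacement_cons (V : ι) (l : List ι) :
    displacement (V :: l) = Finsupp.single V 1 + displacement l := by simp [displacement]

lemma pathSum_append (l l' : List ι) : ∀ n : ι →₀ ℤ,
    pathSum d n (l ++ l') = pathSum d n l + pathSum d (n + displacement l) l' := by
  induction l with
  | nil => intro n; simp [pathSum, displacement]
  | cons V l ih =>
    intro n
    rw [List.cons_append, pathSum, pathSum, ih, displacement_cons, add_assoc, add_assoc]

variable {d}

/-- If a translation changes the edge function `d` by a function of the direction only, then it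
changes a path sum by an amount that depends only on the steps of the path. -/
lemma pathSum_shift {a : ι →₀ ℤ} {α : ι → ℤ} (h : ∀ n V, d (n + a) V = d n V + α V)
    (l : List ι) : ∀ n, pathSum d (n + a) l = pathSum d n l + (l.map α).sum := by
  induction l with
  | nil => intro n; simp [pathSum]
  | cons V l ih =>
    intro n
    rw [pathSum, pathSum, h, add_right_comm n, ih, List.map_cons, List.sum_cons]
    ring

/-- If `d` sums to the same value along the two ways around each elementary square, then a path sum
is independent of the order of the steps. -/
lemma pathSum_perm
    (h : ∀ n V W, d n V + d (n + Finsupp.single V 1) W = d n W + d (n + Finsupp.single W 1) V)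
    {l l' : List ι} (hl : l.Perm l') : ∀ n, pathSum d n l = pathSum d n l' := by
  induction hl with
  | nil => exact fun _ => rfl
  | cons V _ ih => intro n; rw [pathSum, pathSum, ih]
  | swap V W l =>
    intro n
    rw [pathSum, pathSum, pathSum, pathSum, ← add_assoc, ← add_assoc, h, add_right_comm n]
  | trans _ _ ih₁ ih₂ => intro n; rw [ih₁, ih₂]

lemma sum_map_eq_displacement (α : ι → ℤ) (l : List ι) :
    (l.map α).sum = (displacement l).sum fun V k => k * α V := by
  classical
  induction l with
  | nil => simp [displacement]
  | cons V l ih =>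
    rw [displacement_cons, Finsupp.sum_add_index' (by simp) (by intros; ring),
      Finsupp.sum_single_index (by simp), ← ih]
    simp

lemma exists_displacement_eq {a : ι →₀ ℤ} (ha : 0 ≤ a) : ∃ l : List ι, displacement l = a := by
  classical
  have hrep : ∀ (V : ι) (k : ℕ), displacement (List.replicate k V) = Finsupp.single V (k : ℤ) := by
    intro V k
    simp [displacement]
  induction a using Finsupp.induction with
  | zero => exact ⟨[], rfl⟩
  | single_add V k f hV hk ih =>
    have hf : 0 ≤ f := fun W => by
      by_cases h : W = V
      · subst h
        simp [Finsupp.notMem_support_iff.mp hV]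
      · simpa [Finsupp.single_eq_of_ne h] using ha W
    have hk0 : 0 ≤ k := by simpa [Finsupp.notMem_support_iff.mp hV] using ha V
    obtain ⟨l, hl⟩ := ih hf
    refine ⟨List.replicate k.toNat V ++ l, ?_⟩
    have : displacement (List.replicate k.toNat V ++ l) =
        displacement (List.replicate k.toNat V) + displacement l := by simp [displacement]
    rw [this, hrep, hl, Int.toNat_of_nonneg hk0]

/-- If the edge function `d` is closed and changes under translation by `a` and by `b` by functions
of the direction only, then comparing the paths from `0` to `a + b` through `a` and through `b`
gives a symmetry. -/
lemma sum_eq_sum_of_closed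
    (h : ∀ n V W, d n V + d (n + Finsupp.single V 1) W = d n W + d (n + Finsupp.single W 1) V)
    {a b : ι →₀ ℤ} {α β : ι → ℤ} (ha : 0 ≤ a) (hb : 0 ≤ b)
    (hα : ∀ n V, d (n + a) V = d n V + α V) (hβ : ∀ n V, d (n + b) V = d n V + β V) :
    (a.sum fun V k => k * β V) = b.sum fun V k => k * α V := by
  obtain ⟨l, rfl⟩ := exists_displacement_eq ha
  obtain ⟨l', rfl⟩ := exists_displacement_eq hb
  -- the path with steps `l` and then `l'` goes through `a`, the one with steps `l'` and then `l`
  -- through `b`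
  have h1 := pathSum_perm h (List.perm_append_comm (l₁ := l) (l₂ := l')) 0
  rw [pathSum_append, pathSum_append, pathSum_shift hα, pathSum_shift hβ] at h1
  rw [← sum_map_eq_displacement, ← sum_map_eq_displacement]
  linarith

end PathSum

variable {A K : Type u} [CommRing A] [Field K] [Algebra A K]
variable {ι : Type*} {P : ι → Place A K} (hP : IsDivisorial P)

namespace IsDivisorial

/-- The index of the lattice of leading coefficients at `V` relative to the one for `n = 0`. -/
def leadingIndex (P : ι → Place A K) (n : ι →₀ ℤ) (V : ι) : ℤ :=
  submoduleIndex (leadingLattice P 0 V) (leadingLattice P n V)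

variable [IsNoetherianRing A] (H : ∀ V, IsOrderRing A (P V).κ₀)

include hP H

/-- A step in the direction `W` changes the index at another place `V` by the length of a quotient
that is symmetric in `V` and `W`. -/
lemma leadingIndex_add_single (n : ι →₀ ℤ) {V W : ι} (h : W ≠ V) :
    leadingIndex P (n + Finsupp.single W 1) V = leadingIndex P n V +
      (quotLength (divisorial P (n + Finsupp.single W 1) ⊔ divisorial P (n + Finsupp.single V 1))
        (divisorial P n)).toNat := by
  obtain ⟨hle, hq⟩ := quotLength_leadingLattice P n h
  rw [leadingIndex, leadingIndex, ← (H V).submoduleIndex_add (hP.isLattice_leadingLattice 0 V)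
    (hP.isLattice_leadingLattice n V) (hP.isLattice_leadingLattice _ V), submoduleIndex_of_le hle,
    hq]

/-- The indices form a closed edge function on the lattice of divisors. -/
lemma leadingIndex_closed (n : ι →₀ ℤ) (V W : ι) :
    leadingIndex P n V + leadingIndex P (n + Finsupp.single V 1) W =
      leadingIndex P n W + leadingIndex P (n + Finsupp.single W 1) V := by
  by_cases h : V = W
  · rw [h]
  · rw [hP.leadingIndex_add_single H n h, hP.leadingIndex_add_single H n (Ne.symm h), sup_comm]
    ring

/-- Translation by a principal divisor changes the index at `V` by the order of the norm of the
residue, by the determinant formula for lattices. -/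
lemma leadingIndex_add_div (n : ι →₀ ℤ) {z : K} (hz : z ≠ 0) (V : ι) :
    leadingIndex P (n + hP.div z hz) V = leadingIndex P n V + (P V).residueOrd z := by
  have := hP.finiteDimensional V
  have hL := hP.isLattice_leadingLattice n V
  have hne := (P V).res_unit_ne_zero ((P V).unitPart z)
  have hdet : Algebra.norm (P V).κ₀ ((P V).res ((P V).unitPart z)) ≠ 0 :=
    Algebra.norm_ne_zero_iff.mpr hne
  have h := submoduleIndex_map_eq_fracOrd_det (H V) hL
    (LinearMap.mul (P V).κ₀ (P V).κ ((P V).res ((P V).unitPart z))) hdet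
  rw [leadingIndex, leadingIndex, ← (H V).submoduleIndex_add (hP.isLattice_leadingLattice 0 V) hL
    (hP.isLattice_leadingLattice _ V), hP.leadingLattice_add_div n hz V, h]
  rfl

/-- The reciprocity law for functions with effective divisors `a` and `b`: the leading indices are
compared along the paths from `0` to `a + b` through `a` and through `b`. -/
lemma reciprocity_of_nonneg {x y : K} (hx : x ≠ 0) (hy : y ≠ 0) (hx' : x ∈ divisorial P 0)
    (hy' : y ∈ divisorial P 0) :
    ∑ᶠ V, ((P V).ord x * (P V).residueOrd y - (P V).ord y * (P V).residueOrd x) = 0 := by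
  have h := sum_eq_sum_of_closed (hP.leadingIndex_closed H)
    (fun V => (mem_divisorial P hx).mp hx' V : 0 ≤ hP.div x hx)
    (fun V => (mem_divisorial P hy).mp hy' V : 0 ≤ hP.div y hy)
    (fun n V => hP.leadingIndex_add_div H n hx V) (fun n V => hP.leadingIndex_add_div H n hy V)
  have hs : ∀ (z w : K) (hz : z ≠ 0), (Function.support fun V =>
      (P V).ord z * (P V).residueOrd w).Finite := fun z w hz =>
    (hP.finite_ord z hz).subset fun V hV => left_ne_zero_of_mul hV
  rw [finsum_sub_distrib (hs x y hx) (hs y x hy), sub_eq_zero]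
  have e : ∀ (z w : K) (hz : z ≠ 0), ∑ᶠ V, (P V).ord z * (P V).residueOrd w =
      (hP.div z hz).sum fun V k => k * (P V).residueOrd w := by
    intro z w hz
    rw [finsum_eq_sum_of_support_subset (s := (hP.div z hz).support)]
    · rfl
    · intro V hV
      simpa using left_ne_zero_of_mul hV
  rw [e x y hx, e y x hy, h]

end IsDivisorial

lemma Place.residueOrd_mul {P : Place A K} (H : IsOrderRing A P.κ₀) [FiniteDimensional P.κ₀ P.κ]
    {y z : K} (hy : y ≠ 0) (hz : z ≠ 0) :
    P.residueOrd (y * z) = P.residueOrd y + P.residueOrd z := by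
  have h : ∀ z : K, Algebra.norm P.κ₀ (P.res (P.unitPart z)) ≠ 0 := fun z =>
    Algebra.norm_ne_zero_iff.mpr (P.res_unit_ne_zero _)
  have hz' := latticeOrd_mul H (h y) (h z)
  rw [residueOrd, residueOrd, residueOrd, fracOrd_eq_submoduleIndex H (h _),
    fracOrd_eq_submoduleIndex H (h _), fracOrd_eq_submoduleIndex H (h _), P.unitPart_mul hy hz,
    Units.val_mul, map_mul, map_mul]
  exact hz'

namespace IsDivisorial

include hP in
/-- Every nonzero element is a quotient of elements with effective divisors. -/
lemma exists_mul_mem {x : K} (hx : x ≠ 0) :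
    ∃ z ∈ divisorial P 0, z ≠ 0 ∧ x * z ∈ divisorial P 0 := by
  obtain ⟨z, hz, hz0⟩ := hP.exists_mem_divisorial
    (Finsupp.mapRange (fun k => max 0 (-k)) (by simp) (hP.div x hx))
  have h := (mem_divisorial P hz0).mp hz
  simp only [Finsupp.mapRange_apply, div_apply, max_le_iff] at h
  refine ⟨z, (mem_divisorial P hz0).mpr fun V => (h V).1, hz0,
    (mem_divisorial P (mul_ne_zero hx hz0)).mpr fun V => ?_⟩
  rw [(P V).ord_mul hx hz0]
  have := (h V).2
  simp
  linarith

variable [IsNoetherianRing A] (H : ∀ V, IsOrderRing A (P V).κ₀)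

include hP H

/-- The reciprocity law: the orders of the norms of the tame symbols of `x` and `y` sum to zero. -/
theorem reciprocity {x y : K} (hx : x ≠ 0) (hy : y ≠ 0) :
    ∑ᶠ V, ((P V).ord x * (P V).residueOrd y - (P V).ord y * (P V).residueOrd x) = 0 := by
  have hfd := hP.finiteDimensional
  have hfin : ∀ {x y : K}, x ≠ 0 → y ≠ 0 → (Function.support fun V =>
      (P V).ord x * (P V).residueOrd y - (P V).ord y * (P V).residueOrd x).Finite := by
    intro x y hx hy
    refine ((hP.finite_ord x hx).union (hP.finite_ord y hy)).subset fun V hV => ?_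
    by_contra! h
    simp only [Set.mem_union, Set.mem_ofPred_eq, not_or, not_not] at h
    exact hV (by simp [h.1, h.2])
  have hmul : ∀ {x z y : K}, x ≠ 0 → z ≠ 0 → y ≠ 0 →
      ∑ᶠ V, ((P V).ord (x * z) * (P V).residueOrd y - (P V).ord y * (P V).residueOrd (x * z)) =
      ∑ᶠ V, ((P V).ord x * (P V).residueOrd y - (P V).ord y * (P V).residueOrd x) +
      ∑ᶠ V, ((P V).ord z * (P V).residueOrd y - (P V).ord y * (P V).residueOrd z) := by
    intro x z y hx hz hy
    rw [← finsum_add_distrib (hfin hx hy) (hfin hz hy)]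
    refine finsum_congr fun V => ?_
    rw [(P V).ord_mul hx hz, Place.residueOrd_mul (H V) hx hz]
    ring
  have hswap : ∀ x y : K,
      ∑ᶠ V, ((P V).ord x * (P V).residueOrd y - (P V).ord y * (P V).residueOrd x) =
      -∑ᶠ V, ((P V).ord y * (P V).residueOrd x - (P V).ord x * (P V).residueOrd y) := by
    intro x y
    rw [← finsum_neg_distrib]
    exact finsum_congr fun V => by ring
  -- it suffices to treat elements with effective divisor, first in `x` and then in `y`
  have key : ∀ {x y : K}, x ≠ 0 → y ≠ 0 → y ∈ divisorial P 0 →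
      ∑ᶠ V, ((P V).ord x * (P V).residueOrd y - (P V).ord y * (P V).residueOrd x) = 0 := by
    intro x y hx hy hy'
    obtain ⟨z, hz, hz0, hxz⟩ := hP.exists_mul_mem hx
    have h1 := hmul hx hz0 hy
    rw [hP.reciprocity_of_nonneg H (mul_ne_zero hx hz0) hy hxz hy',
      hP.reciprocity_of_nonneg H hz0 hy hz hy'] at h1
    linarith
  obtain ⟨z, hz, hz0, hyz⟩ := hP.exists_mul_mem hy
  have h1 := hmul hy hz0 hx
  rw [hswap, hswap z, key hx (mul_ne_zero hy hz0) hyz, key hx hz0 hz] at h1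
  rw [hswap]
  linarith

end IsDivisorial

namespace IsDivisorial

variable [IsNoetherianRing A]

/-- If `A` is one-dimensional with fraction field `F`, the order of an element of `F` is the sum of
its valuations at the places of a divisorial family in a finite extension of `F`, weighted by the
residue degrees. -/
theorem fracOrd_det_eq_finsum (hP : IsDivisorial P) {F : Type u} [Field F] [Algebra A F]
    [Algebra F K] [IsScalarTower A F K] [FiniteDimensional F K] (H : IsOrderRing A F)
    (hspan : Submodule.span F (divisorial P 0 : Set K) = ⊤)
    (hres : ∀ V, Function.Surjective (algebraMap A (P V).κ₀)) {y : K} (hy : y ≠ 0) :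
    fracOrd (algebraMap A F).range (Algebra.norm F y) =
      ∑ᶠ V, (P V).ord y * (Module.finrank (P V).κ₀ (P V).κ : ℤ) := by
  have hfd := hP.finiteDimensional
  have hscale : ∀ (L : Submodule A K) (z : K),
      L.map ((LinearMap.mul F K z).restrictScalars A) = L.map (scale A K z) := fun L z => rfl
  have hbij : ∀ z : K, z ≠ 0 → Function.Surjective (LinearMap.mul F K z) := fun z hz t =>
    ⟨z⁻¹ * t, by simp [hz]⟩
  have hlat0 : IsLattice F (divisorial P 0) := ⟨hP.fg, hspan⟩
  have hlat : ∀ n, IsLattice F (divisorial P n) := by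
    intro n
    obtain ⟨z, hz, hz0⟩ := hP.exists_mem_divisorial n
    refine (hlat0.map _ (hbij z hz0)).of_le ?_ (hP.divisorial_fg n)
    rw [hscale, ← hP.divisorial_add_div 0 hz0, zero_add]
    exact divisorial_antitone P fun V => (mem_divisorial P hz0).mp hz V
  -- over a field, every lattice of leading coefficients is the whole residue field
  have hlen : ∀ n V, quotLength (divisorial P (n + Finsupp.single V 1)) (divisorial P n) =
      Module.finrank (P V).κ₀ (P V).κ := by
    intro n V
    rw [quotLength_divisorial_single]
    have htop : leadingLattice P n V = ⊤ := by
      refine eq_top_iff.mpr fun t _ => ?_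
      have ht : t ∈ Submodule.span (P V).κ₀ (leadingLattice P n V : Set (P V).κ) := by
        rw [(hP.isLattice_leadingLattice n V).span_eq_top]; trivial
      induction ht using Submodule.span_induction with
      | mem t h => exact h
      | zero => exact zero_mem _
      | add s t _ _ hs ht => exact add_mem (hs trivial) (ht trivial)
      | smul c t _ ht =>
        obtain ⟨a, rfl⟩ := hres V c
        rw [algebraMap_smul]
        exact Submodule.smul_mem _ a (ht trivial)
    rw [htop, quotLength, ← Module.length_eq_finrank, ← Module.length_eq_of_surjective (hres V)]
    refine ((Submodule.quotEquivOfEqBot _ ?_).trans Submodule.topEquiv).length_eq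
    rw [Submodule.submoduleOf, Submodule.comap_bot, Submodule.ker_subtype]
  -- hence one step in the direction `V` changes the index by the residue degree, and by additivity
  -- the index of `divisorial P n` is the degree of `n`
  have hstep : ∀ n V, submoduleIndex (divisorial P 0) (divisorial P (n + Finsupp.single V 1)) =
      submoduleIndex (divisorial P 0) (divisorial P n) + Module.finrank (P V).κ₀ (P V).κ := by
    intro n V
    rw [← H.submoduleIndex_add (hlat 0) (hlat n) (hlat _),
      submoduleIndex_of_le (L := divisorial P n) (divisorial_antitone P (by simp)), hlen,
      ENat.toNat_natCast]
  have hstep' : ∀ (n : ι →₀ ℤ) V (k : ℤ),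
      submoduleIndex (divisorial P 0) (divisorial P (n + Finsupp.single V k)) =
      submoduleIndex (divisorial P 0) (divisorial P n) + k * Module.finrank (P V).κ₀ (P V).κ := by
    intro n V k
    induction k using Int.induction_on with
    | zero => simp
    | succ k ih =>
      rw [Finsupp.single_add, ← add_assoc, hstep, ih]
      ring
    | pred k ih =>
      have := hstep (n + Finsupp.single V (-(k : ℤ) - 1)) V
      rw [add_assoc, ← Finsupp.single_add, sub_add_cancel, ih] at this
      linarith
  have hall : ∀ n : ι →₀ ℤ, submoduleIndex (divisorial P 0) (divisorial P n) =
      n.sum fun V k => k * (Module.finrank (P V).κ₀ (P V).κ : ℤ) := by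
    classical
    intro n
    induction n using Finsupp.induction with
    | zero => simp
    | single_add V k f hV hk ih =>
      rw [add_comm, hstep', ih, Finsupp.sum_add_index' (by simp) (by intros; ring),
        Finsupp.sum_single_index (by simp)]
  -- for `n` the divisor of `y` the index is also the order of the determinant
  have hnorm : LinearMap.det (LinearMap.mul F K y) ≠ 0 := Algebra.norm_ne_zero_iff.mpr hy
  have h := submoduleIndex_map_eq_fracOrd_det H hlat0 (LinearMap.mul F K y) hnorm
  rw [hscale, ← hP.divisorial_add_div 0 hy, zero_add, hall] at h
  rw [finsum_eq_sum_of_support_subset (s := (hP.div y hy).support)]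
  · exact h.symm
  · intro V hV
    simpa using left_ne_zero_of_mul hV

end IsDivisorial

end

noncomputable section

/-! ### Finiteness of the integral closure of a finitely generated domain -/

section RootExtension

open MvPolynomial

variable {k : Type u} [Field k] {s : ℕ}

/-- Extraction of roots: after the substitution `Xᵢ ↦ Xᵢ ^ Q` and a finite extension of the
constants, each of finitely many given polynomials becomes a `Q`-th power, where `Q` is a power of
the exponential characteristic. -/
lemma exists_finite_extension_forall_eq_pow (q n : ℕ) [ExpChar k q]
    (T : Finset (MvPolynomial (Fin s) k)) :
    ∃ (k' : Type u) (_ : Field k') (_ : ExpChar k' q)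
      (φ : MvPolynomial (Fin s) k →+* MvPolynomial (Fin s) k'),
      Function.Injective φ ∧ φ.Finite ∧ ∀ c ∈ T, ∃ d, φ c = d ^ q ^ n := by
  classical
  have hq : 0 < q ^ n := Nat.pow_pos (expChar_pos k q)
  let C₀ : Finset k := T.biUnion fun c => c.support.image fun m => c.coeff m
  choose r hr using fun a : k => IsAlgClosed.exists_pow_nat_eq
    (algebraMap k (AlgebraicClosure k) a) hq
  let k' := IntermediateField.adjoin k (r '' (C₀ : Set k))
  have hint : ∀ x ∈ r '' (C₀ : Set k), IsIntegral k x := fun x _ =>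
    (AlgebraicClosure.isAlgebraic k).isIntegral.isIntegral x
  have hfin : Finite (r '' (C₀ : Set k)) := (C₀.finite_toSet.image r).to_subtype
  have hfd : FiniteDimensional k k' := IntermediateField.finiteDimensional_adjoin hint
  have hexp : ExpChar k' q := expChar_of_injective_algebraMap (algebraMap k k').injective q
  let φ : MvPolynomial (Fin s) k →+* MvPolynomial (Fin s) k' :=
    (expand (q ^ n) : _ →ₐ[k'] MvPolynomial (Fin s) k').toRingHom.comp (map (algebraMap k k'))
  have hφC : ∀ a, φ (C a) = C (algebraMap k k' a) := fun a => by simp [φ]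
  have hφX : ∀ i, φ (X i) = X i ^ q ^ n := fun i => by simp [φ]
  refine ⟨k', inferInstance, hexp, φ, ?_, ?_, ?_⟩
  · exact (expand_injective hq).comp (map_injective _ (algebraMap k k').injective)
  · have h1 : φ.IsIntegral := by
      intro p
      induction p using MvPolynomial.induction_on with
      | C a =>
        have ha : (algebraMap k k').IsIntegralElem a := Algebra.IsIntegral.isIntegral (R := k) a
        obtain ⟨f, hf, hfa⟩ := ha
        refine ⟨f.map C, hf.map _, ?_⟩
        have h2 : φ.comp C = (C : k' →+* MvPolynomial (Fin s) k').comp (algebraMap k k') :=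
          RingHom.ext hφC
        rw [Polynomial.eval₂_map, h2, ← Polynomial.hom_eval₂, hfa, map_zero]
      | add p p' hp hp' => exact hp.add φ hp'
      | mul_X p i hp =>
        refine hp.mul φ ⟨Polynomial.X ^ q ^ n - Polynomial.C (X i),
          Polynomial.monic_X_pow_sub_C _ hq.ne', ?_⟩
        simp [hφX]
    refine h1.to_finite ?_
    refine RingHom.FiniteType.of_comp_finiteType (f := (C : k →+* MvPolynomial (Fin s) k)) ?_
    have h2 : φ.comp C = algebraMap k (MvPolynomial (Fin s) k') := RingHom.ext hφC
    rw [h2, RingHom.finiteType_algebraMap]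
    exact Algebra.FiniteType.trans (S := k') inferInstance inferInstance
  · intro c hc
    have hexp' : ExpChar (MvPolynomial (Fin s) k') q :=
      expChar_of_injective_algebraMap (C_injective (Fin s) k') q
    have hroot : ∀ a ∈ C₀, ∃ b : k', algebraMap k k' a = b ^ q ^ n := fun a ha =>
      ⟨⟨r a, IntermediateField.subset_adjoin k _ ⟨a, ha, rfl⟩⟩, Subtype.ext (hr a).symm⟩
    have hsum : φ c = ∑ m ∈ c.support, φ (monomial m (c.coeff m)) := by
      rw [← map_sum, ← c.as_sum]
    have hmem : ∀ m ∈ c.support, ∃ d, φ (monomial m (c.coeff m)) = d ^ q ^ n := by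
      intro m hm
      obtain ⟨b, hb⟩ := hroot (c.coeff m)
        (Finset.mem_biUnion.mpr ⟨c, hc, Finset.mem_image_of_mem _ hm⟩)
      refine ⟨monomial m b, ?_⟩
      rw [monomial_eq, monomial_eq, mul_pow, ← C_pow, ← hb, map_mul, hφC, Finsupp.prod,
        Finsupp.prod, map_prod, ← Finset.prod_pow]
      congr 1
      refine Finset.prod_congr rfl fun i _ => ?_
      rw [map_pow, hφX, ← pow_mul, ← pow_mul, mul_comm]
    choose! d hd using hmem
    refine ⟨∑ m ∈ c.support, d m, ?_⟩
    rw [hsum, sum_pow_char_pow, Finset.sum_congr rfl hd]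

end RootExtension

open Polynomial in
/-- If the coefficients of a separable polynomial `g` are `q ^ n`-th powers, then every root `z` of
`g(X ^ (q ^ n))` is separable. -/
lemma isSeparable_of_expand {F Ω : Type u} [Field F] [Field Ω] [Algebra F Ω] (q n : ℕ) [ExpChar F q]
    {g : F[X]} (hg : g.Separable) (hroot : ∀ i, ∃ d, g.coeff i = d ^ q ^ n) {z : Ω}
    (hz : aeval z (expand F (q ^ n) g) = 0) : IsSeparable F z := by
  obtain ⟨h, hh⟩ : ∃ h : F[X], h.map (iterateFrobenius F q n) = g := by
    refine (mem_lifts g).mp ((lifts_iff_coeff_lifts g).mpr fun i => ?_)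
    obtain ⟨d, hd⟩ := hroot i
    exact ⟨d, by rw [iterateFrobenius_def, hd]⟩
  have hs : h.Separable := by rwa [← hh, separable_map] at hg
  refine hs.of_dvd (minpoly.dvd F z ?_)
  have hexp : ExpChar Ω q := expChar_of_injective_algebraMap (algebraMap F Ω).injective q
  have hpow : aeval z h ^ q ^ n = aeval z (expand F (q ^ n) g) := by
    rw [expand_aeval, ← hh, aeval_def, aeval_def, eval₂_map, ← iterateFrobenius_def,
      hom_eval₂, RingHom.iterateFrobenius_comm, iterateFrobenius_def]
  exact eq_zero_of_pow_eq_zero (hpow.trans hz)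

/-- A field that embeds into a finite separable extension of the fraction field of a normal finite
extension of `P` has a finite integral closure over `P`. -/
lemma finite_integralClosure_of_algHom {P P' K E : Type u} [CommRing P] [IsNoetherianRing P]
    [CommRing P'] [IsDomain P'] [IsNoetherianRing P'] [IsIntegrallyClosed P'] [Algebra P P']
    [Module.Finite P P'] (F' : Type u) [Field F'] [Algebra P' F'] [IsFractionRing P' F']
    [Field K] [Algebra P K] [Field E] [Algebra F' E] [FiniteDimensional F' E]
    [Algebra.IsSeparable F' E] [Algebra P' E] [IsScalarTower P' F' E] [Algebra P E]
    [IsScalarTower P P' E] (σ : K →ₐ[P] E) : Module.Finite P (integralClosure P K) := by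
  let C' := integralClosure P' E
  have hC' : Module.Finite P' C' := IsIntegralClosure.finite P' F' E C'
  have : Module.Finite P C' := Module.Finite.trans P' C'
  let τ : integralClosure P K →ₗ[P] C' :=
    { toFun := fun x => ⟨σ x, (x.2.map σ).tower_top⟩
      map_add' := fun x y => Subtype.ext (map_add σ _ _)
      map_smul' := fun c x => Subtype.ext (map_smul σ _ _) }
  have : IsNoetherian P C' := isNoetherian_of_isNoetherianRing_of_finite P C'
  refine Module.Finite.of_injective τ fun x y h => Subtype.ext (σ.toRingHom.injective ?_)
  exact congrArg Subtype.val h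

/-- A domain that is finite over a polynomial ring `P` has a finite integral closure. Its fraction
field need not be separable over that of `P`; it becomes so after passing to the polynomial ring
`P'` over a finite extension of the constants in which the variables are replaced by `q`-power
roots. -/
lemma finite_integralClosure_of_mvPolynomial {k : Type u} [Field k] {s : ℕ} (R K : Type u)
    [CommRing R] [IsDomain R] [Field K] [Algebra R K] [IsFractionRing R K]
    [Algebra (MvPolynomial (Fin s) k) R] [Module.Finite (MvPolynomial (Fin s) k) R]
    [FaithfulSMul (MvPolynomial (Fin s) k) R] [Algebra (MvPolynomial (Fin s) k) K]
    [IsScalarTower (MvPolynomial (Fin s) k) R K] :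
    Module.Finite (MvPolynomial (Fin s) k) (integralClosure (MvPolynomial (Fin s) k) K) := by
  classical
  set P := MvPolynomial (Fin s) k with hP
  let F := FractionRing P
  obtain ⟨q, hq⟩ := ExpChar.exists k
  have hPq : ExpChar P q := expChar_of_injective_algebraMap (MvPolynomial.C_injective (Fin s) k) q
  have hFq : ExpChar F q := expChar_of_injective_algebraMap (IsFractionRing.injective P F) q
  obtain ⟨B, hB⟩ := Module.Finite.fg_top (R := P) (M := R)
  have hint : ∀ b : R, IsIntegral P b := fun b => Algebra.IsIntegral.isIntegral b
  -- the separable contraction of the minimal polynomial of each generator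
  have hcontr : ∀ b : R, ∃ (n : ℕ) (g : Polynomial F), g.Separable ∧
      Polynomial.expand F (q ^ n) g = (minpoly P b).map (algebraMap P F) := by
    intro b
    have hirr : Irreducible ((minpoly P b).map (algebraMap P F)) :=
      ((minpoly.monic (hint b)).irreducible_iff_irreducible_map_fraction_map).1
        (minpoly.irreducible (hint b))
    obtain ⟨g, hg, n, hn⟩ := hirr.hasSeparableContraction q
    exact ⟨n, g, hg, hn⟩
  choose n g hg hgn using hcontr
  obtain ⟨k', _, _, φ, hφ, hφfin, hφroot⟩ := exists_finite_extension_forall_eq_pow q (B.sup n)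
    (B.biUnion fun b => (minpoly P b).coeffs)
  let P' := MvPolynomial (Fin s) k'
  let F' := FractionRing P'
  have hP'q : ExpChar P' q :=
    expChar_of_injective_algebraMap (MvPolynomial.C_injective (Fin s) k') q
  have hF'q : ExpChar F' q := expChar_of_injective_algebraMap (IsFractionRing.injective P' F') q
  let Ω := AlgebraicClosure F'
  let _ : Algebra P P' := φ.toAlgebra
  have hPF' : Function.Injective (algebraMap P F') := by
    rw [IsScalarTower.algebraMap_eq P P' F']
    exact (IsFractionRing.injective P' F').comp hφ
  have hPΩ : Function.Injective (algebraMap P Ω) := by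
    rw [IsScalarTower.algebraMap_eq P F' Ω]
    exact (algebraMap F' Ω).injective.comp hPF'
  have : FaithfulSMul P Ω := (faithfulSMul_iff_algebraMap_injective P Ω).mpr hPΩ
  have : FaithfulSMul P K := by
    rw [faithfulSMul_iff_algebraMap_injective, IsScalarTower.algebraMap_eq P R K]
    exact (IsFractionRing.injective R K).comp (FaithfulSMul.algebraMap_injective P R)
  have : Algebra.IsAlgebraic P K := (IsFractionRing.isAlgebraic_iff' P R K).1 inferInstance
  let σ : K →ₐ[P] Ω := IsAlgClosed.lift
  let ι : F →+* F' := IsFractionRing.lift hPF'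
  have hι : ∀ c, ι (algebraMap P F c) = algebraMap P F' c := IsFractionRing.lift_algebraMap hPF'
  have hsep : ∀ b ∈ B, IsSeparable F' (σ (algebraMap R K b)) := by
    intro b hb
    have hcomp : ((Polynomial.expand F (q ^ n b) (g b)).map ι) =
        (minpoly P b).map (algebraMap P F') := by
      rw [hgn, Polynomial.map_map]
      congr 1
      exact RingHom.ext hι
    refine isSeparable_of_expand q (n b) (hg b).map (fun i => ?_) (g := (g b).map ι) ?_
    · have h1 : ((g b).map ι).coeff i = algebraMap P F' ((minpoly P b).coeff (i * q ^ n b)) := by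
        rw [← Polynomial.coeff_map, ← hcomp, Polynomial.map_expand,
          Polynomial.coeff_expand_mul (Nat.pow_pos (expChar_pos k q))]
      rw [h1]
      by_cases h0 : (minpoly P b).coeff (i * q ^ n b) = 0
      · exact ⟨0, by rw [h0, map_zero, zero_pow (Nat.pow_pos (expChar_pos k q)).ne']⟩
      obtain ⟨d, hd⟩ := hφroot _
        (Finset.mem_biUnion.mpr ⟨b, hb, Polynomial.coeff_mem_coeffs h0⟩)
      refine ⟨algebraMap P' F' (d ^ q ^ (B.sup n - n b)), ?_⟩
      rw [IsScalarTower.algebraMap_apply P P' F', RingHom.algebraMap_toAlgebra, hd, ← map_pow,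
        ← pow_mul, ← pow_add, Nat.sub_add_cancel (Finset.le_sup hb)]
    · rw [← Polynomial.map_expand, hcomp, Polynomial.aeval_map_algebraMap,
        Polynomial.aeval_algHom_apply, Polynomial.aeval_algebraMap_apply, minpoly.aeval, map_zero,
        map_zero]
  let E := IntermediateField.adjoin F' ((fun b => σ (algebraMap R K b)) '' (B : Set R))
  have hEsep : Algebra.IsSeparable F' E := by
    refine (IntermediateField.isSeparable_adjoin_iff_isSeparable _ _).mpr ?_
    rintro _ ⟨b, hb, rfl⟩
    exact hsep b hb
  have : Finite ((fun b => σ (algebraMap R K b)) '' (B : Set R)) :=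
    (B.finite_toSet.image _).to_subtype
  have hEfin : FiniteDimensional F' E := by
    refine IntermediateField.finiteDimensional_adjoin ?_
    rintro _ ⟨b, hb, rfl⟩
    exact (hsep b hb).isIntegral
  have htower : IsScalarTower P P' E := IsScalarTower.of_algebraMap_eq fun c =>
    Subtype.ext (IsScalarTower.algebraMap_apply P P' Ω c)
  have hφfin' : Module.Finite P P' := hφfin
  -- the field `K` lies in `E`, being generated by quotients of combinations of `B`
  have hσR : ∀ r : R, σ (algebraMap R K r) ∈ E := by
    intro r
    have hr : r ∈ Submodule.span P (B : Set R) := by rw [hB]; trivial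
    induction hr using Submodule.span_induction with
    | mem b hb => exact IntermediateField.subset_adjoin _ _ ⟨b, hb, rfl⟩
    | zero => simp
    | add x y _ _ hx hy => rw [map_add, map_add]; exact add_mem hx hy
    | smul c x _ hx =>
      rw [Algebra.smul_def, map_mul, map_mul, ← IsScalarTower.algebraMap_apply, σ.commutes]
      exact mul_mem (E.algebraMap_mem (algebraMap P F' c)) hx
  have hσE : ∀ z : K, σ z ∈ E := by
    intro z
    obtain ⟨a, b, -, rfl⟩ := IsFractionRing.div_surjective (A := R) z
    rw [map_div₀]
    exact div_mem (hσR a) (hσR b)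
  let σ' : K →ₐ[P] E :=
    { toRingHom := σ.toRingHom.codRestrict E hσE
      commutes' := fun c => Subtype.ext (σ.commutes c) }
  exact finite_integralClosure_of_algHom (P' := P') F' σ'

/-- The integral closure of a finitely generated domain over a field in its fraction field is a
finite module. -/
theorem finite_integralClosure (k : Type u) [Field k] (R K : Type u) [CommRing R] [IsDomain R]
    [Algebra k R] [Algebra.FiniteType k R] [Field K] [Algebra R K] [IsFractionRing R K] :
    Module.Finite R (integralClosure R K) := by
  obtain ⟨s, g, hg, hgfin⟩ := exists_finite_inj_algHom_of_fg k R
  let P := MvPolynomial (Fin s) k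
  let _ : Algebra P R := g.toRingHom.toAlgebra
  let _ : Algebra P K := ((algebraMap R K).comp g.toRingHom).toAlgebra
  have : IsScalarTower P R K := IsScalarTower.of_algebraMap_eq fun _ => rfl
  have : Module.Finite P R := hgfin
  have : FaithfulSMul P R := (faithfulSMul_iff_algebraMap_injective P R).mpr hg
  have h := finite_integralClosure_of_mvPolynomial (k := k) (s := s) R K
  let e : integralClosure P K →ₗ[P] integralClosure R K :=
    { toFun := fun x => ⟨x, x.2.tower_top⟩
      map_add' := fun _ _ => rfl
      map_smul' := fun _ _ => rfl }
  have he : Function.Surjective e := fun x => ⟨⟨x, isIntegral_trans (R := P) _ x.2⟩, rfl⟩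
  have : Module.Finite P (integralClosure R K) := Module.Finite.of_surjective e he
  exact Module.Finite.of_restrictScalars_finite P R _

end

noncomputable section

/-! ### Dimension theory of finitely generated algebras -/

section Dimension

/-- Every maximal ideal of a polynomial ring in `s` variables over a field has height `s`. -/
lemma height_eq_of_isMaximal_mvPolynomial (k : Type u) [Field k] : ∀ (s : ℕ)
    (M : Ideal (MvPolynomial (Fin s) k)) [M.IsMaximal], M.height = s
  | 0, M, hM => by
    have h := Ideal.height_le_ringKrullDim_of_ne_top hM.ne_top
    rw [MvPolynomial.ringKrullDim_of_isNoetherianRing, ringKrullDim_eq_zero_of_field] at h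
    simpa using h
  | s + 1, M, hM => by
    let e := (MvPolynomial.finSuccEquiv k s).toRingEquiv
    have h1 : (M.map e).IsMaximal := Ideal.map_isMaximal_of_equiv e
    let m := (M.map e).comap (Polynomial.C : MvPolynomial (Fin s) k →+* _)
    have hm : m.IsMaximal := Polynomial.isMaximal_comap_C_of_isJacobsonRing _
    have hl : (M.map e).LiesOver m := ⟨rfl⟩
    have h2 := Polynomial.height_eq_height_add_one m (M.map e)
    rw [RingEquiv.height_map, height_eq_of_isMaximal_mvPolynomial k s m] at h2
    rw [h2, Nat.cast_succ]

lemma ringKrullDim_eq_of_isIntegral (R S : Type*) [CommRing R] [CommRing S] [Algebra R S]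
    [Algebra.IsIntegral R S] [FaithfulSMul R S] : ringKrullDim S = ringKrullDim R := by
  refine le_antisymm (Order.krullDim_le_of_strictMono (PrimeSpectrum.comap (algebraMap R S))
    fun p q hpq => Ideal.IsIntegral.comap_lt_comap hpq) ?_
  refine iSup_le fun l => ?_
  obtain ⟨⟨Q, hQ, hQl⟩⟩ := Ideal.nonempty_primesOver (S := S) l.head.asIdeal
  obtain ⟨L, hL, -⟩ := Ideal.exists_ltSeries_of_hasGoingUp l Q
  exact hL ▸ Order.LTSeries.length_le_krullDim L

lemma ringKrullDim_quotient_eq_of_liesOver {R S : Type*} [CommRing R] [CommRing S] [Algebra R S]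
    [Algebra.IsIntegral R S] (p : Ideal R) (P : Ideal S) [P.LiesOver p] :
    ringKrullDim (S ⧸ P) = ringKrullDim (R ⧸ p) :=
  ringKrullDim_eq_of_isIntegral _ _

/-- The dimension of a finitely generated domain drops by at most one modulo a prime of height
one. -/
lemma ringKrullDim_le_quotient_add_one (k : Type u) [Field k] {C : Type u} [CommRing C] [IsDomain C]
    [Algebra k C] [Algebra.FiniteType k C] {q : PrimeSpectrum C} (hq : ⊥ ⋖ q) :
    ringKrullDim C ≤ ringKrullDim (C ⧸ q.asIdeal) + 1 := by
  obtain ⟨s, g, hg, hgint⟩ := exists_integral_inj_algHom_of_fg k C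
  let P := MvPolynomial (Fin s) k
  let _ : Algebra P C := g.toRingHom.toAlgebra
  have : FaithfulSMul P C := (faithfulSMul_iff_algebraMap_injective P C).mpr hg
  have : Algebra.IsIntegral P C := ⟨hgint⟩
  let q' : Ideal P := q.asIdeal.under P
  have hq0 : q.asIdeal ≠ ⊥ := fun h => hq.1.ne' (PrimeSpectrum.ext h)
  have hq'0 : q' ≠ ⊥ := Ideal.IsIntegral.comap_ne_bot P hq0
  obtain ⟨f, hfq, hf⟩ := Ideal.IsPrime.exists_mem_prime_of_ne_bot (I := q') inferInstance hq'0
  have hfp : (Ideal.span {f}).IsPrime := (Ideal.span_singleton_prime hf.ne_zero).mpr hf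
  have hle : Ideal.span {f} ≤ q' := (Ideal.span_singleton_le_iff_mem _).mpr hfq
  -- going down forces the contraction of `q` to be principal
  have heq : Ideal.span {f} = q' := by
    by_contra hne
    obtain ⟨Q, hQq, hQ, hQf⟩ := Ideal.exists_ideal_lt_liesOver_of_lt (p := Ideal.span {f})
      (q := q') q.asIdeal (lt_of_le_of_ne hle hne)
    have hQ0 : Q = ⊥ := by
      by_contra h
      exact hq.2 (c := ⟨Q, hQ⟩) (bot_lt_iff_ne_bot.mpr fun h' => h (congrArg (·.asIdeal) h')) hQq
    have h1 := hQf.over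
    rw [hQ0, Ideal.under_bot] at h1
    exact hf.ne_zero (Ideal.span_singleton_eq_bot.mp h1)
  obtain ⟨M, hM, hqM⟩ := Ideal.exists_le_maximal q' Ideal.IsPrime.ne_top'
  have h1 := Ideal.height_le_ringKrullDim_quotient_add_one (hqM hfq)
  rw [height_eq_of_isMaximal_mvPolynomial, heq] at h1
  have : q.asIdeal.LiesOver q' := ⟨rfl⟩
  rw [ringKrullDim_quotient_eq_of_liesOver q' q.asIdeal, ringKrullDim_eq_of_isIntegral P C,
    MvPolynomial.ringKrullDim_of_isNoetherianRing, ringKrullDim_eq_zero_of_field]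
  simpa using h1

variable (k : Type u) [Field k]

lemma exists_ringKrullDim_eq_nat (R : Type u) [CommRing R] [Nontrivial R] [Algebra k R]
    [Algebra.FiniteType k R] : ∃ n : ℕ, ringKrullDim R = n := by
  obtain ⟨s, g, hg, hgint⟩ := exists_integral_inj_algHom_of_fg k R
  let P := MvPolynomial (Fin s) k
  let _ : Algebra P R := g.toRingHom.toAlgebra
  have : FaithfulSMul P R := (faithfulSMul_iff_algebraMap_injective P R).mpr hg
  have : Algebra.IsIntegral P R := ⟨hgint⟩
  refine ⟨s, ?_⟩
  rw [ringKrullDim_eq_of_isIntegral P R, MvPolynomial.ringKrullDim_of_isNoetherianRing,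
    ringKrullDim_eq_zero_of_field]
  simp

/-- The dimension of the subvariety defined by a prime of a finitely generated algebra. -/
def primeDim (R : Type u) [CommRing R] [Algebra k R] [Algebra.FiniteType k R]
    (p : PrimeSpectrum R) : ℕ :=
  (exists_ringKrullDim_eq_nat k (R ⧸ p.asIdeal)).choose

variable {R : Type u} [CommRing R] [Algebra k R] [Algebra.FiniteType k R]

lemma ringKrullDim_quotient_eq_primeDim (p : PrimeSpectrum R) :
    ringKrullDim (R ⧸ p.asIdeal) = primeDim k R p :=
  (exists_ringKrullDim_eq_nat k (R ⧸ p.asIdeal)).choose_spec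

lemma primeDim_lt {p q : PrimeSpectrum R} (h : p < q) : primeDim k R q < primeDim k R p := by
  obtain ⟨hle, x, hxq, hxp⟩ := SetLike.lt_iff_le_and_exists.mp (show p.asIdeal < q.asIdeal from h)
  have h1 := ringKrullDim_succ_le_of_surjective (Ideal.Quotient.factor hle)
    (Ideal.Quotient.factor_surjective hle) (r := Ideal.Quotient.mk _ x)
    (mem_nonZeroDivisors_of_ne_zero fun h => hxp (Ideal.Quotient.eq_zero_iff_mem.mp h))
    (by simpa [Ideal.Quotient.eq_zero_iff_mem] using hxq)
  rw [ringKrullDim_quotient_eq_primeDim k, ringKrullDim_quotient_eq_primeDim k] at h1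
  exact_mod_cast h1

/-- Finitely generated algebras over a field are catenary: consecutive primes have consecutive
dimensions. -/
lemma primeDim_add_one {p q : PrimeSpectrum R} (h : p ⋖ q) :
    primeDim k R q + 1 = primeDim k R p := by
  refine le_antisymm (primeDim_lt k h.1) ?_
  let π := Ideal.Quotient.mk p.asIdeal
  have hπ : Function.Surjective π := Ideal.Quotient.mk_surjective
  have hker : RingHom.ker π ≤ q.asIdeal := by rw [Ideal.mk_ker]; exact h.1.le
  have hprime : (q.asIdeal.map π).IsPrime := Ideal.map_isPrime_of_surjective hπ hker
  have hcomap : (q.asIdeal.map π).comap π = q.asIdeal := by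
    rw [Ideal.comap_map_of_surjective' π hπ, sup_eq_left.mpr hker]
  have hcov : (⊥ : PrimeSpectrum (R ⧸ p.asIdeal)) ⋖ ⟨q.asIdeal.map π, hprime⟩ := by
    refine ⟨bot_lt_iff_ne_bot.mpr fun h0 => ?_, fun c hc hcq => ?_⟩
    · have h1 : q.asIdeal.map π = ⊥ := congrArg (·.asIdeal) h0
      rw [h1, ← RingHom.ker_eq_comap_bot, Ideal.mk_ker] at hcomap
      exact h.1.ne (PrimeSpectrum.ext hcomap)
    · refine h.2 (c := PrimeSpectrum.comap π c) ?_ ?_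
      · refine lt_of_le_of_ne ?_ fun h1 => ?_
        · change p.asIdeal ≤ c.asIdeal.comap π
          exact Ideal.mk_ker.symm.le.trans (Ideal.comap_mono bot_le)
        · refine hc.ne' (PrimeSpectrum.ext ?_)
          have h2 : p.asIdeal = c.asIdeal.comap π := congrArg (·.asIdeal) h1
          rw [← Ideal.map_comap_of_surjective π hπ c.asIdeal, ← h2, Ideal.map_quotient_self]
          rfl
      · have h1 := Ideal.comap_mono (f := π) hcq.le
        refine lt_of_le_of_ne (show c.asIdeal.comap π ≤ q.asIdeal from hcomap ▸ h1) fun h2 => ?_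
        have h3 : c.asIdeal.comap π = q.asIdeal := congrArg (·.asIdeal) h2
        refine hcq.ne (PrimeSpectrum.ext ?_)
        rw [← Ideal.map_comap_of_surjective π hπ c.asIdeal, h3]
  have h1 := ringKrullDim_le_quotient_add_one k hcov
  have e : ((R ⧸ p.asIdeal) ⧸ q.asIdeal.map π) ≃+* R ⧸ q.asIdeal :=
    DoubleQuot.quotQuotEquivQuotOfLE h.1.le
  rw [ringKrullDim_eq_of_ringEquiv e, ringKrullDim_quotient_eq_primeDim k,
    ringKrullDim_quotient_eq_primeDim k] at h1
  exact_mod_cast h1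

include k in
/-- In a finitely generated domain, if one prime of height one is covered by `q`, so is every prime
of height one below `q`. -/
lemma covBy_of_bot_covBy [IsDomain R] {p₁ p₂ q : PrimeSpectrum R} (h₁ : ⊥ ⋖ p₁) (h₂ : ⊥ ⋖ p₂)
    (h₁q : p₁ ⋖ q) (h₂q : p₂ ≤ q) : p₂ ⋖ q := by
  have e₁ := primeDim_add_one k h₁
  have e₂ := primeDim_add_one k h₂
  have e₃ := primeDim_add_one k h₁q
  refine ⟨lt_of_le_of_ne h₂q fun h => ?_, fun c hc hcq => ?_⟩
  · subst h; omega
  · have := primeDim_lt k hc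
    have := primeDim_lt k hcq
    omega

/-- In an integral extension of finitely generated domains, primes of height one contract to primes
of height one. -/
lemma bot_covBy_comap {S : Type u} [CommRing S] [Algebra k S] [Algebra.FiniteType k S] [IsDomain R]
    [IsDomain S] [Algebra R S] [Algebra.IsIntegral R S] [FaithfulSMul R S] {Q : PrimeSpectrum S}
    (hQ : ⊥ ⋖ Q) : ⊥ ⋖ PrimeSpectrum.comap (algebraMap R S) Q := by
  set p := PrimeSpectrum.comap (algebraMap R S) Q
  have hQ0 : Q.asIdeal ≠ ⊥ := fun h => hQ.1.ne' (PrimeSpectrum.ext h)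
  have hp0 : p.asIdeal ≠ ⊥ := Ideal.IsIntegral.comap_ne_bot R hQ0
  have : Q.asIdeal.LiesOver p.asIdeal := ⟨rfl⟩
  have e₁ : primeDim k S Q = primeDim k R p := by
    have h := ringKrullDim_quotient_eq_of_liesOver p.asIdeal Q.asIdeal
    rw [ringKrullDim_quotient_eq_primeDim k, ringKrullDim_quotient_eq_primeDim k] at h
    exact_mod_cast h
  have : (⊥ : PrimeSpectrum S).asIdeal.LiesOver (⊥ : PrimeSpectrum R).asIdeal :=
    ⟨(Ideal.under_bot (A := R) (B := S)).symm⟩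
  have e₂ : primeDim k S ⊥ = primeDim k R ⊥ := by
    have h := ringKrullDim_quotient_eq_of_liesOver (⊥ : PrimeSpectrum R).asIdeal
      (⊥ : PrimeSpectrum S).asIdeal
    rw [ringKrullDim_quotient_eq_primeDim k, ringKrullDim_quotient_eq_primeDim k] at h
    exact_mod_cast h
  -- `Q` and its contraction define subvarieties of the same dimension, and so do the zero ideals
  have e₃ := primeDim_add_one k hQ
  refine ⟨bot_lt_iff_ne_bot.mpr fun h => hp0 (congrArg (·.asIdeal) h), fun c hc hcp => ?_⟩
  have := primeDim_lt k hc
  have := primeDim_lt k hcp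
  omega

end Dimension

end

noncomputable section

/-! ### Normal domains are determined in codimension one -/

/-- In a normal Noetherian domain, a prime that is the ideal of denominators of a fraction `g` has
height one. -/
lemma bot_covBy_of_denominators {C K : Type*} [CommRing C] [IsDomain C] [IsNoetherianRing C]
    [IsIntegrallyClosed C] [Field K] [Algebra C K] [IsFractionRing C K] (p : PrimeSpectrum C)
    {g : K} (hg : ∀ s, s ∈ p.asIdeal ↔ algebraMap C K s * g ∈ (algebraMap C K).range) :
    ⊥ ⋖ p := by
  have hinj := IsFractionRing.injective C K
  obtain ⟨a, b, hb, hab⟩ := IsFractionRing.div_surjective (A := C) g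
  have hb0 : b ≠ 0 := nonZeroDivisors.ne_zero hb
  have hb0' : algebraMap C K b ≠ 0 := (map_ne_zero_iff _ hinj).mpr hb0
  have hbp : b ∈ p.asIdeal := (hg b).mpr ⟨a, by rw [← hab, mul_div_cancel₀ _ hb0']⟩
  have hp0 : p ≠ ⊥ := fun h => hb0 (by rw [h] at hbp; exact hbp)
  have hg0 : g ∉ (algebraMap C K).range := fun h =>
    p.2.ne_top ((Ideal.eq_top_iff_one _).mpr ((hg 1).mpr (by simpa using h)))
  -- if `p g ⊆ p`, then `g` is integral over `C`
  obtain ⟨t, ht, u, hu, htu⟩ : ∃ t ∈ p.asIdeal, ∃ u ∉ p.asIdeal,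
      algebraMap C K u = algebraMap C K t * g := by
    by_contra! hcon
    refine hg0 ?_
    let M : Submodule C K := Submodule.map (Algebra.linearMap C K) p.asIdeal
    refine (IsIntegrallyClosed.isIntegral_iff (R := C)).mp
      (isIntegral_of_smul_mem_submodule M ?_ ?_ g ?_)
    · exact (Submodule.ne_bot_iff _).mpr ⟨_, ⟨b, hbp, rfl⟩, hb0'⟩
    · exact Submodule.FG.map _ (IsNoetherian.noetherian _)
    · rintro _ ⟨s, hs, rfl⟩
      obtain ⟨v, hv⟩ := (hg s).mp hs
      exact ⟨v, by_contra fun h => hcon s hs v h hv, by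
        rw [Algebra.linearMap_apply, Algebra.linearMap_apply, hv, smul_eq_mul, mul_comm]⟩
  -- since `t g = u` is a unit at `p`, the ideal `p` is generated by `t` near `p`
  have hmin : p.asIdeal ∈ (Ideal.span {t}).minimalPrimes := by
    refine ⟨⟨p.2, (Ideal.span_singleton_le_iff_mem _).mpr ht⟩, fun q hq hqp s hs => ?_⟩
    obtain ⟨v, hv⟩ := (hg s).mp hs
    have h1 : u * s = t * v := hinj (by rw [map_mul, map_mul, htu, hv]; ring)
    have h2 : u * s ∈ q := h1 ▸ q.mul_mem_right _ (hq.2 (Ideal.mem_span_singleton_self t))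
    exact (hq.1.mem_or_mem h2).resolve_left fun h => hu (hqp h)
  have hht := Ideal.height_le_one_of_isPrincipal_of_mem_minimalPrimes _ _ hmin
  refine ⟨bot_lt_iff_ne_bot.mpr hp0, fun c hc hcp => ?_⟩
  have h1 := (Ideal.height_strict_mono_of_isPrime_of_isPrime
    (show c.asIdeal < p.asIdeal from hcp)).trans_le hht
  rw [Order.lt_one_iff, Ideal.height_eq_zero_iff_eq_bot] at h1
  exact hc.ne' (PrimeSpectrum.ext h1)

/-- A fraction that is not in the normal Noetherian domain `C` fails to be regular at some prime of
height one. -/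
lemma exists_bot_covBy_of_notMem_range {C K : Type*} [CommRing C] [IsDomain C] [IsNoetherianRing C]
    [IsIntegrallyClosed C] [Field K] [Algebra C K] [IsFractionRing C K] {f : K}
    (hf : f ∉ (algebraMap C K).range) :
    ∃ p : PrimeSpectrum C, ⊥ ⋖ p ∧
      ∀ s ∉ p.asIdeal, algebraMap C K s * f ∉ (algebraMap C K).range := by
  have hinj := IsFractionRing.injective C K
  obtain ⟨a, b, hb, rfl⟩ := IsFractionRing.div_surjective (A := C) f
  have hb0' : algebraMap C K b ≠ 0 := (map_ne_zero_iff _ hinj).mpr (nonZeroDivisors.ne_zero hb)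
  -- the ideal of denominators of `c / b` is the annihilator of the class of `c` in `C / b`, so that
  -- an associated prime of `C / b` is the ideal of denominators of some fraction
  have key : ∀ s c, algebraMap C K s * (algebraMap C K c / algebraMap C K b) ∈
      (algebraMap C K).range ↔ s • (Ideal.Quotient.mk (Ideal.span {b}) c) = 0 := by
    intro s c
    change _ ↔ Ideal.Quotient.mk (Ideal.span {b}) (s * c) = 0
    rw [Ideal.Quotient.eq_zero_iff_mem, Ideal.mem_span_singleton, ← mul_div_assoc, ← map_mul]
    constructor
    · rintro ⟨v, hv⟩
      exact ⟨v, hinj (by rw [map_mul _ b, hv, mul_div_cancel₀ _ hb0'])⟩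
    · rintro ⟨v, hv⟩
      exact ⟨v, by rw [hv, map_mul, mul_div_cancel_left₀ _ hb0']⟩
  have hx : Ideal.Quotient.mk (Ideal.span {b}) a ≠ 0 := fun h =>
    hf (by simpa using (key 1 a).mpr (by rw [h, smul_zero]))
  obtain ⟨P, hP, hle⟩ := exists_le_isAssociatedPrime_of_isNoetherianRing C _ hx
  obtain ⟨hPp, y, hy⟩ := Submodule.isAssociatedPrime_iff.mp hP
  obtain ⟨c, rfl⟩ := Ideal.Quotient.mk_surjective y
  refine ⟨⟨P, hPp⟩, bot_covBy_of_denominators (g := algebraMap C K c / algebraMap C K b) _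
    fun s => ?_, fun s hs h => hs (hle ?_)⟩
  · rw [key]
    change s ∈ P ↔ _
    rw [hy, Submodule.mem_colon_singleton, Submodule.mem_bot]
  · rw [Submodule.mem_colon_singleton, Submodule.mem_bot]
    exact (key s a).mp h

end

noncomputable section

/-! ### Places of a normal domain over a localization of its base ring -/

/-- Primes of height one of a localization contract to primes of height one. -/
lemma bot_covBy_comap_of_isLocalization {C L : Type*} [CommRing C] [IsDomain C] [CommRing L]
    [IsDomain L] [Algebra C L] (M : Submonoid C) [IsLocalization M L]
    (hinj : Function.Injective (algebraMap C L)) {q : PrimeSpectrum L} (hq : ⊥ ⋖ q) :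
    ⊥ ⋖ PrimeSpectrum.comap (algebraMap C L) q := by
  let e : PrimeSpectrum L ↪o PrimeSpectrum C :=
    (IsLocalization.primeSpectrumOrderIso M L).toOrderEmbedding.trans (OrderEmbedding.subtype _)
  have he : ∀ x, e x = PrimeSpectrum.comap (algebraMap C L) x := fun x => rfl
  have hbot : e ⊥ = ⊥ := by
    refine PrimeSpectrum.ext ?_
    change Ideal.comap (algebraMap C L) ⊥ = ⊥
    rw [← RingHom.ker_eq_comap_bot, (RingHom.injective_iff_ker_eq_bot _).mp hinj]
  have hconn : (Set.range e).OrdConnected := by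
    refine ⟨?_⟩
    rintro _ ⟨x, rfl⟩ _ ⟨y, rfl⟩ z ⟨-, hz⟩
    have hdis : Disjoint (M : Set C) (z.asIdeal : Set C) :=
      ((IsLocalization.primeSpectrumOrderIso M L) y).2.mono_right hz
    exact ⟨(IsLocalization.primeSpectrumOrderIso M L).symm ⟨z, hdis⟩, by simp [e]⟩
  rw [← he, ← hbot]
  exact (hconn.apply_covBy_apply_iff e).mpr hq

/-- Membership in the localization of a normal Noetherian domain `C` at a prime `p` of the base ring
is tested at the primes of height one of `C` that lie below `p`. -/
lemma exists_smul_mem_range_of_forall {R C K : Type*} [CommRing R] [CommRing C] [IsDomain C]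
    [IsNoetherianRing C] [IsIntegrallyClosed C] [Algebra R C] [Field K] [Algebra C K]
    [IsFractionRing C K] (p : PrimeSpectrum R) (f : K)
    (h : ∀ q : PrimeSpectrum C, ⊥ ⋖ q → PrimeSpectrum.comap (algebraMap R C) q ≤ p →
      ∃ s ∉ q.asIdeal, algebraMap C K s * f ∈ (algebraMap C K).range)
    (hp : ∀ s ∉ p.asIdeal, algebraMap R C s ≠ 0) :
    ∃ s ∉ p.asIdeal, algebraMap C K (algebraMap R C s) * f ∈ (algebraMap C K).range := by
  let M := Algebra.algebraMapSubmonoid C p.asIdeal.primeCompl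
  have hM : M ≤ nonZeroDivisors C := by
    rintro _ ⟨s, hs, rfl⟩
    exact mem_nonZeroDivisors_of_ne_zero (hp s hs)
  let L := Localization.subalgebra K M hM
  have hloc : IsLocalization M L := Localization.subalgebra.isLocalization_subalgebra K M hM
  have hfrac : IsFractionRing L K := Localization.subalgebra.isFractionRing K M hM
  have hN : IsNoetherianRing L := IsLocalization.isNoetherianRing M L inferInstance
  have hC : IsIntegrallyClosed L := isIntegrallyClosed_of_isLocalization L M hM
  have hinj : Function.Injective (algebraMap C L) := IsLocalization.injective L hM
  have key : f ∈ (algebraMap L K).range := by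
    by_contra hf
    obtain ⟨q, hq, hqf⟩ := exists_bot_covBy_of_notMem_range hf
    obtain ⟨s, hs, ⟨c, hc⟩⟩ := h (PrimeSpectrum.comap (algebraMap C L) q)
      (bot_covBy_comap_of_isLocalization M hinj hq) (fun r hr => by
        by_contra hrp
        refine q.2.ne_top (Ideal.eq_top_of_isUnit_mem _ hr ?_)
        exact IsLocalization.map_units L (⟨_, r, hrp, rfl⟩ : M))
    exact hqf _ hs ⟨algebraMap C L c, hc⟩
  obtain ⟨y, hy⟩ := key
  obtain ⟨⟨c, ⟨_, s, hs, rfl⟩⟩, hcs⟩ := IsLocalization.surj M y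
  refine ⟨s, hs, c, ?_⟩
  have h1 := congrArg (algebraMap L K) hcs
  rw [map_mul, hy, ← IsScalarTower.algebraMap_apply C L K, ← IsScalarTower.algebraMap_apply C L K]
    at h1
  rw [← h1, mul_comm]

/-- The residue field of a prime of a finite extension is spanned by the residues. -/
lemma span_range_eq_top_of_isIntegral {R C κ₀ κ : Type*} [CommRing R] [CommRing C] [Algebra R C]
    [Algebra.IsIntegral R C] [Field κ₀] [Field κ] [Algebra κ₀ κ] (f : R →+* κ₀) (g : C →+* κ)
    (hfg : ∀ r, g (algebraMap R C r) = algebraMap κ₀ κ (f r))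
    (hg : ∀ z, ∃ a b, g b ≠ 0 ∧ z * g b = g a) :
    Submodule.span κ₀ (Set.range g) = ⊤ := by
  let S := Algebra.adjoin κ₀ (Set.range g)
  have hint : ∀ c, IsIntegral κ₀ (g c) := by
    intro c
    obtain ⟨P, hP, hPc⟩ := Algebra.IsIntegral.isIntegral (R := R) c
    refine ⟨P.map f, hP.map f, ?_⟩
    have h1 : (algebraMap κ₀ κ).comp f = g.comp (algebraMap R C) :=
      RingHom.ext fun r => (hfg r).symm
    rw [Polynomial.eval₂_map, h1, ← Polynomial.hom_eval₂, hPc, map_zero]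
  have hspan : Submodule.span κ₀ (Set.range g) = Subalgebra.toSubmodule S := by
    rw [Algebra.adjoin_eq_span]
    congr 1
    exact congrArg SetLike.coe (Submonoid.closure_eq (MonoidHom.mrange g.toMonoidHom)).symm
  rw [hspan, Algebra.toSubmodule_eq_top, eq_top_iff]
  intro z _
  obtain ⟨a, b, hb, hab⟩ := hg z
  rw [eq_div_of_mul_eq hb hab, div_eq_mul_inv]
  exact S.mul_mem (Algebra.subset_adjoin ⟨a, rfl⟩)
    ((hint b).inv_mem (Algebra.subset_adjoin ⟨b, rfl⟩))

/-- If the residues of a finite `R`-algebra span `κ` over `κ₀`, finitely many of them do. -/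
lemma finiteDimensional_of_span_range {R C κ₀ κ : Type*} [CommRing R] [CommRing C] [Algebra R C]
    [Module.Finite R C] [Field κ₀] [Field κ] [Algebra κ₀ κ] (f : R →+* κ₀) (g : C →+* κ)
    (hfg : ∀ r, g (algebraMap R C r) = algebraMap κ₀ κ (f r))
    (hspan : Submodule.span κ₀ (Set.range g) = ⊤) : FiniteDimensional κ₀ κ := by
  obtain ⟨B, hB⟩ := Module.Finite.fg_top (R := R) (M := C)
  classical
  refine ⟨⟨B.image g, ?_⟩⟩
  rw [eq_top_iff, ← hspan, Submodule.span_le]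
  rintro _ ⟨c, rfl⟩
  have hc : c ∈ Submodule.span R (B : Set C) := by rw [hB]; trivial
  induction hc using Submodule.span_induction with
  | mem b hb => exact Submodule.subset_span (Finset.mem_coe.mpr (Finset.mem_image_of_mem g hb))
  | zero => simp
  | add x y _ _ hx hy => rw [map_add]; exact add_mem hx hy
  | smul r x _ hx =>
    rw [Algebra.smul_def, map_mul, hfg, ← Algebra.smul_def]
    exact Submodule.smul_mem _ _ hx

/-- The place of a discrete valuation ring `O` with fraction field `K`, for a field `κ` over `O` in
which the nonunits of `O` vanish. -/
def Place.ofDVR (A K O κ₀ κ : Type u) [CommRing A] [Field K] [Algebra A K] [CommRing O] [IsDomain O]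
    [IsDiscreteValuationRing O] [Algebra A O] [Algebra O K] [IsFractionRing O K]
    [IsScalarTower A O K] [Field κ₀] [Field κ] [Algebra A κ₀] [Algebra A κ] [Algebra κ₀ κ]
    [IsScalarTower A κ₀ κ] [Algebra O κ] [IsScalarTower A O κ]
    (hκ : ∀ x : O, ¬ IsUnit x → algebraMap O κ x = 0) : Place A K where
  O := O
  κ₀ := κ₀
  κ := κ
  toField := IsScalarTower.toAlgHom A O K
  toField_injective := IsFractionRing.injective O K
  res := IsScalarTower.toAlgHom A O κ
  unif := (IsDiscreteValuationRing.exists_irreducible O).choose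
  unif_ne_zero := (IsDiscreteValuationRing.exists_irreducible O).choose_spec.ne_zero
  res_unif := hκ _ (IsDiscreteValuationRing.exists_irreducible O).choose_spec.not_isUnit
  exists_eq z hz := by
    have hϖ := (IsDiscreteValuationRing.exists_irreducible O).choose_spec
    set ϖ := (IsDiscreteValuationRing.exists_irreducible O).choose
    have hinj := IsFractionRing.injective O K
    obtain ⟨a, b, hb, rfl⟩ := IsFractionRing.div_surjective (A := O) z
    have hb0 : b ≠ 0 := nonZeroDivisors.ne_zero hb
    have ha0 : a ≠ 0 := by rintro rfl; simp at hz
    obtain ⟨n, u, rfl⟩ := IsDiscreteValuationRing.eq_unit_mul_pow_irreducible ha0 hϖ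
    obtain ⟨m, v, rfl⟩ := IsDiscreteValuationRing.eq_unit_mul_pow_irreducible hb0 hϖ
    refine ⟨n - m, u * v⁻¹, ?_⟩
    have hϖ0 : algebraMap O K ϖ ≠ 0 := (map_ne_zero_iff _ hinj).mpr hϖ.ne_zero
    have hv0 : algebraMap O K v ≠ 0 := (map_ne_zero_iff _ hinj).mpr v.ne_zero
    have hv : algebraMap O K ↑v⁻¹ = (algebraMap O K v)⁻¹ := by
      refine eq_inv_of_mul_eq_one_left ?_
      rw [← map_mul, Units.inv_mul, map_one]
    simp only [IsScalarTower.coe_toAlgHom', map_mul, map_pow, Units.val_mul, hv,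
      zpow_sub₀ hϖ0, zpow_natCast]
    field_simp

section Criterion

variable {A K : Type u} [CommRing A] [Field K] [Algebra A K]

lemma Place.res_eq_zero_iff_ord_pos (P : Place A K) {x : P.O} (hx : x ≠ 0) :
    P.res x = 0 ↔ 0 < P.ord (P.toField x) := by
  have h0 : P.toField x ≠ 0 := (map_ne_zero_iff _ P.toField_injective).mpr hx
  rw [P.res_eq_zero_iff 0, ← Int.add_one_le_iff, ← P.mem_fil h0]
  simp

lemma Place.ord_toField_nonneg (P : Place A K) (x : P.O) : 0 ≤ P.ord (P.toField x) := by
  by_cases h0 : P.toField x = 0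
  · simp [h0, Place.ord]
  · exact (P.mem_fil h0).mp ⟨x, by simp⟩

lemma Place.exists_toField_eq (P : Place A K) {z : K} (hz : z ≠ 0) (h : 0 ≤ P.ord z) :
    ∃ x, P.toField x = z := by
  obtain ⟨x, hx⟩ := (P.mem_fil hz).mpr h
  exact ⟨x, by simpa using hx⟩

/-- Let `C` be a normal domain with fraction field `K`, finite over the Noetherian ring `R`, and `A`
the localization of `R` at a prime `p`. The primes of height one of `C` that lie over primes
contained in `p` form a divisorial family of places. -/
theorem isDivisorial_of_finite {R C : Type u} [CommRing R] [IsNoetherianRing R] [CommRing C]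
    [IsDomain C] [IsIntegrallyClosed C] [Algebra R C] [Module.Finite R C] [Algebra C K]
    [IsFractionRing C K] [Algebra R A] [Algebra R K] [IsScalarTower R C K] [IsScalarTower R A K]
    (p : PrimeSpectrum R) (hunit : ∀ s ∉ p.asIdeal, IsUnit (algebraMap R A s))
    {ι : Type*} (P : ι → Place A K) (Q : ι → PrimeSpectrum C) (hQinj : Function.Injective Q)
    (hQ : ∀ V, ⊥ ⋖ Q V)
    (hQsurj : ∀ q : PrimeSpectrum C, ⊥ ⋖ q → PrimeSpectrum.comap (algebraMap R C) q ≤ p →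
      ∃ V, Q V = q)
    (φ : ∀ V, C →+* (P V).O) (hφ : ∀ V b, (P V).toField (φ V b) = algebraMap C K b)
    (hres : ∀ V b, (P V).res (φ V b) = 0 ↔ b ∈ (Q V).asIdeal)
    (hfrac : ∀ V x, ∃ b s, s ∉ (Q V).asIdeal ∧ x * φ V s = φ V b)
    (hsurj : ∀ V, Function.Surjective (P V).res)
    (hfin : ∀ z : K, z ≠ 0 → {V | (P V).ord z ≠ 0}.Finite) : IsDivisorial P := by
  have hCinj := IsFractionRing.injective C K
  have hN : IsNoetherianRing C := IsNoetherianRing.of_finite R C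
  have hφ0 : ∀ V b, b ≠ 0 → φ V b ≠ 0 := fun V b hb h => by
    have h1 := hφ V b
    rw [h, map_zero] at h1
    exact hb (hCinj (by rw [← h1, map_zero]))
  have hφR : ∀ V r, φ V (algebraMap R C r) = algebraMap A (P V).O (algebraMap R A r) := by
    intro V r
    refine (P V).toField_injective ?_
    rw [hφ, (P V).toField.commutes, ← IsScalarTower.algebraMap_apply,
      ← IsScalarTower.algebraMap_apply]
  have hC0 : ∀ b : C, algebraMap C K b ∈ divisorial P 0 := by
    intro b
    by_cases h0 : algebraMap C K b = 0
    · rw [h0]; exact zero_mem _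
    · exact (mem_divisorial P h0).mpr fun V => hφ V b ▸ (P V).ord_toField_nonneg _
  have hR0 : ∀ s ∉ p.asIdeal, algebraMap R C s ≠ 0 := by
    intro s hs h0
    have h1 := (hunit s hs).map (algebraMap A K)
    rw [← IsScalarTower.algebraMap_apply, IsScalarTower.algebraMap_apply R C K, h0, map_zero] at h1
    exact not_isUnit_zero h1
  -- normality enters here: the functions without poles at the places are the localization of `C`
  have hfg : divisorial P 0 = Submodule.span A (Set.range (algebraMap C K)) := by
    refine le_antisymm (fun f hf => ?_) (Submodule.span_le.mpr ?_)
    · by_cases hf0 : f = 0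
      · rw [hf0]; exact zero_mem _
      obtain ⟨s, hs, c, hc⟩ := exists_smul_mem_range_of_forall (C := C) p f (fun q hq hqp => by
        obtain ⟨V, rfl⟩ := hQsurj q hq hqp
        obtain ⟨x, rfl⟩ := (P V).exists_toField_eq hf0 ((mem_divisorial P hf0).mp hf V)
        obtain ⟨b, s, hs, h⟩ := hfrac V x
        exact ⟨s, hs, b, by rw [← hφ V, ← hφ V, ← map_mul, ← h, mul_comm]⟩) hR0
      obtain ⟨u, hu⟩ := hunit s hs
      have h1 : f = (↑u⁻¹ : A) • algebraMap C K c := by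
        rw [hc, ← IsScalarTower.algebraMap_apply, IsScalarTower.algebraMap_apply R A K, ← hu,
          ← Algebra.smul_def, smul_smul, Units.inv_mul, one_smul]
      rw [h1]
      exact Submodule.smul_mem _ _ (Submodule.subset_span ⟨c, rfl⟩)
    · rintro _ ⟨b, rfl⟩
      exact hC0 b
  have hspan : ∀ V, Submodule.span (P V).κ₀ (Set.range ((P V).res.toRingHom.comp (φ V))) = ⊤ := by
    intro V
    refine span_range_eq_top_of_isIntegral (R := R) (C := C)
      ((algebraMap A (P V).κ₀).comp (algebraMap R A)) _ (fun r => ?_) fun z => ?_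
    · change (P V).res (φ V _) = algebraMap _ _ (algebraMap _ _ _)
      rw [hφR, (P V).res.commutes, ← IsScalarTower.algebraMap_apply A (P V).κ₀ (P V).κ]
    · obtain ⟨x, rfl⟩ := hsurj V z
      obtain ⟨b, s, hs, h⟩ := hfrac V x
      exact ⟨b, s, fun h0 => hs ((hres V s).mp h0), by
        change (P V).res x * (P V).res (φ V s) = (P V).res (φ V b)
        rw [← map_mul, h]⟩
  refine ⟨hfin, ?_, fun V W hVW => ?_, fun V => ?_, fun V => ?_⟩
  · obtain ⟨B, hB⟩ := Module.Finite.fg_top (R := R) (M := C)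
    classical
    refine ⟨B.image (algebraMap C K), ?_⟩
    rw [hfg]
    refine le_antisymm (Submodule.span_mono ?_) (Submodule.span_le.mpr ?_)
    · rw [Finset.coe_image]; exact Set.image_subset_range _ _
    · rintro _ ⟨c, rfl⟩
      have hc : c ∈ Submodule.span R (B : Set C) := by rw [hB]; trivial
      induction hc using Submodule.span_induction with
      | mem b hb =>
        exact Submodule.subset_span (Finset.mem_coe.mpr (Finset.mem_image_of_mem _ hb))
      | zero => simp
      | add x y _ _ hx hy => rw [map_add]; exact add_mem hx hy
      | smul r x _ hx =>
        rw [Algebra.smul_def, map_mul, ← IsScalarTower.algebraMap_apply,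
          IsScalarTower.algebraMap_apply R A K, ← Algebra.smul_def]
        exact Submodule.smul_mem _ _ hx
  · -- distinct primes of height one are incomparable
    obtain ⟨b, hbW, hbV⟩ : ∃ b ∈ (Q W).asIdeal, b ∉ (Q V).asIdeal := by
      by_contra! hle
      have h1 : Q W ≤ Q V := hle
      rcases h1.lt_or_eq with h2 | h2
      · exact (hQ V).2 (hQ W).1 h2
      · exact hVW (hQinj h2.symm)
    have hb0 : b ≠ 0 := fun h => hbV (h ▸ zero_mem _)
    refine ⟨algebraMap C K b, hC0 b, (map_ne_zero_iff _ hCinj).mpr hb0, ?_, ?_⟩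
    · rw [← hφ V]
      refine le_antisymm (not_lt.mp fun h => hbV ?_) ((P V).ord_toField_nonneg _)
      exact (hres V b).mp (((P V).res_eq_zero_iff_ord_pos (hφ0 V b hb0)).mpr h)
    · rw [← hφ W]
      exact ((P W).res_eq_zero_iff_ord_pos (hφ0 W b hb0)).mp ((hres W b).mpr hbW)
  · refine finiteDimensional_of_span_range (R := R) (C := C)
      ((algebraMap A (P V).κ₀).comp (algebraMap R A)) _ (fun r => ?_) (hspan V)
    change (P V).res (φ V _) = algebraMap _ _ (algebraMap _ _ _)
    rw [hφR, (P V).res.commutes, ← IsScalarTower.algebraMap_apply A (P V).κ₀ (P V).κ]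
  · rw [eq_top_iff, ← hspan V]
    refine Submodule.span_mono ?_
    rintro _ ⟨c, rfl⟩
    exact ⟨φ V c, by rw [Set.mem_ofPred_eq, hφ]; exact hC0 c, rfl⟩

end Criterion

/-- The image of a Noetherian ring in a field is an order ring if it is one-dimensional. -/
lemma isOrderRing_of_forall_isMaximal {A κ : Type*} [CommRing A] [IsNoetherianRing A] [Field κ]
    [Algebra A κ] (frac : ∀ z : κ, ∃ a b : A, algebraMap A κ b ≠ 0 ∧
      z * algebraMap A κ b = algebraMap A κ a)
    (hmax : ∀ q : Ideal A, q.IsPrime → RingHom.ker (algebraMap A κ) < q → q.IsMaximal) :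
    IsOrderRing A κ := by
  refine ⟨frac, fun a ha => ?_⟩
  let S := (algebraMap A κ).range
  have hsurj : Function.Surjective (algebraMap A κ).rangeRestrict :=
    (algebraMap A κ).rangeRestrict_surjective
  have hN : IsNoetherianRing S := isNoetherianRing_of_surjective _ _ _ hsurj
  have hdim : Ring.KrullDimLE 1 S := by
    refine Ring.krullDimLE_one_iff_of_noZeroDivisors.mpr fun I hI hIp => ?_
    have h1 : (I.comap (algebraMap A κ).rangeRestrict).IsMaximal := by
      refine hmax _ inferInstance (lt_of_le_of_ne (fun x hx => ?_) fun h => hI ?_)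
      · have : (algebraMap A κ).rangeRestrict x = 0 := Subtype.ext hx
        rw [Ideal.mem_comap, this]
        exact zero_mem _
      · rw [eq_bot_iff]
        intro y hy
        obtain ⟨x, rfl⟩ := hsurj y
        have hx : x ∈ RingHom.ker (algebraMap A κ) := by rw [h]; exact hy
        exact Subtype.ext hx
    exact Ideal.isMaximal_of_isIntegral_of_isMaximal_comap' _
      (RingHom.isIntegral_of_surjective _ hsurj) I h1
  rw [← ord_range_eq_quotLength ⟨algebraMap A κ a, a, rfl⟩]
  exact Ring.ord_ne_top (mem_nonZeroDivisors_of_ne_zero fun h => ha (congrArg Subtype.val h))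

end

noncomputable section

/-! ### The order function of a discrete valuation ring -/

section FracOrd

lemma IsOrderRing.fracOrd_mul {A κ : Type*} [CommRing A] [Field κ] [Algebra A κ]
    (H : IsOrderRing A κ) {y z : κ} (hy : y ≠ 0) (hz : z ≠ 0) :
    fracOrd (algebraMap A κ).range (y * z) =
      fracOrd (algebraMap A κ).range y + fracOrd (algebraMap A κ).range z := by
  rw [fracOrd_eq_submoduleIndex H (mul_ne_zero hy hz), fracOrd_eq_submoduleIndex H hy,
    fracOrd_eq_submoduleIndex H hz]
  exact latticeOrd_mul H hy hz

lemma fracOrd_one {K : Type*} [Field K] (R : Subring K) : fracOrd R 1 = 0 :=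
  fracOrd_eq_zero R R.one_mem (by rw [inv_one]; exact R.one_mem)

lemma IsOrderRing.fracOrd_inv {A κ : Type*} [CommRing A] [Field κ] [Algebra A κ]
    (H : IsOrderRing A κ) {y : κ} (hy : y ≠ 0) :
    fracOrd (algebraMap A κ).range y⁻¹ = - fracOrd (algebraMap A κ).range y := by
  have h := H.fracOrd_mul hy (inv_ne_zero hy)
  rw [mul_inv_cancel₀ hy, fracOrd_one] at h
  omega

lemma IsOrderRing.fracOrd_pow {A κ : Type*} [CommRing A] [Field κ] [Algebra A κ]
    (H : IsOrderRing A κ) {y : κ} (hy : y ≠ 0) (n : ℕ) :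
    fracOrd (algebraMap A κ).range (y ^ n) = n * fracOrd (algebraMap A κ).range y := by
  induction n with
  | zero => rw [pow_zero, fracOrd_one]; simp
  | succ n ih => rw [pow_succ, H.fracOrd_mul (pow_ne_zero n hy) hy, ih]; push_cast; ring

lemma IsOrderRing.fracOrd_zpow {A κ : Type*} [CommRing A] [Field κ] [Algebra A κ]
    (H : IsOrderRing A κ) {y : κ} (hy : y ≠ 0) (n : ℤ) :
    fracOrd (algebraMap A κ).range (y ^ n) = n * fracOrd (algebraMap A κ).range y := by
  cases n with
  | ofNat n => simpa using H.fracOrd_pow hy n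
  | negSucc n =>
    rw [zpow_negSucc, H.fracOrd_inv (pow_ne_zero _ hy), H.fracOrd_pow hy, Int.negSucc_eq]
    push_cast
    ring

/-- A one-dimensional Noetherian domain is an order ring in its fraction field. -/
lemma isOrderRing_of_krullDimLE_one (A K : Type*) [CommRing A] [IsDomain A] [IsNoetherianRing A]
    [Ring.KrullDimLE 1 A] [Field K] [Algebra A K] [IsFractionRing A K] : IsOrderRing A K := by
  refine isOrderRing_of_forall_isMaximal (fun z => ?_) fun q hq hlt => ?_
  · obtain ⟨a, b, hb, rfl⟩ := IsFractionRing.div_surjective (A := A) z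
    have hb0 : algebraMap A K b ≠ 0 := by
      rw [ne_eq, FaithfulSMul.algebraMap_eq_zero_iff]; exact nonZeroDivisors.ne_zero hb
    exact ⟨a, b, hb0, div_mul_cancel₀ _ hb0⟩
  · exact Ring.krullDimLE_one_iff_of_noZeroDivisors.mp ‹_› q
      (ne_bot_of_gt hlt) hq

/-- A uniformizer of a discrete valuation ring has order one. -/
lemma fracOrd_irreducible {O K : Type*} [CommRing O] [IsDomain O] [IsDiscreteValuationRing O]
    [Field K] [Algebra O K] [IsFractionRing O K] {ϖ : O} (hϖ : Irreducible ϖ) :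
    fracOrd (algebraMap O K).range (algebraMap O K ϖ) = 1 := by
  let S := (algebraMap O K).range
  let e : O ≃+* S := RingEquiv.ofBijective (algebraMap O K).rangeRestrict
    ⟨fun x y h => IsFractionRing.injective O K (congrArg Subtype.val h),
      (algebraMap O K).rangeRestrict_surjective⟩
  have hS : IsPrincipalIdealRing S := .of_surjective e.toRingHom e.surjective
  have hirr : Irreducible (e ϖ) := (MulEquiv.irreducible_iff e).mpr hϖ
  have hϖ0 : algebraMap O K ϖ ≠ 0 := by
    rw [ne_eq, FaithfulSMul.algebraMap_eq_zero_iff]; exact hϖ.ne_zero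
  have hex : ∃ p : S × S, p.1 ≠ 0 ∧ p.2 ≠ 0 ∧ algebraMap O K ϖ * p.2 = p.1 :=
    ⟨(e ϖ, 1), hirr.ne_zero, one_ne_zero, mul_one _⟩
  rw [fracOrd, dif_pos hex]
  obtain ⟨-, h2, h3⟩ := hex.choose_spec
  have h4 : hex.choose.1 = e ϖ * hex.choose.2 := Subtype.ext h3.symm
  have h5 := Ring.ord_ne_top (mem_nonZeroDivisors_of_ne_zero h2)
  have h6 : (Ring.ord S hex.choose.1).toNat = 1 + (Ring.ord S hex.choose.2).toNat := by
    rw [h4, Ring.ord_mul _ (mem_nonZeroDivisors_of_ne_zero h2), Ring.ord_of_irreducible hirr,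
      ENat.toNat_add ENat.one_ne_top h5]
    rfl
  change ((Ring.ord S hex.choose.1).toNat : ℤ) - ((Ring.ord S hex.choose.2).toNat : ℤ) = 1
  rw [h6]
  push_cast
  ring

/-- The normalized valuation of a discrete valuation ring is the order function defined by lengths.
-/
lemma Place.ord_ofDVR (A K O κ₀ κ : Type u) [CommRing A] [Field K] [Algebra A K] [CommRing O]
    [IsDomain O] [IsDiscreteValuationRing O] [Algebra A O] [Algebra O K] [IsFractionRing O K]
    [IsScalarTower A O K] [Field κ₀] [Field κ] [Algebra A κ₀] [Algebra A κ] [Algebra κ₀ κ]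
    [IsScalarTower A κ₀ κ] [Algebra O κ] [IsScalarTower A O κ]
    (hκ : ∀ x : O, ¬ IsUnit x → algebraMap O κ x = 0) {z : K} (hz : z ≠ 0) :
    (Place.ofDVR A K O κ₀ κ hκ).ord z = fracOrd (algebraMap O K).range z := by
  set P := Place.ofDVR A K O κ₀ κ hκ
  have h := P.mulPow_ord_unitPart hz
  have hdim : Ring.KrullDimLE 1 O :=
    Ring.krullDimLE_one_iff_of_noZeroDivisors.mpr fun I hI hIp => hIp.isMaximal hI
  have H : IsOrderRing O K := isOrderRing_of_krullDimLE_one O K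
  let ϖ : O := P.unif
  let v : Oˣ := P.unitPart z
  have hϖ : Irreducible ϖ := (IsDiscreteValuationRing.exists_irreducible O).choose_spec
  have hϖ0 : algebraMap O K ϖ ≠ 0 := P.toField_unif_ne_zero
  have hv0 : algebraMap O K v ≠ 0 := P.toField_unit_ne_zero v
  have hv : fracOrd (algebraMap O K).range (algebraMap O K v) = 0 := by
    refine fracOrd_eq_zero _ ⟨_, rfl⟩ ⟨(v⁻¹ : Oˣ), ?_⟩
    refine eq_inv_of_mul_eq_one_left ?_
    rw [← map_mul, Units.inv_mul, map_one]
  have h1 : algebraMap O K ϖ ^ P.ord z * algebraMap O K v = z := h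
  have h2 := H.fracOrd_mul (zpow_ne_zero (P.ord z) hϖ0) hv0
  rw [h1, H.fracOrd_zpow hϖ0, fracOrd_irreducible hϖ, hv, mul_one, add_zero] at h2
  exact h2.symm

end FracOrd

/-! ### Points of a scheme and primes of an affine chart -/

section Chart

variable {Y : Scheme.{u}} {U : Y.Opens} (hU : IsAffineOpen U)

/-- A section over an affine open subscheme lies in the prime of a point if and only if it vanishes
there. -/
lemma mem_primeIdealOf_iff (x : U) (b : Γ(Y, U)) :
    b ∈ (hU.primeIdealOf x).asIdeal ↔ ¬ IsUnit (Y.presheaf.germ U x x.2 b) := by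
  rw [hU.primeIdealOf_eq_map_closedPoint]
  exact IsLocalRing.mem_maximalIdeal _

lemma fromSpec_le_fromSpec_iff {p q : PrimeSpectrum Γ(Y, U)} :
    hU.fromSpec p ≤ hU.fromSpec q ↔ q ≤ p := by
  rw [Scheme.le_iff_specializes, PrimeSpectrum.le_iff_specializes]
  exact hU.fromSpec.isOpenEmbedding.isInducing.specializes_iff

lemma fromSpec_covBy_fromSpec_iff {p q : PrimeSpectrum Γ(Y, U)} :
    hU.fromSpec q ⋖ hU.fromSpec p ↔ p ⋖ q := by
  let e : (PrimeSpectrum Γ(Y, U))ᵒᵈ ↪o Y :=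
    { toFun := fun p => hU.fromSpec (OrderDual.ofDual p)
      inj' := fun p q h => hU.fromSpec.isOpenEmbedding.injective h
      map_rel_iff' := fromSpec_le_fromSpec_iff hU }
  have hconn : (Set.range e).OrdConnected := by
    refine ⟨?_⟩
    rintro _ ⟨x, rfl⟩ y - z ⟨hxz, -⟩
    have hx : e x ∈ (U : Set Y) := hU.range_fromSpec ▸ ⟨_, rfl⟩
    have hz : z ∈ (U : Set Y) := (show z ⤳ e x from hxz).mem_open U.isOpen hx
    rw [← hU.range_fromSpec] at hz
    exact hz
  have h := hconn.apply_covBy_apply_iff e (a := OrderDual.toDual q) (b := OrderDual.toDual p)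
  rw [toDual_covBy_toDual_iff] at h
  exact h

lemma le_iff_primeIdealOf_le (x y : U) :
    x.1 ≤ y.1 ↔ hU.primeIdealOf y ≤ hU.primeIdealOf x := by
  rw [← fromSpec_le_fromSpec_iff hU, hU.fromSpec_primeIdealOf, hU.fromSpec_primeIdealOf]

lemma covBy_iff_primeIdealOf_covBy (x y : U) :
    x.1 ⋖ y.1 ↔ hU.primeIdealOf y ⋖ hU.primeIdealOf x := by
  rw [← fromSpec_covBy_fromSpec_iff hU, hU.fromSpec_primeIdealOf, hU.fromSpec_primeIdealOf]

lemma primeIdealOf_injective : Function.Injective hU.primeIdealOf := fun x y h =>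
  Subtype.ext (by rw [← hU.fromSpec_primeIdealOf x, h, hU.fromSpec_primeIdealOf])

lemma primeIdealOf_surjective : Function.Surjective hU.primeIdealOf := fun p => by
  have hp : hU.fromSpec p ∈ (U : Set Y) := hU.range_fromSpec ▸ ⟨_, rfl⟩
  exact ⟨⟨_, hp⟩, hU.fromSpec.isOpenEmbedding.injective (hU.fromSpec_primeIdealOf ⟨_, hp⟩)⟩

lemma coheight_eq_one_iff_covBy_genericPoint [IsIntegral Y] (v : Y) :
    Order.coheight v = 1 ↔ v ⋖ genericPoint Y := by
  refine ⟨covBy_genericPoint, fun h => le_antisymm ?_ ?_⟩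
  · rw [← Nat.cast_one, Order.coheight_le_coe_iff]
    intro z hz
    have hmax : IsMax z := fun y _ => by
      have h1 : genericPoint Y ≤ z := by
        by_contra h2
        exact h.2 hz (lt_of_le_not_ge (genericPoint_specializes z) h2)
      exact (show y ≤ genericPoint Y from genericPoint_specializes y).trans h1
    rw [Order.coheight_eq_zero.mpr hmax]
    exact zero_lt_one
  · have h1 := Order.coheight_add_one_le h.1
    exact le_trans (by simp) h1

lemma genericPoint_mem [IsIntegral Y] [h : Nonempty U] : genericPoint Y ∈ U :=
  ((genericPoint_spec Y).mem_open_set_iff U.isOpen).mpr (by simpa using h)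

lemma primeIdealOf_genericPoint_eq_bot [IsIntegral Y] [Nonempty U] :
    hU.primeIdealOf ⟨genericPoint Y, genericPoint_mem⟩ = ⊥ := by
  refine PrimeSpectrum.ext (Ideal.ext fun b => ?_)
  rw [mem_primeIdealOf_iff]
  have hinj := germ_injective_of_isIntegral Y (genericPoint Y) (genericPoint_mem (U := U))
  change ¬ IsUnit (M := Y.functionField) _ ↔ b = 0
  rw [isUnit_iff_ne_zero, not_not]
  exact map_eq_zero_iff _ hinj

lemma coheight_eq_one_iff_bot_covBy [IsIntegral Y] [Nonempty U] (v : U) :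
    Order.coheight v.1 = 1 ↔ ⊥ ⋖ hU.primeIdealOf v := by
  rw [coheight_eq_one_iff_covBy_genericPoint,
    covBy_iff_primeIdealOf_covBy hU v ⟨_, genericPoint_mem⟩, primeIdealOf_genericPoint_eq_bot]

end Chart

end

noncomputable section

/-! ### Affine charts of the normalization -/

section NormalizationChart

variable {X : Scheme.{u}} [IsIntegral X]

/-- Over an affine open subscheme `U` of `X`, the sections of the normalization are the integral
closure of `Γ(X, U)` in the function field. -/
lemma exists_sections_ringEquiv_integralClosure {U : X.Opens} [Nonempty U] (hU : IsAffineOpen U) :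
    ∃ e : Γ(normalization X, normalizationMap X ⁻¹ᵁ U) ≃+*
        integralClosure Γ(X, U) X.functionField,
      ∀ r : Γ(X, U), e ((normalizationMap X).app U r) = algebraMap _ _ r := by
  let f := genericInclusion X
  let : Algebra Γ(X, U) Γ(Spec X.functionField, f ⁻¹ᵁ U) := (f.app U).hom.toAlgebra
  have htop : (⊤ : (Spec X.functionField).Opens) = f ⁻¹ᵁ U := by
    refine (eq_top_iff.mpr fun p _ => ?_).symm
    have : p = IsLocalRing.closedPoint X.functionField :=
      Subsingleton.elim (α := PrimeSpectrum _) _ _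
    change f p ∈ U
    rw [this, show f (IsLocalRing.closedPoint X.functionField) = genericPoint X from
      Scheme.fromSpecStalk_closedPoint]
    exact genericPoint_mem
  let g : X.functionField ⟶ Γ(Spec X.functionField, f ⁻¹ᵁ U) :=
    (Scheme.ΓSpecIso X.functionField).inv ≫
      (Spec X.functionField).presheaf.map (homOfLE le_top).op
  have hg : IsIso g := by
    have : IsIso (homOfLE (le_top : f ⁻¹ᵁ U ≤ ⊤)) := ⟨homOfLE htop.le, rfl, rfl⟩
    infer_instance
  have hfg : f.app U = X.presheaf.germ U _ genericPoint_mem ≫ g :=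
    Scheme.fromSpecStalk_app genericPoint_mem
  let eg : X.functionField ≃ₐ[Γ(X, U)] Γ(Spec X.functionField, f ⁻¹ᵁ U) :=
    AlgEquiv.ofRingEquiv (f := (asIso g).commRingCatIsoToRingEquiv) fun r => by
      change g.hom (X.presheaf.germ U _ genericPoint_mem r) = (f.app U).hom r
      rw [hfg]
      rfl
  let e₁ := (f.normalizationObjIso hU).commRingCatIsoToRingEquiv
  refine ⟨e₁.trans eg.mapIntegralClosure.symm.toRingEquiv, fun r => ?_⟩
  have h1 : e₁ ((normalizationMap X).app U r) =
      algebraMap Γ(X, U) (integralClosure Γ(X, U) Γ(Spec X.functionField, f ⁻¹ᵁ U)) r := by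
    rw [show (normalizationMap X).app U = _ from f.fromNormalization_app hU]
    change (f.normalizationObjIso hU).hom ((f.normalizationObjIso hU).inv _) = _
    simp
    rfl
  change eg.mapIntegralClosure.symm (e₁ _) = _
  rw [h1]
  exact eg.mapIntegralClosure.symm.commutes r

lemma isIntegrallyClosed_sections_normalization {U : X.Opens} [Nonempty U]
    (hU : IsAffineOpen U) : IsIntegrallyClosed Γ(normalization X, normalizationMap X ⁻¹ᵁ U) := by
  obtain ⟨e, -⟩ := exists_sections_ringEquiv_integralClosure hU
  have := functionField_isFractionRing_of_isAffineOpen X U hU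
  have : IsIntegrallyClosed (integralClosure Γ(X, U) X.functionField) :=
    integralClosure.isIntegrallyClosedOfFiniteExtension X.functionField
  exact IsIntegrallyClosed.of_equiv e.symm

lemma normalizationMap_app_injective {U : X.Opens} [Nonempty U] (hU : IsAffineOpen U) :
    Function.Injective ((normalizationMap X).app U) := by
  obtain ⟨e, he⟩ := exists_sections_ringEquiv_integralClosure hU
  have := functionField_isFractionRing_of_isAffineOpen X U hU
  intro a b hab
  have h := congrArg e hab
  rw [he, he] at h
  exact IsFractionRing.injective Γ(X, U) X.functionField (congrArg Subtype.val h)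

/-- The normalization is birational. -/
lemma exists_normalizationMap_app_mul_eq {U : X.Opens} [Nonempty U] (hU : IsAffineOpen U)
    (b : Γ(normalization X, normalizationMap X ⁻¹ᵁ U)) :
    ∃ r s : Γ(X, U), s ≠ 0 ∧ (normalizationMap X).app U s * b = (normalizationMap X).app U r := by
  obtain ⟨e, he⟩ := exists_sections_ringEquiv_integralClosure hU
  have := functionField_isFractionRing_of_isAffineOpen X U hU
  obtain ⟨r, s, hs, h⟩ := IsFractionRing.div_surjective (A := Γ(X, U)) (e b : X.functionField)
  have hs0 : algebraMap Γ(X, U) X.functionField s ≠ 0 := by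
    rw [ne_eq, FaithfulSMul.algebraMap_eq_zero_iff]; exact nonZeroDivisors.ne_zero hs
  refine ⟨r, s, nonZeroDivisors.ne_zero hs, e.injective (Subtype.ext ?_)⟩
  rw [map_mul, he, he]
  change algebraMap _ _ s * (e b : X.functionField) = algebraMap _ _ r
  rw [← h, mul_div_cancel₀ _ hs0]

end NormalizationChart

section VarietyChart

variable {k : Type u} [Field k] (X : Variety k)

/-- The sections of a variety over an affine open subscheme form a finitely generated algebra. -/
lemma exists_algebra_finiteType_sections {U : X.toScheme.Opens} (hU : IsAffineOpen U) :
    ∃ _ : Algebra k Γ(X.toScheme, U), Algebra.FiniteType k Γ(X.toScheme, U) := by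
  have h := X.structureMap.finiteType_appLE (isAffineOpen_top _) hU le_top
  have h2 := h.comp (RingHom.FiniteType.of_surjective _
    (Scheme.ΓSpecIso (CommRingCat.of k)).commRingCatIsoToRingEquiv.symm.surjective)
  exact ⟨RingHom.toAlgebra _, h2⟩

/-- The normalization map of a variety is finite. -/
instance isFinite_normalizationMap : IsFinite (normalizationMap X.toScheme) where
  finite_app U hU := by
    by_cases hne : Nonempty U
    · obtain ⟨e, he⟩ := exists_sections_ringEquiv_integralClosure hU
      obtain ⟨_, hft⟩ := exists_algebra_finiteType_sections X hU
      have := functionField_isFractionRing_of_isAffineOpen X.toScheme U hU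
      have h := finite_integralClosure k Γ(X.toScheme, U) X.toScheme.functionField
      have h1 : ((normalizationMap X.toScheme).app U).hom =
          e.symm.toRingHom.comp (algebraMap _ _) := by
        ext r
        exact e.injective ((he r).trans (e.apply_symm_apply _).symm)
      rw [h1]
      exact (RingHom.Finite.of_surjective _ e.symm.surjective).comp
        (RingHom.finite_algebraMap.mpr h)
    · have hU0 : U = ⊥ := by
        ext x
        exact ⟨fun hx => hne ⟨⟨x, hx⟩⟩, fun hx => hx.elim⟩
      subst hU0
      refine RingHom.Finite.of_surjective _ fun b => ⟨0, ?_⟩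
      have : Subsingleton Γ(normalization X.toScheme, normalizationMap X.toScheme ⁻¹ᵁ ⊥) :=
        inferInstanceAs (Subsingleton Γ(normalization X.toScheme, ⊥))
      exact Subsingleton.elim _ _

instance isNoetherian_normalization : IsNoetherian (normalization X.toScheme) :=
  { toIsLocallyNoetherian := LocallyOfFiniteType.isLocallyNoetherian (normalizationMap X.toScheme)
    toCompactSpace := QuasiCompact.compactSpace_of_compactSpace (normalizationMap X.toScheme) }

end VarietyChart

end

noncomputable section

/-! ### Local rings at points of codimension one -/

section LocalRings

variable {Y : Scheme.{u}}

lemma residue_eq_zero_iff (v : Y) (a : Y.presheaf.stalk v) : Y.residue v a = 0 ↔ ¬ IsUnit a :=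
  (IsLocalRing.residue_eq_zero_iff a).trans (IsLocalRing.mem_maximalIdeal a)

/-- Every element of a stalk is a fraction of sections over a given affine neighbourhood. -/
lemma exists_mul_germ_eq_germ {U : Y.Opens} (hU : IsAffineOpen U) {v : Y} (hv : v ∈ U)
    (x : Y.presheaf.stalk v) : ∃ b s : Γ(Y, U), IsUnit (Y.presheaf.germ U v hv s) ∧
      x * Y.presheaf.germ U v hv s = Y.presheaf.germ U v hv b := by
  let := Y.presheaf.algebra_section_stalk (⟨v, hv⟩ : U)
  have h := hU.isLocalization_stalk ⟨v, hv⟩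
  obtain ⟨⟨b, s⟩, hbs⟩ := IsLocalization.surj (M := (hU.primeIdealOf ⟨v, hv⟩).asIdeal.primeCompl) x
  exact ⟨b, s, not_not.mp fun h => s.2 ((mem_primeIdealOf_iff hU ⟨v, hv⟩ s).mpr h), hbs⟩

/-- If `z` is an immediate specialization of `v`, the local ring at `z` of the closure of `v` has
dimension one. -/
lemma isOrderRing_residueField [IsLocallyNoetherian Y] {z v : Y} (h : z ⋖ v)
    [Algebra (Y.presheaf.stalk z) (Y.residueField v)]
    (halg : algebraMap (Y.presheaf.stalk z) (Y.residueField v) =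
      (Y.presheaf.stalkSpecializes (show v ⤳ z from h.le) ≫ Y.residue v).hom) :
    IsOrderRing (Y.presheaf.stalk z) (Y.residueField v) := by
  have hvz : v ⤳ z := h.le
  refine isOrderRing_of_forall_isMaximal (fun t => ?_) fun q hq hlt => ?_
  · obtain ⟨x, rfl⟩ := Y.residue_surjective v t
    obtain ⟨U, hU, hzU, -⟩ := exists_isAffineOpen_mem_and_subset (U := ⊤) (x := z) trivial
    have hvU : v ∈ U := hvz.mem_open U.isOpen hzU
    obtain ⟨b, s, hs, hbs⟩ := exists_mul_germ_eq_germ hU hvU x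
    have key : ∀ c, algebraMap (Y.presheaf.stalk z) (Y.residueField v)
        (Y.presheaf.germ U z hzU c) = Y.residue v (Y.presheaf.germ U v hvU c) := by
      intro c
      rw [halg, ← Y.presheaf.germ_stalkSpecializes hzU hvz]
      rfl
    refine ⟨Y.presheaf.germ U z hzU b, Y.presheaf.germ U z hzU s, ?_, ?_⟩
    · rw [key, ne_eq, residue_eq_zero_iff, not_not]
      exact hs
    · rw [key, key, ← hbs, map_mul]
  -- a prime of the local ring at `z` strictly above the prime `p` of `v` is a specialization of `v`
  -- other than `v` that specializes to `z`, so that it is `z` itself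
  · let p : PrimeSpectrum (Y.presheaf.stalk z) :=
      Spec.map (Y.presheaf.stalkSpecializes hvz) (IsLocalRing.closedPoint (Y.presheaf.stalk v))
    let Q : PrimeSpectrum (Y.presheaf.stalk z) := ⟨q, hq⟩
    have hp : p.asIdeal = RingHom.ker (algebraMap (Y.presheaf.stalk z) (Y.residueField v)) := by
      ext x
      rw [RingHom.mem_ker, halg]
      exact (IsLocalRing.mem_maximalIdeal _).trans (residue_eq_zero_iff v _).symm
    have hpQ : p < Q := by
      rw [← hp] at hlt
      exact hlt
    let j := Y.fromSpecStalk z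
    have hj : Topology.IsEmbedding j := j.isEmbedding
    have hjp : j p = v := by
      change (Spec.map (Y.presheaf.stalkSpecializes hvz) ≫ Y.fromSpecStalk z) _ = v
      rw [Scheme.SpecMap_stalkSpecializes_fromSpecStalk]
      exact Scheme.fromSpecStalk_closedPoint
    have h1 : v ⤳ j Q := by
      rw [← hjp]
      exact ((PrimeSpectrum.le_iff_specializes p Q).mp hpQ.le).map j.continuous
    have h2 : ¬ j Q ⤳ v := by
      intro h3
      rw [← hjp] at h3
      exact hpQ.not_ge ((PrimeSpectrum.le_iff_specializes Q p).mpr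
        (hj.isInducing.specializes_iff.mp h3))
    have h3 : j Q ⤳ z := by
      have : j Q ∈ Set.range j := ⟨Q, rfl⟩
      rwa [Scheme.range_fromSpecStalk] at this
    have h4 : j Q = z := by
      by_contra hne
      have h5 : ¬ z ⤳ j Q := fun h6 => hne ((h3.antisymm h6).eq)
      exact h.2 (lt_of_le_not_ge (show z ≤ j Q from h3) h5)
        (lt_of_le_not_ge (show j Q ≤ v from h1) h2)
    have h5 : Q = IsLocalRing.closedPoint (Y.presheaf.stalk z) :=
      hj.injective (h4.trans Scheme.fromSpecStalk_closedPoint.symm)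
    have h6 : q = IsLocalRing.maximalIdeal (Y.presheaf.stalk z) :=
      congrArg PrimeSpectrum.asIdeal h5
    rw [h6]
    infer_instance

end LocalRings

section Variety

variable {k : Type u} [Field k] (X : Variety k)

/-- If one prime divisor through `w` has `w` as a point of codimension one, so does every other. -/
lemma covBy_of_specializes {w v v' : X.toScheme} (hw : w ⋖ v) (hv : Order.coheight v = 1)
    (hv' : Order.coheight v' = 1) (h : v' ⤳ w) : w ⋖ v' := by
  obtain ⟨U, hU, hwU, -⟩ := exists_isAffineOpen_mem_and_subset (U := ⊤) (x := w) trivial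
  have hvw : v ⤳ w := hw.le
  have hvU : v ∈ U := hvw.mem_open U.isOpen hwU
  have hvU' : v' ∈ U := h.mem_open U.isOpen hwU
  have : Nonempty U := ⟨⟨w, hwU⟩⟩
  obtain ⟨_, hft⟩ := exists_algebra_finiteType_sections X hU
  rw [coheight_eq_one_iff_bot_covBy hU ⟨v, hvU⟩] at hv
  rw [coheight_eq_one_iff_bot_covBy hU ⟨v', hvU'⟩] at hv'
  exact (covBy_iff_primeIdealOf_covBy hU ⟨w, hwU⟩ ⟨v', hvU'⟩).mpr
    (covBy_of_bot_covBy k hv hv' ((covBy_iff_primeIdealOf_covBy hU ⟨w, hwU⟩ ⟨v, hvU⟩).mp hw)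
      ((le_iff_primeIdealOf_le hU ⟨w, hwU⟩ ⟨v', hvU'⟩).mp h))

/-- The image of a prime divisor under the normalization map is a prime divisor. -/
lemma coheight_normalizationMap {V : normalization X.toScheme} (hV : Order.coheight V = 1) :
    Order.coheight (normalizationMap X.toScheme V) = 1 := by
  let π := normalizationMap X.toScheme
  obtain ⟨U, hU, hvU, -⟩ := exists_isAffineOpen_mem_and_subset (U := ⊤) (x := π V) trivial
  have hW : IsAffineOpen (π ⁻¹ᵁ U) := hU.preimage π
  have hVW : V ∈ π ⁻¹ᵁ U := hvU
  have : Nonempty U := ⟨⟨_, hvU⟩⟩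
  have : Nonempty (π ⁻¹ᵁ U) := ⟨⟨V, hvU⟩⟩
  obtain ⟨_, hft⟩ := exists_algebra_finiteType_sections X hU
  let : Algebra Γ(X.toScheme, U) Γ(normalization X.toScheme, π ⁻¹ᵁ U) := (π.app U).hom.toAlgebra
  have hfin : Module.Finite Γ(X.toScheme, U) Γ(normalization X.toScheme, π ⁻¹ᵁ U) :=
    π.finite_app U hU
  have hinj : FaithfulSMul Γ(X.toScheme, U) Γ(normalization X.toScheme, π ⁻¹ᵁ U) :=
    (faithfulSMul_iff_algebraMap_injective _ _).mpr (normalizationMap_app_injective hU)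
  let : Algebra k Γ(normalization X.toScheme, π ⁻¹ᵁ U) :=
    ((π.app U).hom.comp (algebraMap k Γ(X.toScheme, U))).toAlgebra
  have : IsScalarTower k Γ(X.toScheme, U) Γ(normalization X.toScheme, π ⁻¹ᵁ U) :=
    .of_algebraMap_eq' rfl
  have : Algebra.FiniteType k Γ(normalization X.toScheme, π ⁻¹ᵁ U) :=
    Algebra.FiniteType.trans hft inferInstance
  rw [coheight_eq_one_iff_bot_covBy hW ⟨V, hVW⟩] at hV
  rw [coheight_eq_one_iff_bot_covBy hU ⟨π V, hvU⟩]
  have h := bot_covBy_comap k (R := Γ(X.toScheme, U)) hV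
  have h1 := IsAffineOpen.comap_primeIdealOf_appLE (f := π) U hU _ hW le_rfl hVW
  rw [← Scheme.Hom.app_eq_appLE] at h1
  rw [← h1]
  exact h

/-- The local ring of the normalization at a prime divisor is normal and Noetherian of dimension
one. -/
lemma isDiscreteValuationRing_stalk {V : normalization X.toScheme} (hV : Order.coheight V = 1) :
    IsDiscreteValuationRing ((normalization X.toScheme).presheaf.stalk V) := by
  let π := normalizationMap X.toScheme
  obtain ⟨U, hU, hvU, -⟩ := exists_isAffineOpen_mem_and_subset (U := ⊤) (x := π V) trivial
  have hW : IsAffineOpen (π ⁻¹ᵁ U) := hU.preimage π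
  have hVW : V ∈ π ⁻¹ᵁ U := hvU
  have : Nonempty U := ⟨⟨_, hvU⟩⟩
  have : Nonempty (π ⁻¹ᵁ U) := ⟨⟨V, hvU⟩⟩
  have := isIntegrallyClosed_sections_normalization hU
  let := (normalization X.toScheme).presheaf.algebra_section_stalk (⟨V, hVW⟩ : ↥(π ⁻¹ᵁ U))
  have hloc := hW.isLocalization_stalk ⟨V, hVW⟩
  have hcl : IsIntegrallyClosed ((normalization X.toScheme).presheaf.stalk V) :=
    isIntegrallyClosed_of_isLocalization _ (hW.primeIdealOf ⟨V, hVW⟩).asIdeal.primeCompl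
      (Ideal.primeCompl_le_nonZeroDivisors _)
  have hdim := ringKrullDim_stalk_eq_coheight V
  rw [hV] at hdim
  have hfield : ¬ IsField ((normalization X.toScheme).presheaf.stalk V) := fun h => by
    rw [ringKrullDim_eq_zero_of_isField h] at hdim
    exact absurd hdim (by norm_num)
  have h1 : Ring.KrullDimLE 1 ((normalization X.toScheme).presheaf.stalk V) :=
    krullDimLE_of_coheight_le hV.le
  rw [Ring.krullDimLE_one_iff_of_noZeroDivisors] at h1
  have h2 : IsDiscreteValuationRing ((normalization X.toScheme).presheaf.stalk V) ↔
      IsIntegrallyClosed ((normalization X.toScheme).presheaf.stalk V) ∧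
        ∃! P : Ideal ((normalization X.toScheme).presheaf.stalk V), P ≠ ⊥ ∧ P.IsPrime :=
    (IsDiscreteValuationRing.TFAE _ hfield).out 0 3
  refine h2.mpr ⟨hcl, ?_⟩
  refine ⟨IsLocalRing.maximalIdeal _, ⟨fun h => hfield ?_, inferInstance⟩, fun P hP => ?_⟩
  · exact IsLocalRing.isField_iff_maximalIdeal_eq.mpr h
  · exact IsLocalRing.eq_maximalIdeal (h1 P hP.1 hP.2)

end Variety

end

noncomputable section

/-! ### Function fields under normalization -/

section FunctionField

variable {X : Scheme.{u}} [IsIntegral X]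

/-- The pullback of rational functions extends the pullback of germs. -/
lemma pullbackFunction_algebraMap (V : normalization X)
    (a : X.presheaf.stalk (normalizationMap X V)) :
    pullbackFunction X (algebraMap _ _ a) =
      algebraMap _ (normalization X).functionField ((normalizationMap X).stalkMap V a) := by
  have h : V ∈ closure {genericPoint (normalization X)} :=
    (genericPoint_specializes V).mem_closure
  have h1 := Scheme.Hom.stalkSpecializes_stalkMap (normalizationMap X)
    (genericPoint (normalization X)) V (genericPoint_specializes V)
  have h2 : X.presheaf.stalkSpecializes
        (genericPoint_specializes (normalizationMap X V)) ≫
      X.presheaf.stalkSpecializes (specializes_of_eq (normalizationMap_genericPoint X)) =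
      X.presheaf.stalkSpecializes
        ((genericPoint_specializes V).map (normalizationMap X).continuous) :=
    X.presheaf.stalkSpecializes_comp _ _
  change (X.presheaf.stalkSpecializes (genericPoint_specializes (normalizationMap X V)) ≫
      X.presheaf.stalkSpecializes (specializes_of_eq (normalizationMap_genericPoint X)) ≫
        (normalizationMap X).stalkMap (genericPoint (normalization X))) a =
      ((normalizationMap X).stalkMap V ≫
        (normalization X).presheaf.stalkSpecializes (genericPoint_specializes V)) a
  rw [← Category.assoc, h2, ← h1]

lemma nonempty_preimage_normalizationMap {U : X.Opens} [Nonempty U] :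
    Nonempty (normalizationMap X ⁻¹ᵁ U) :=
  ⟨⟨genericPoint (normalization X), show normalizationMap X _ ∈ U by
    rw [normalizationMap_genericPoint]; exact genericPoint_mem⟩⟩

lemma pullbackFunction_algebraMap_section {U : X.Opens} [Nonempty U]
    [Nonempty (normalizationMap X ⁻¹ᵁ U)] (r : Γ(X, U)) :
    pullbackFunction X (algebraMap _ _ r) =
      algebraMap _ (normalization X).functionField ((normalizationMap X).app U r) := by
  have hη : normalizationMap X (genericPoint (normalization X)) ∈ U :=
    genericPoint_mem (U := normalizationMap X ⁻¹ᵁ U)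
  have h := pullbackFunction_algebraMap (genericPoint (normalization X)) (X.presheaf.germ U _ hη r)
  rw [Scheme.Hom.germ_stalkMap_apply, Scheme.algebraMap_germ_eq_germToFunctionField] at h
  exact h.trans (Scheme.algebraMap_germ_eq_germToFunctionField (normalization X)
    (genericPoint_mem (U := normalizationMap X ⁻¹ᵁ U)) _)

/-- The normalization map induces an isomorphism of function fields. -/
lemma pullbackFunction_bijective : Function.Bijective (pullbackFunction X) := by
  refine ⟨(pullbackFunction X).injective, fun z => ?_⟩
  obtain ⟨U, hU, hηU, -⟩ :=
    exists_isAffineOpen_mem_and_subset (U := ⊤) (x := genericPoint X) trivial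
  have : Nonempty U := ⟨⟨_, hηU⟩⟩
  have : Nonempty (normalizationMap X ⁻¹ᵁ U) := nonempty_preimage_normalizationMap
  have := functionField_isFractionRing_of_isAffineOpen _ _ (hU.preimage (normalizationMap X))
  obtain ⟨b, s, -, rfl⟩ := IsFractionRing.div_surjective
    (A := Γ(normalization X, normalizationMap X ⁻¹ᵁ U)) z
  have key : ∀ b, algebraMap Γ(normalization X, normalizationMap X ⁻¹ᵁ U)
      (normalization X).functionField b ∈ (pullbackFunction X).fieldRange := by
    intro b
    obtain ⟨r, s, hs, h⟩ := exists_normalizationMap_app_mul_eq hU b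
    have hs0 : algebraMap Γ(normalization X, normalizationMap X ⁻¹ᵁ U)
        (normalization X).functionField ((normalizationMap X).app U s) ≠ 0 := by
      rw [ne_eq, FaithfulSMul.algebraMap_eq_zero_iff]
      exact (map_ne_zero_iff _ (normalizationMap_app_injective hU)).mpr hs
    have h1 := congrArg (algebraMap Γ(normalization X, normalizationMap X ⁻¹ᵁ U)
      (normalization X).functionField) h
    rw [map_mul] at h1
    rw [eq_div_of_mul_eq hs0 ((mul_comm _ _).trans h1), ← pullbackFunction_algebraMap_section,
      ← pullbackFunction_algebraMap_section]
    exact div_mem ⟨_, rfl⟩ ⟨_, rfl⟩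
  exact div_mem (key b) (key s)

/-- The function field of the normalization is an algebra over the local rings of `X`, by pullback
of rational functions. -/
instance stalkNormalizationAlgebra (z : X) :
    Algebra (X.presheaf.stalk z) (normalization X).functionField :=
  ((pullbackFunction X).comp (algebraMap (X.presheaf.stalk z) X.functionField)).toAlgebra

/-- If the image of `V` specializes to `z`, the pullback of functions regular at `z` factors through
the local ring of `V`. -/
lemma algebraMap_stalk_normalization {z : X} {V : normalization X} (h : normalizationMap X V ⤳ z)
    (a : X.presheaf.stalk z) : algebraMap _ (normalization X).functionField a =
      algebraMap _ (normalization X).functionField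
        ((normalizationMap X).stalkMap V (X.presheaf.stalkSpecializes h a)) := by
  rw [← pullbackFunction_algebraMap]
  refine congrArg (pullbackFunction X) ?_
  change X.presheaf.stalkSpecializes (genericPoint_specializes z) a =
    (X.presheaf.stalkSpecializes h ≫ X.presheaf.stalkSpecializes _) a
  rw [X.presheaf.stalkSpecializes_comp]

end FunctionField

/-! ### The places of the normalization over a point -/

section Places

variable {k : Type u} [Field k] (X : Variety k)

/-- The prime divisors of the normalization whose image contains the point `z`. -/
abbrev PrimeDivisorsOver (z : X.toScheme) : Type u :=
  {V : normalization X.toScheme // Order.coheight V = 1 ∧ normalizationMap X.toScheme V ⤳ z}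

/-- The place of a prime divisor `V` of the normalization over `z`: its ring is the local ring of
`V`, and its residue field is viewed as an extension of the residue field of the image of `V`. The
algebra structures are the pullback maps of local rings and residue fields; they are local to this
definition. -/
def place (z : X.toScheme) (V : PrimeDivisorsOver X z) :
    Place (X.toScheme.presheaf.stalk z) (normalization X.toScheme).functionField :=
  let π := normalizationMap X.toScheme
  let N := normalization X.toScheme
  have : IsDiscreteValuationRing (N.presheaf.stalk V.1) := isDiscreteValuationRing_stalk X V.2.1
  let s := X.toScheme.presheaf.stalkSpecializes V.2.2
  let : Algebra (X.toScheme.presheaf.stalk z) (N.presheaf.stalk V.1) :=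
    (s ≫ π.stalkMap V.1).hom.toAlgebra
  let : Algebra (X.toScheme.presheaf.stalk z) (X.toScheme.residueField (π V.1)) :=
    (s ≫ X.toScheme.residue (π V.1)).hom.toAlgebra
  let : Algebra (X.toScheme.presheaf.stalk z) (N.residueField V.1) :=
    (s ≫ π.stalkMap V.1 ≫ N.residue V.1).hom.toAlgebra
  let : Algebra (X.toScheme.residueField (π V.1)) (N.residueField V.1) :=
    (π.residueFieldMap V.1).hom.toAlgebra
  let : Algebra (N.presheaf.stalk V.1) (N.residueField V.1) := (N.residue V.1).hom.toAlgebra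
  have : IsScalarTower (X.toScheme.presheaf.stalk z) (N.presheaf.stalk V.1) N.functionField :=
    .of_algebraMap_eq fun a => algebraMap_stalk_normalization V.2.2 a
  have : IsScalarTower (X.toScheme.presheaf.stalk z) (X.toScheme.residueField (π V.1))
      (N.residueField V.1) := .of_algebraMap_eq fun a => by
    change (s ≫ π.stalkMap V.1 ≫ N.residue V.1) a =
      ((s ≫ X.toScheme.residue (π V.1)) ≫ π.residueFieldMap V.1) a
    rw [Category.assoc, Scheme.residue_residueFieldMap]
  have : IsScalarTower (X.toScheme.presheaf.stalk z) (N.presheaf.stalk V.1)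
      (N.residueField V.1) := .of_algebraMap_eq fun _ => rfl
  Place.ofDVR (X.toScheme.presheaf.stalk z) N.functionField (N.presheaf.stalk V.1)
    (X.toScheme.residueField (π V.1)) (N.residueField V.1)
    fun x hx => (residue_eq_zero_iff V.1 x).mpr hx

variable {X}

/-- The valuation of the place of `V` is the order of vanishing along `V`. -/
lemma place_ord {z : X.toScheme} (V : PrimeDivisorsOver X z)
    {f : (normalization X.toScheme).functionField} (hf : f ≠ 0) :
    (place X z V).ord f = ordAlong V.1 f := by
  have : IsDiscreteValuationRing ((normalization X.toScheme).presheaf.stalk V.1) :=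
    isDiscreteValuationRing_stalk X V.2.1
  exact @Place.ord_ofDVR _ _ _ _ _ (_) (_) (_) (_) _ _ (_) (_) _ (_) (_) (_) (_) (_) (_) (_) (_) (_)
    (fun x hx => (residue_eq_zero_iff V.1 x).mpr hx) _ hf

variable (X) in
/-- The prime divisors of the normalization over a point form a divisorial family of places. -/
theorem isDivisorial_place (z : X.toScheme) : IsDivisorial (place X z) := by
  let π := normalizationMap X.toScheme
  let N := normalization X.toScheme
  obtain ⟨U, hU, hzU, -⟩ := exists_isAffineOpen_mem_and_subset (U := ⊤) (x := z) trivial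
  have hW : IsAffineOpen (π ⁻¹ᵁ U) := hU.preimage π
  have hne : Nonempty U := ⟨⟨z, hzU⟩⟩
  have hneW : Nonempty (π ⁻¹ᵁ U) := nonempty_preimage_normalizationMap
  have hcl := isIntegrallyClosed_sections_normalization hU
  have hfrac := functionField_isFractionRing_of_isAffineOpen N (π ⁻¹ᵁ U) hW
  have hnoeth : IsNoetherianRing Γ(X.toScheme, U) :=
    IsLocallyNoetherian.component_noetherian ⟨U, hU⟩
  let a₁ : Algebra Γ(X.toScheme, U) Γ(N, π ⁻¹ᵁ U) := (π.app U).hom.toAlgebra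
  have hfin : Module.Finite Γ(X.toScheme, U) Γ(N, π ⁻¹ᵁ U) := π.finite_app U hU
  let a₂ : Algebra Γ(X.toScheme, U) (X.toScheme.presheaf.stalk z) :=
    X.toScheme.presheaf.algebra_section_stalk (⟨z, hzU⟩ : U)
  let a₃ : Algebra Γ(X.toScheme, U) N.functionField :=
    ((algebraMap Γ(N, π ⁻¹ᵁ U) N.functionField).comp (π.app U).hom).toAlgebra
  have t₁ : IsScalarTower Γ(X.toScheme, U) Γ(N, π ⁻¹ᵁ U) N.functionField :=
    .of_algebraMap_eq' rfl
  have t₂ : IsScalarTower Γ(X.toScheme, U) (X.toScheme.presheaf.stalk z) N.functionField :=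
    .of_algebraMap_eq fun r => by
      change algebraMap Γ(N, π ⁻¹ᵁ U) N.functionField (π.app U r) =
        pullbackFunction _ (algebraMap _ _ (X.toScheme.presheaf.germ U z hzU r))
      rw [Scheme.algebraMap_germ_eq_germToFunctionField]
      exact (pullbackFunction_algebraMap_section r).symm
  have hVW : ∀ V : PrimeDivisorsOver X z, V.1 ∈ π ⁻¹ᵁ U := fun V => V.2.2.mem_open U.isOpen hzU
  have hcomap : ∀ V : ↥(π ⁻¹ᵁ U),
      PrimeSpectrum.comap (algebraMap Γ(X.toScheme, U) Γ(N, π ⁻¹ᵁ U)) (hW.primeIdealOf V) =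
        hU.primeIdealOf ⟨π V.1, V.2⟩ := fun V => by
    have h1 := IsAffineOpen.comap_primeIdealOf_appLE (f := π) U hU _ hW le_rfl V.2
    rw [← Scheme.Hom.app_eq_appLE] at h1
    exact h1
  refine isDivisorial_of_finite (R := Γ(X.toScheme, U)) (C := Γ(N, π ⁻¹ᵁ U))
    (hU.primeIdealOf ⟨z, hzU⟩) (fun s hs => ?_) (place X z)
    (fun V => hW.primeIdealOf ⟨V.1, hVW V⟩) (fun V V' h => ?_) (fun V => ?_) (fun q hq hqp => ?_)
    (fun V => (N.presheaf.germ (π ⁻¹ᵁ U) V.1 (hVW V)).hom) (fun V b => ?_) (fun V b => ?_)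
    (fun V x => ?_) (fun V => ?_) (fun f hf => ?_)
  · exact not_not.mp fun h => hs ((mem_primeIdealOf_iff hU ⟨z, hzU⟩ s).mpr h)
  · exact Subtype.ext (Subtype.mk.inj (primeIdealOf_injective hW h))
  · exact (coheight_eq_one_iff_bot_covBy hW ⟨V.1, hVW V⟩).mp V.2.1
  · obtain ⟨V, rfl⟩ := primeIdealOf_surjective hW q
    rw [hcomap] at hqp
    exact ⟨⟨V.1, (coheight_eq_one_iff_bot_covBy hW V).mpr hq,
      (le_iff_primeIdealOf_le hU ⟨z, hzU⟩ ⟨π V.1, V.2⟩).mpr hqp⟩, rfl⟩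
  · exact Scheme.algebraMap_germ_eq_germToFunctionField N (hVW V) b
  · exact (residue_eq_zero_iff V.1 _).trans (mem_primeIdealOf_iff hW ⟨V.1, hVW V⟩ b).symm
  · obtain ⟨b, s, hs, h⟩ := exists_mul_germ_eq_germ hW (hVW V) x
    exact ⟨b, s, fun h0 => (mem_primeIdealOf_iff hW ⟨V.1, hVW V⟩ s).mp h0 hs, h⟩
  · exact N.residue_surjective V.1
  · refine Set.Finite.of_finite_image ((finite_ordAlong (Units.mk0 f hf)).subset ?_)
      Subtype.val_injective.injOn
    rintro _ ⟨V, hV, rfl⟩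
    rw [Set.mem_ofPred_eq, place_ord V hf] at hV
    rw [Function.mem_support, if_pos V.2.1]
    exact hV

end Places

end

noncomputable section

/-! ### Orders and residues at prime divisors of the normalization -/

/-- A unit of the valuation ring has order zero and is its own unit part. -/
lemma Place.ord_residueOrd_toField {A K : Type u} [CommRing A] [Field K] [Algebra A K]
    (P : Place A K) (v : P.Oˣ) : P.ord (P.toField v) = 0 ∧ P.residueOrd (P.toField v) =
      fracOrd (algebraMap A P.κ₀).range (Algebra.norm P.κ₀ (P.res v)) := by
  have h : P.mulPow 0 v = P.toField v := by simp
  have h1 := P.ord_unitPart_mulPow 0 v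
  rw [h] at h1
  exact ⟨h1.1, by rw [Place.residueOrd, h1.2]⟩

/-- The tame symbol `y ^ ord x / x ^ ord y` is a unit of the valuation ring, and the order of the
norm of its residue is the summand of the reciprocity law. -/
lemma Place.exists_tame {A K : Type u} [CommRing A] [Field K] [Algebra A K] (P : Place A K)
    (H : IsOrderRing A P.κ₀) [FiniteDimensional P.κ₀ P.κ] {x y : K} (hx : x ≠ 0) (hy : y ≠ 0) :
    ∃ v : P.Oˣ, P.toField v = y ^ P.ord x / x ^ P.ord y ∧
      fracOrd (algebraMap A P.κ₀).range (Algebra.norm P.κ₀ (P.res v)) =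
        P.ord x * P.residueOrd y - P.ord y * P.residueOrd x := by
  have hmap : ∀ {L : Type u} [Field L] (f : P.O →* L) (u : P.Oˣ) (n : ℤ), f ↑(u ^ n) = f u ^ n :=
    fun f u n => (congrArg Units.val (map_zpow (Units.map f) u n)).trans
      (Units.val_zpow_eq_zpow_val _ _)
  have hu : ∀ (u : P.Oˣ) (n : ℤ), P.toField ↑(u ^ n) = P.toField u ^ n :=
    hmap (P.toField : P.O →* K)
  have hr : ∀ (u : P.Oˣ) (n : ℤ), Algebra.norm P.κ₀ (P.res ↑(u ^ n)) =
      Algebra.norm P.κ₀ (P.res u) ^ n := hmap ((Algebra.norm P.κ₀).comp (P.res : P.O →* P.κ))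
  have hn : ∀ u : P.Oˣ, Algebra.norm P.κ₀ (P.res u) ≠ 0 := fun u =>
    Algebra.norm_ne_zero_iff.mpr (P.res_unit_ne_zero _)
  have hϖ := P.toField_unif_ne_zero
  have hdiv : ∀ z : K, z ≠ 0 → z = P.toField P.unif ^ P.ord z * P.toField (P.unitPart z) :=
    fun z hz => (P.mulPow_ord_unitPart hz).symm
  refine ⟨P.unitPart y ^ P.ord x * P.unitPart x ^ (-P.ord y), ?_, ?_⟩
  · rw [Units.val_mul, map_mul, hu, hu]
    have hxu := P.toField_unit_ne_zero (P.unitPart x)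
    rw [eq_div_iff (zpow_ne_zero _ hx)]
    conv_lhs => rw [hdiv x hx, ← hdiv x hx]
    have h1 : x ^ P.ord y = P.toField P.unif ^ (P.ord x * P.ord y) *
        P.toField (P.unitPart x) ^ P.ord y := by
      conv_lhs => rw [hdiv x hx]
      rw [mul_zpow, ← zpow_mul]
    have h2 : y ^ P.ord x = P.toField P.unif ^ (P.ord x * P.ord y) *
        P.toField (P.unitPart y) ^ P.ord x := by
      conv_lhs => rw [hdiv y hy]
      rw [mul_zpow, ← zpow_mul, mul_comm (P.ord y)]
    rw [h1, h2, zpow_neg]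
    field_simp
  · rw [Units.val_mul, map_mul, map_mul, hr, hr,
      H.fracOrd_mul (zpow_ne_zero _ (hn _)) (zpow_ne_zero _ (hn _)), H.fracOrd_zpow (hn _),
      H.fracOrd_zpow (hn _), Place.residueOrd, Place.residueOrd]
    ring

/-- The restriction of a rational function is computed by any germ that represents it. -/
lemma restrict_eq {Y : Scheme.{u}} [IsIntegral Y] {f : Y.functionFieldˣ} {v : Y}
    (a : (Y.presheaf.stalk v)ˣ) (h : algebraMap (Y.presheaf.stalk v) Y.functionField a = f) :
    restrict f v = Units.map (Y.residue v).hom.toMonoidHom a := by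
  have hex : ∃ a : (Y.presheaf.stalk v)ˣ, algebraMap (Y.presheaf.stalk v) Y.functionField a = f :=
    ⟨a, h⟩
  rw [restrict, dif_pos hex]
  congr 1
  exact Units.ext (IsFractionRing.injective _ Y.functionField (hex.choose_spec.trans h.symm))

lemma divCoeff_mul {Y : Scheme.{u}} [IsLocallyNoetherian Y] (v : Y) (r s : (Y.residueField v)ˣ)
    (w : Y) : divCoeff v (r * s) w = divCoeff v r w + divCoeff v s w := by
  unfold divCoeff
  split_ifs with h
  · let : Algebra (Y.presheaf.stalk w) (Y.residueField v) :=
      (Y.presheaf.stalkSpecializes (show v ⤳ w from h.le) ≫ Y.residue v).hom.toAlgebra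
    exact (isOrderRing_residueField h rfl).fracOrd_mul r.ne_zero s.ne_zero
  · rfl

/-- Points of codimension one do not specialize to one another. -/
lemma eq_of_specializes_of_coheight_eq_one {Y : Scheme.{u}} [IsIntegral Y] {v v' : Y}
    (hv : Order.coheight v = 1) (hv' : Order.coheight v' = 1) (h : v' ⤳ v) : v' = v := by
  by_contra hne
  exact (covBy_genericPoint hv).2
    (lt_of_le_not_ge (show v ≤ v' from h) fun h2 => hne (h.antisymm (show v ⤳ v' from h2)).eq)
    (covBy_genericPoint hv').1

section Places

variable {k : Type u} [Field k] {X : Variety k}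

/-- If `w` is an immediate specialization of one prime divisor, the hypothesis of the reciprocity
law is satisfied at every prime divisor of the normalization over `w`. -/
lemma isOrderRing_place {w v : X.toScheme} (hw : w ⋖ v) (hv : Order.coheight v = 1)
    (V : PrimeDivisorsOver X w) : IsOrderRing (X.toScheme.presheaf.stalk w) (place X w V).κ₀ := by
  have h := covBy_of_specializes X hw hv (coheight_normalizationMap X V.2.1) V.2.2
  let : Algebra (X.toScheme.presheaf.stalk w)
      (X.toScheme.residueField (normalizationMap X.toScheme V.1)) :=
    (X.toScheme.presheaf.stalkSpecializes V.2.2 ≫ X.toScheme.residue _).hom.toAlgebra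
  exact isOrderRing_residueField h rfl

/-- Let `x` be a unit at the image of `V`. Then `x` has order zero along `V`, and its residue comes
from the residue field of the image, so that the norm of the residue is a power whose exponent is
the residue degree. -/
lemma ord_residueOrd_place_of_isUnit {w : X.toScheme} (V : PrimeDivisorsOver X w)
    (hw : w ⋖ normalizationMap X.toScheme V.1) (x : X.toScheme.functionFieldˣ)
    (a : (X.toScheme.presheaf.stalk (normalizationMap X.toScheme V.1))ˣ)
    (ha : algebraMap _ X.toScheme.functionField a.1 = x) :
    (place X w V).ord (pullbackUnit x : (normalization X.toScheme).functionField) = 0 ∧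
    (place X w V).residueOrd (pullbackUnit x : (normalization X.toScheme).functionField) =
      (normalizationMap X.toScheme).residueDegree V.1 *
        divCoeff (normalizationMap X.toScheme V.1)
          (restrict x (normalizationMap X.toScheme V.1)) w := by
  let π := normalizationMap X.toScheme
  let u : (place X w V).Oˣ := Units.map (π.stalkMap V.1).hom.toMonoidHom a
  have hu : (place X w V).toField u =
      (pullbackUnit x : (normalization X.toScheme).functionField) := by
    refine (pullbackFunction_algebraMap V.1 a.1).symm.trans ?_
    rw [ha]
    rfl
  have h := (place X w V).ord_residueOrd_toField u
  rw [hu] at h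
  refine ⟨h.1, h.2.trans ?_⟩
  let r : (place X w V).κ₀ := X.toScheme.residue (π V.1) a.1
  have hr0 : r ≠ 0 := fun h0 => (residue_eq_zero_iff _ _).mp h0 a.isUnit
  have hres : (place X w V).res u = algebraMap (place X w V).κ₀ (place X w V).κ r := by
    change (π.stalkMap V.1 ≫ (normalization X.toScheme).residue V.1) a.1 =
      (X.toScheme.residue (π V.1) ≫ π.residueFieldMap V.1) a.1
    rw [Scheme.residue_residueFieldMap]
  have hfin := (isDivisorial_place X w).finiteDimensional V
  rw [hres, Algebra.norm_algebraMap, (isOrderRing_place hw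
    (coheight_normalizationMap X V.2.1) V).fracOrd_pow hr0, restrict_eq a ha, divCoeff, dif_pos hw]
  rfl

/-- The norm `κ(V)ˣ → κ(π(V))ˣ` of the residue field extension of a point of the normalization. -/
def normResidue {X : Scheme.{u}} [IsIntegral X] (V : normalization X) :
    ((normalization X).residueField V)ˣ →* (X.residueField (normalizationMap X V))ˣ :=
  let : Algebra (X.residueField (normalizationMap X V)) ((normalization X).residueField V) :=
    ((normalizationMap X).residueFieldMap V).hom.toAlgebra
  Units.map (Algebra.norm (X.residueField (normalizationMap X V)))

/-- The coefficient at `w` of the divisor of the norm of the tame symbol along `V` is the summand of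
the reciprocity law at `V`. -/
lemma divCoeff_norm_tame (D E : PDivisor X.toScheme) {w : X.toScheme} (V : PrimeDivisorsOver X w)
    (hw : w ⋖ normalizationMap X.toScheme V.1) :
    divCoeff (normalizationMap X.toScheme V.1) (normResidue V.1 (D.tame E V.1)) w =
      (place X w V).ord (pullbackUnit D.x : (normalization X.toScheme).functionField) *
        (place X w V).residueOrd (pullbackUnit E.x : (normalization X.toScheme).functionField) -
      (place X w V).ord (pullbackUnit E.x : (normalization X.toScheme).functionField) *
        (place X w V).residueOrd (pullbackUnit D.x : (normalization X.toScheme).functionField) := by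
  have hfin := (isDivisorial_place X w).finiteDimensional V
  obtain ⟨u, hu, h⟩ := (place X w V).exists_tame (isOrderRing_place hw
    (coheight_normalizationMap X V.2.1) V) (pullbackUnit D.x).ne_zero (pullbackUnit E.x).ne_zero
  rw [← h]
  rw [place_ord V (pullbackUnit D.x).ne_zero, place_ord V (pullbackUnit E.x).ne_zero] at hu
  have h1 : D.tame E V.1 =
      Units.map ((normalization X.toScheme).residue V.1).hom.toMonoidHom u := by
    refine restrict_eq (Y := normalization X.toScheme) u (hu.trans ?_)
    simp only [Units.val_div_eq_div_val, Units.val_zpow_eq_zpow_val]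
    rfl
  rw [h1, divCoeff, dif_pos hw]
  rfl

/-- The divisor of a rational function is the pushforward of the divisor of its pullback to the
normalization. -/
lemma weilDivisor_eq_sum (y : X.toScheme.functionFieldˣ) :
    weilDivisor y = (weilDivisor (pullbackUnit y)).sum fun V n =>
      Finsupp.single (normalizationMap X.toScheme V)
        (n * ((normalizationMap X.toScheme).residueDegree V : ℤ)) := by
  classical
  let π := normalizationMap X.toScheme
  have hW : ∀ V, weilDivisor (pullbackUnit y) V = if Order.coheight V = 1 then
      ordAlong V (pullbackUnit y : (normalization X.toScheme).functionField) else 0 := fun _ => rfl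
  ext v
  rw [Finsupp.sum_apply]
  change (if Order.coheight v = 1 then ordAlong v (y : X.toScheme.functionField) else 0) = _
  split_ifs with hv
  · let : Algebra X.toScheme.functionField (normalization X.toScheme).functionField :=
      (pullbackFunction X.toScheme).toAlgebra
    have ht : IsScalarTower (X.toScheme.presheaf.stalk v) X.toScheme.functionField
        (normalization X.toScheme).functionField := .of_algebraMap_eq' rfl
    have hbij : Function.Bijective (algebraMap X.toScheme.functionField
        (normalization X.toScheme).functionField) := pullbackFunction_bijective
    have hrank : Module.finrank X.toScheme.functionField
        (normalization X.toScheme).functionField = 1 := by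
      rw [← (LinearEquiv.ofBijective (Algebra.linearMap X.toScheme.functionField
        (normalization X.toScheme).functionField) hbij).finrank_eq, Module.finrank_self]
    have hfd : FiniteDimensional X.toScheme.functionField
        (normalization X.toScheme).functionField := Module.finite_of_finrank_eq_succ hrank
    have hdim : Ring.KrullDimLE 1 (X.toScheme.presheaf.stalk v) := krullDimLE_of_coheight_le hv.le
    have hover : ∀ V : PrimeDivisorsOver X v, π V.1 = v := fun V =>
      eq_of_specializes_of_coheight_eq_one hv (coheight_normalizationMap X V.2.1) V.2.2
    -- the two function fields agree, so that the norm in this formula is the identity; the prime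
    -- divisors over `v` are exactly those with image `v`
    have key := (isDivisorial_place X v).fracOrd_det_eq_finsum (F := X.toScheme.functionField)
      (isOrderRing_of_krullDimLE_one _ _) ?_ ?_ (pullbackUnit y).ne_zero
    · have hnorm : Algebra.norm X.toScheme.functionField
          (pullbackUnit y : (normalization X.toScheme).functionField) = y := by
        change Algebra.norm X.toScheme.functionField (algebraMap X.toScheme.functionField
          (normalization X.toScheme).functionField y) = y
        rw [Algebra.norm_algebraMap, hrank, pow_one]
      rw [hnorm] at key
      refine key.trans ?_
      have hterm : ∀ V : PrimeDivisorsOver X v, (place X v V).ord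
          (pullbackUnit y : (normalization X.toScheme).functionField) *
            (Module.finrank (place X v V).κ₀ (place X v V).κ : ℤ) =
          weilDivisor (pullbackUnit y) V.1 * (π.residueDegree V.1 : ℤ) := fun V => by
        rw [place_ord V (pullbackUnit y).ne_zero, hW, if_pos V.2.1]
        rfl
      rw [finsum_congr hterm, finsum_subtype_eq_finsum_cond
        (fun V => Order.coheight V = 1 ∧ π V ⤳ v)
        (f := fun V => weilDivisor (pullbackUnit y) V * (π.residueDegree V : ℤ)), Finsupp.sum,
        finsum_eq_sum_of_support_subset (s := (weilDivisor (pullbackUnit y)).support)]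
      · refine Finset.sum_congr rfl fun V hV => ?_
        have hV1 : Order.coheight V = 1 := by
          by_contra h
          rw [Finsupp.mem_support_iff, hW, if_neg h] at hV
          exact hV rfl
        rw [Finsupp.single_apply]
        by_cases h : π V = v
        · rw [if_pos h, finsum_eq_if, if_pos ⟨hV1, specializes_of_eq h⟩]
        · rw [if_neg h, finsum_eq_if, if_neg fun h2 => h (hover ⟨V, h2⟩)]
      · intro V hV
        rw [Finset.mem_coe, Finsupp.mem_support_iff]
        intro h
        refine hV ?_
        simp only [h, zero_mul, finsum_zero]
    · rw [eq_top_iff]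
      intro z _
      obtain ⟨c, rfl⟩ := hbij.2 z
      rw [Algebra.algebraMap_eq_smul_one]
      refine Submodule.smul_mem _ _ (Submodule.subset_span ?_)
      exact (mem_divisorial _ one_ne_zero).mpr fun V => by simp [(place X v V).ord_one]
    · intro V t
      obtain ⟨b, rfl⟩ := X.toScheme.residue_surjective (π V.1) t
      have h1 : v ⤳ π V.1 := specializes_of_eq (hover V).symm
      refine ⟨X.toScheme.presheaf.stalkSpecializes h1 b, ?_⟩
      change (X.toScheme.presheaf.stalkSpecializes h1 ≫ X.toScheme.presheaf.stalkSpecializes V.2.2 ≫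
        X.toScheme.residue (π V.1)) b = _
      rw [X.toScheme.presheaf.stalkSpecializes_comp_assoc,
        X.toScheme.presheaf.stalkSpecializes_refl, Category.id_comp]
  · symm
    refine Finset.sum_eq_zero fun V hV => ?_
    beta_reduce
    rw [Finsupp.single_apply, if_neg]
    rintro rfl
    rw [Finsupp.mem_support_iff, hW] at hV
    by_cases h : Order.coheight V = 1
    · exact hv (coheight_normalizationMap X h)
    · rw [if_neg h] at hV
      exact hV rfl

end Places

end

noncomputable section

/-! ### Coefficients of the boundary and of intersection cycles -/

section Coefficients

open Classical in
/-- The coefficient of the boundary at `w`, as a homomorphism. -/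
def boundaryCoeff {Y : Scheme.{u}} [IsLocallyNoetherian Y] (w : Y) : RatEquivs Y →+ ℤ :=
  DirectSum.toAddMonoid fun v =>
    { toFun := fun r => divCoeff v r.toMul w
      map_zero' := by
        have h := divCoeff_mul v (1 : (Y.residueField v)ˣ) 1 w
        rw [mul_one] at h
        exact left_eq_add.mp h
      map_add' := fun r s => divCoeff_mul v r.toMul s.toMul w }

open Classical in
lemma boundaryCoeff_of {Y : Scheme.{u}} [IsLocallyNoetherian Y] (w v : Y)
    (r : Additive (Y.residueField v)ˣ) :
    boundaryCoeff w (DirectSum.of (fun v => Additive (Y.residueField v)ˣ) v r) =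
      divCoeff v r.toMul w :=
  DirectSum.toAddMonoid_of _ _ _

lemma boundary_apply {Y : Scheme.{u}} [IsNoetherian Y] (ω : RatEquivs Y) (w : Y) :
    boundary ω w = boundaryCoeff w ω := by
  classical
  rw [boundary, Finsupp.finsetSum_apply]
  exact (DFinsupp.sumAddHom_apply (fun v => (⟨⟨fun r => divCoeff v r.toMul w, _⟩, _⟩ :
    Additive (Y.residueField v)ˣ →+ ℤ)) ω).symm

open Classical in
lemma pushforward_of {X : Scheme.{u}} [IsIntegral X] (V : normalization X)
    (r : ((normalization X).residueField V)ˣ) :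
    pushforward (normalizationMap X)
      (DirectSum.of (fun V => Additive ((normalization X).residueField V)ˣ) V (Additive.ofMul r)) =
    DirectSum.of (fun v => Additive (X.residueField v)ˣ) (normalizationMap X V)
      (Additive.ofMul (normResidue V r)) :=
  DirectSum.toAddMonoid_of _ _ _

variable {X : Scheme.{u}} [IsIntegral X] (D E : PDivisor X)

open Classical in
lemma PDivisor.tameSum_eq (S : Set (normalization X)) : D.tameSum E S = ∑ᶠ V ∈ S,
    DirectSum.of (fun v => Additive (X.residueField v)ˣ) (normalizationMap X V)
      (Additive.ofMul (normResidue V (D.tame E V))) :=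
  finsum_congr fun V => finsum_congr fun _ => pushforward_of V _

lemma PDivisor.tameSum_mem_ratEquivsOn {T : Set X} {S : Set (normalization X)}
    (hS : ∀ V ∈ S, normalizationMap X V ∈ T) : D.tameSum E S ∈ ratEquivsOn T := by
  classical
  rw [D.tameSum_eq]
  refine finsum_mem_induction (· ∈ ratEquivsOn T) (zero_mem _) (fun _ _ => add_mem)
    fun V hV v hv => ?_
  exact DirectSum.of_eq_of_ne _ _ _ fun h => hv (h.symm ▸ hS V hV)

lemma PDivisor.boundary_tameSum_apply [IsNoetherian X] {S : Set (normalization X)} (hS : S.Finite)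
    (w : X) : boundary (D.tameSum E S) w =
      ∑ᶠ V ∈ S, divCoeff (normalizationMap X V) (normResidue V (D.tame E V)) w := by
  classical
  rw [boundary_apply, D.tameSum_eq, (boundaryCoeff w).map_finsum_mem _ hS]
  exact finsum_congr fun V => finsum_congr fun _ => boundaryCoeff_of _ _ _

lemma PDivisor.inter_apply [IsNoetherian X] (α : Cycles X) (w : X) :
    D.inter α w = α.sum fun v n => n * D.interSubvariety v w := by
  rw [PDivisor.inter, Finsupp.sum_apply]
  rfl

open Classical in
lemma PDivisor.interSubvariety_apply [IsNoetherian X] (v w : X) : D.interSubvariety v w =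
    if v ∉ D.support ∧ w ∈ D.U then divCoeff v (restrict D.x v) w else 0 := by
  rw [PDivisor.interSubvariety]
  by_cases h : v ∈ D.support
  · rw [if_pos h, if_neg fun h2 => h2.1 h]; rfl
  · rw [if_neg h, Finsupp.filter_apply]
    by_cases hw : w ∈ D.U
    · rw [if_pos hw, if_pos ⟨h, hw⟩]; rfl
    · rw [if_neg hw, if_neg fun h2 => hw h2.2]

lemma PDivisor.notMem_support_iff (v : X) : v ∉ D.support ↔ v ∈ D.U' := by
  rw [PDivisor.support, D.support_eq]
  exact not_not

/-- On `U ∩ U'` the local defining function is a unit. -/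
lemma PDivisor.exists_unit_eq {v : X} (h : v ∈ D.U) (h' : v ∈ D.U') :
    ∃ a : (X.presheaf.stalk v)ˣ, algebraMap _ X.functionField a.1 = D.x := by
  obtain ⟨hη, a, ha⟩ := D.isUnit
  have hv : v ∈ D.U ⊓ D.U' := ⟨h, h'⟩
  have : Nonempty (D.U ⊓ D.U' : X.Opens) := ⟨⟨v, hv⟩⟩
  exact ⟨Units.map (X.presheaf.germ _ v hv).hom.toMonoidHom a,
    (Scheme.algebraMap_germ_eq_germToFunctionField X hv _).trans ha⟩

lemma PDivisor.mem_U_or (v : X) : v ∈ D.U ∨ v ∈ D.U' := by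
  have h : v ∈ D.U ⊔ D.U' := D.cover ▸ trivial
  exact h

end Coefficients

/-! ### Commutativity of intersection -/

section Main

variable {k : Type u} [Field k] {X : Variety k} (D E : PDivisor X.toScheme)

open Classical in
/-- The contribution of the prime divisor `V` of the normalization to the coefficient of
`D · [E]` at `w`. -/
def PDivisor.contribution (V : normalization X.toScheme) (w : X.toScheme) : ℤ :=
  weilDivisor (pullbackUnit E.x) V * (normalizationMap X.toScheme).residueDegree V *
    if normalizationMap X.toScheme V ∈ E.U then
      D.interSubvariety (normalizationMap X.toScheme V) w else 0

/-- The coefficient of `D · [E]` at `w`, as a sum over the prime divisors of the normalization. -/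
lemma PDivisor.inter_cycle_apply (w : X.toScheme) :
    D.inter E.cycle w = ∑ᶠ V, D.contribution E V w := by
  classical
  let π := normalizationMap X.toScheme
  have h1 : D.inter E.cycle w = (weilDivisor E.x).sum fun v n =>
      n * if v ∈ E.U then D.interSubvariety v w else 0 := by
    rw [D.inter_apply, PDivisor.cycle, Finsupp.sum, Finsupp.sum, Finsupp.support_filter,
      Finset.sum_filter]
    refine Finset.sum_congr rfl fun v _ => ?_
    by_cases h : v ∈ E.U
    · rw [if_pos h, if_pos h, Finsupp.filter_apply_pos _ _ h]
    · rw [if_neg h, if_neg h, mul_zero]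
  rw [h1, weilDivisor_eq_sum,
    Finsupp.sum_sum_index (fun _ => zero_mul _) fun _ _ _ => add_mul _ _ _,
    finsum_eq_sum_of_support_subset (s := (weilDivisor (pullbackUnit E.x)).support)]
  · refine Finset.sum_congr rfl fun V _ => ?_
    exact Finsupp.sum_single_index (zero_mul _)
  · intro V hV
    rw [Finset.mem_coe, Finsupp.mem_support_iff]
    intro h
    refine hV ?_
    change weilDivisor (pullbackUnit E.x) V * _ * _ = 0
    rw [h, zero_mul, zero_mul]

lemma PDivisor.finite_support_contribution (w : X.toScheme) :
    (Function.support fun V => D.contribution E V w).Finite := by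
  refine (weilDivisor (pullbackUnit E.x)).support.finite_toSet.subset fun V hV => ?_
  rw [Finset.mem_coe, Finsupp.mem_support_iff]
  intro h
  refine hV ?_
  change weilDivisor (pullbackUnit E.x) V * _ * _ = 0
  rw [h, zero_mul, zero_mul]

/-- The set of prime divisors of the normalization that lie over the intersection of the
supports. -/
def PDivisor.commonDivisors : Set (normalization X.toScheme) :=
  {V | Order.coheight V = 1 ∧ normalizationMap X.toScheme V ∈ D.support ∩ E.support}

lemma PDivisor.finite_commonDivisors : (D.commonDivisors E).Finite := by
  refine (finite_covBy_notMem (genericPoint (normalization X.toScheme))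
    (normalizationMap X.toScheme ⁻¹ᵁ D.U') ?_).subset fun V hV => ?_
  · change normalizationMap X.toScheme _ ∈ D.U'
    rw [normalizationMap_genericPoint]
    have : Nonempty D.U' := D.nonempty_U'.to_subtype
    exact genericPoint_mem
  · exact ⟨covBy_genericPoint hV.1, fun h => (D.notMem_support_iff _).mpr h hV.2.1⟩

/-- If the local defining function of `E` is a unit at the image of `V`, then `V` contributes
nothing to `D · [E]`. -/
lemma PDivisor.contribution_eq_zero {V : normalization X.toScheme}
    {w : X.toScheme} (h : normalizationMap X.toScheme V ∉ E.support) :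
    D.contribution E V w = 0 := by
  classical
  rw [PDivisor.contribution]
  by_cases hU : normalizationMap X.toScheme V ∈ E.U
  · obtain ⟨a, ha⟩ := E.exists_unit_eq hU ((E.notMem_support_iff _).mp h)
    have hW : weilDivisor (pullbackUnit E.x) V = 0 := by
      change (if Order.coheight V = 1 then ordAlong V
        (pullbackUnit E.x : (normalization X.toScheme).functionField) else 0) = 0
      split_ifs with hV
      · have hu := pullbackFunction_algebraMap V a.1
        rw [ha] at hu
        let u := Units.map ((normalizationMap X.toScheme).stalkMap V).hom.toMonoidHom a
        refine fracOrd_eq_zero _ ⟨u.1, hu.symm⟩ ⟨(u⁻¹).1, eq_inv_of_mul_eq_one_left ?_⟩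
        change _ * pullbackFunction X.toScheme E.x = 1
        rw [hu]
        change _ * algebraMap _ _ u.1 = 1
        rw [← map_mul, Units.inv_mul, map_one]
      · rfl
    rw [hW, zero_mul, zero_mul]
  · rw [if_neg hU, mul_zero]

/-- Only the prime divisors whose image has `w` as an immediate specialization contribute at `w`. -/
lemma PDivisor.contribution_eq_zero_of_not_covBy {V : normalization X.toScheme}
    {w : X.toScheme} (h : ¬ (Order.coheight V = 1 ∧ w ⋖ normalizationMap X.toScheme V)) :
    D.contribution E V w = 0 := by
  classical
  by_cases hV : Order.coheight V = 1
  swap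
  · have hW : weilDivisor (pullbackUnit E.x) V = 0 := if_neg hV
    rw [PDivisor.contribution, hW, zero_mul, zero_mul]
  rw [PDivisor.contribution, D.interSubvariety_apply]
  have : divCoeff (normalizationMap X.toScheme V)
      (restrict D.x (normalizationMap X.toScheme V)) w = 0 :=
    dif_neg fun h2 => h ⟨hV, h2⟩
  simp [this]

/-- Away from the support of `D`, the contribution to `D · [E]` is a product of orders. -/
lemma PDivisor.contribution_eq {w : X.toScheme} (V : PrimeDivisorsOver X w)
    (hw : w ⋖ normalizationMap X.toScheme V.1) (hD : w ∈ D.U) (hE : w ∈ E.U)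
    (h : normalizationMap X.toScheme V.1 ∉ D.support) :
    (place X w V).ord (pullbackUnit D.x : (normalization X.toScheme).functionField) = 0 ∧
    D.contribution E V.1 w =
      (place X w V).ord (pullbackUnit E.x : (normalization X.toScheme).functionField) *
        (place X w V).residueOrd (pullbackUnit D.x : (normalization X.toScheme).functionField) := by
  classical
  have hDV := V.2.2.mem_open D.U.isOpen hD
  have hEV : normalizationMap X.toScheme V.1 ∈ E.U := V.2.2.mem_open E.U.isOpen hE
  obtain ⟨a, ha⟩ := D.exists_unit_eq hDV ((D.notMem_support_iff _).mp h)
  obtain ⟨h1, h2⟩ := ord_residueOrd_place_of_isUnit V hw D.x a ha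
  refine ⟨h1, ?_⟩
  rw [h2, PDivisor.contribution, if_pos hEV, D.interSubvariety_apply, if_pos ⟨h, hD⟩,
    place_ord V (pullbackUnit E.x).ne_zero]
  have hW : weilDivisor (pullbackUnit E.x) V.1 =
    ordAlong V.1 (pullbackUnit E.x : (normalization X.toScheme).functionField) := if_pos V.2.1
  rw [hW]
  ring

lemma PDivisor.contribution_eq_zero_of_mem {V : normalization X.toScheme} {w : X.toScheme}
    (h : normalizationMap X.toScheme V ∈ D.support) : D.contribution E V w = 0 := by
  classical
  have h1 : D.interSubvariety (normalizationMap X.toScheme V) w = 0 := by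
    rw [D.interSubvariety_apply, if_neg fun h2 => h2.1 h]
  rw [PDivisor.contribution, h1, ite_self, mul_zero]

lemma PDivisor.contribution_eq_zero_of_notMem {V : normalization X.toScheme} {w : X.toScheme}
    (h : w ∉ D.U) : D.contribution E V w = 0 := by
  classical
  have h1 : D.interSubvariety (normalizationMap X.toScheme V) w = 0 := by
    rw [D.interSubvariety_apply, if_neg fun h2 => h h2.2]
  rw [PDivisor.contribution, h1, ite_self, mul_zero]

/-- A point outside `U` has no generization in the support. -/
lemma PDivisor.notMem_support_of_notMem {v w : X.toScheme} (h : w ∉ D.U) (hvw : v ⤳ w) :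
    v ∉ D.support :=
  (D.notMem_support_iff v).mpr
    (hvw.mem_open D.U'.isOpen ((D.mem_U_or w).resolve_left h))

/-- The coefficient of `D · [E] - E · [D]` at `w`. If `w` lies in both charts `U`, the contribution
to the difference of each prime divisor `V` that is not common to the supports is the negative of
the summand of the reciprocity law, while the common ones contribute nothing. By reciprocity the
total is the sum of the summands over the common prime divisors. If `w` is outside one of the
charts, or is not an immediate specialization of the image of any prime divisor, every term
vanishes. -/
lemma PDivisor.inter_cycle_sub_apply (w : X.toScheme) :
    D.inter E.cycle w - E.inter D.cycle w = ∑ᶠ V ∈ D.commonDivisors E,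
      divCoeff (normalizationMap X.toScheme V) (normResidue V (D.tame E V)) w := by
  classical
  let π := normalizationMap X.toScheme
  rw [D.inter_cycle_apply, E.inter_cycle_apply, ← finsum_sub_distrib
    (D.finite_support_contribution E w) (E.finite_support_contribution D w)]
  by_cases hDE : (w ∈ D.U ∧ w ∈ E.U) ∧
      ∃ V : normalization X.toScheme, Order.coheight V = 1 ∧ w ⋖ π V
  · obtain ⟨⟨hD, hE⟩, V₀, hV₀, hw₀⟩ := hDE
    have hcov : ∀ V : PrimeDivisorsOver X w, w ⋖ π V.1 := fun V =>
      covBy_of_specializes X hw₀ (coheight_normalizationMap X hV₀)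
        (coheight_normalizationMap X V.2.1) V.2.2
    have hrec := (isDivisorial_place X w).reciprocity
      (isOrderRing_place hw₀ (coheight_normalizationMap X hV₀))
      (pullbackUnit D.x).ne_zero (pullbackUnit E.x).ne_zero
    have hord := (isDivisorial_place X w).finite_ord
    -- the summand of the reciprocity law, extended by zero to all points of the normalization
    let ρ : normalization X.toScheme → ℤ := fun V =>
      if h : Order.coheight V = 1 ∧ π V ⤳ w then
        (place X w ⟨V, h⟩).ord (pullbackUnit D.x : (normalization X.toScheme).functionField) *
          (place X w ⟨V, h⟩).residueOrd
            (pullbackUnit E.x : (normalization X.toScheme).functionField) -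
        (place X w ⟨V, h⟩).ord (pullbackUnit E.x : (normalization X.toScheme).functionField) *
          (place X w ⟨V, h⟩).residueOrd
            (pullbackUnit D.x : (normalization X.toScheme).functionField)
      else 0
    have hρ : ∑ᶠ V, ρ V = 0 := by
      have h1 := finsum_subtype_eq_finsum_cond (fun V => Order.coheight V = 1 ∧ π V ⤳ w) (f := ρ)
      rw [← hrec]
      refine Eq.trans (finsum_congr fun V => ?_) (h1.symm.trans (finsum_congr fun V => dif_pos V.2))
      rw [finsum_eq_if]
      split_ifs with h
      · rfl
      · exact dif_neg h
    have hρfin : (Function.support ρ).Finite := by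
      refine (((hord _ (pullbackUnit D.x).ne_zero).union
        (hord _ (pullbackUnit E.x).ne_zero)).image Subtype.val).subset fun V hV => ?_
      have h : Order.coheight V = 1 ∧ π V ⤳ w := by
        by_contra h
        exact hV (dif_neg h)
      refine ⟨⟨V, h⟩, ?_, rfl⟩
      by_contra! h2
      simp only [Set.mem_union, Set.mem_ofPred_eq, not_or, not_not] at h2
      exact hV ((dif_pos h).trans (by rw [h2.1, h2.2]; simp))
    rw [finsum_mem_def]
    refine Eq.trans (finsum_congr fun V => ?_) ((finsum_sub_distrib
      ((D.finite_commonDivisors E).subset Set.support_indicator_subset) hρfin).trans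
        (by rw [hρ, sub_zero]))
    by_cases h : Order.coheight V = 1 ∧ π V ⤳ w
    · have hρV : ρ V = _ := dif_pos h
      rw [hρV]
      have hV := hcov ⟨V, h⟩
      by_cases hVD : π V ∈ D.support
      · by_cases hVE : π V ∈ E.support
        · rw [Set.indicator_of_mem (show V ∈ D.commonDivisors E from ⟨h.1, hVD, hVE⟩),
            D.contribution_eq_zero_of_mem E hVD, E.contribution_eq_zero_of_mem D hVE,
            divCoeff_norm_tame D E ⟨V, h⟩ hV, sub_self, sub_self]
        · obtain ⟨h1, h2⟩ := E.contribution_eq D ⟨V, h⟩ hV hE hD hVE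
          rw [Set.indicator_of_notMem fun h3 => hVE h3.2.2, D.contribution_eq_zero_of_mem E hVD, h2,
            h1, zero_mul, sub_zero]
      · obtain ⟨h1, h2⟩ := D.contribution_eq E ⟨V, h⟩ hV hD hE hVD
        rw [Set.indicator_of_notMem fun h3 => hVD h3.2.1, E.contribution_eq_zero D hVD, h2, h1,
          zero_mul, zero_sub, zero_sub, neg_neg, sub_zero]
    · have hV : ¬ (Order.coheight V = 1 ∧ w ⋖ π V) := fun h2 => h ⟨h2.1, h2.2.le⟩
      rw [D.contribution_eq_zero_of_not_covBy E hV, E.contribution_eq_zero_of_not_covBy D hV,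
        show ρ V = 0 from dif_neg h, Set.indicator_apply]
      split_ifs with h2
      · rw [divCoeff, dif_neg fun h3 => hV ⟨h2.1, h3⟩]
      · rfl
  · rw [finsum_mem_def]
    refine finsum_congr fun V => ?_
    by_cases hV : Order.coheight V = 1 ∧ w ⋖ π V
    · have hVw : π V ⤳ w := hV.2.le
      have hDE' : w ∉ D.U ∨ w ∉ E.U := by
        by_contra! h
        exact hDE ⟨h, V, hV⟩
      rcases hDE' with h | h
      · have h1 := D.notMem_support_of_notMem h hVw
        rw [D.contribution_eq_zero_of_notMem E h, E.contribution_eq_zero D h1,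
          Set.indicator_of_notMem fun h3 => h1 h3.2.1, sub_zero]
      · have h1 := E.notMem_support_of_notMem h hVw
        rw [E.contribution_eq_zero_of_notMem D h, D.contribution_eq_zero E h1,
          Set.indicator_of_notMem fun h3 => h1 h3.2.2, sub_zero]
    · rw [D.contribution_eq_zero_of_not_covBy E hV, E.contribution_eq_zero_of_not_covBy D hV,
        Set.indicator_apply]
      split_ifs with h2
      · rw [divCoeff, dif_neg fun h3 => hV ⟨h2.1, h3⟩]
        rfl
      · rfl

/-- The commutator of two intersections is the boundary of the tame symbols along the prime divisors
lying over both supports. -/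
theorem PDivisor.inter_sub_inter_eq_boundary :
    (D.commonDivisors E).Finite ∧
      D.tameSum E (D.commonDivisors E) ∈ ratEquivsOn (D.support ∩ E.support) ∧
      D.inter E.cycle - E.inter D.cycle = boundary (D.tameSum E (D.commonDivisors E)) := by
  refine ⟨D.finite_commonDivisors E, D.tameSum_mem_ratEquivsOn E fun V hV => hV.2, ?_⟩
  ext w
  rw [D.boundary_tameSum_apply E (D.finite_commonDivisors E), ← D.inter_cycle_sub_apply E]
  rfl

/-- The components of `|π^* D|` are the prime divisors along which `π^* D` has nonzero order. -/
lemma PDivisor.mem_componentPoints_normSupport_iff (V : normalization X.toScheme) :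
    V ∈ componentPoints D.normSupport ↔ Order.coheight V = 1 ∧ pullbackOrd D.U D.x V ≠ 0 := by
  have hmem : ∀ W, W ∈ D.normSupport ↔ ∃ V : normalization X.toScheme,
      (Order.coheight V = 1 ∧ pullbackOrd D.U D.x V ≠ 0) ∧ V ⤳ W := fun W => by
    simp only [PDivisor.normSupport, pullbackSupport, Set.mem_iUnion, Set.mem_ofPred_eq,
      specializes_iff_mem_closure, exists_prop]
  constructor
  · intro hV
    obtain ⟨V', hV', h⟩ := (hmem V).mp hV.1
    have h2 : V' ≤ V := hV.2 ((hmem V').mpr ⟨V', hV', specializes_rfl⟩) (show V ≤ V' from h)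
    have h3 : V ⤳ V' := h2
    rwa [← (h.antisymm h3).eq]
  · intro hV
    refine ⟨(hmem V).mpr ⟨V, hV, specializes_rfl⟩, fun W hW hVW => ?_⟩
    obtain ⟨V', hV', h⟩ := (hmem W).mp hW
    have h1 : W ⤳ V := hVW
    have h2 := eq_of_specializes_of_coheight_eq_one hV.1 hV'.1 (h.trans h1)
    subst h2
    exact h

variable {D} in
/-- If `π^* D` has nonzero order along every prime divisor lying over `|D|`, these are the
components of `|π^* D|`. -/
lemma PDivisor.PullsBack.mem_support_iff (hD : D.PullsBack) {V : normalization X.toScheme}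
    (hV : Order.coheight V = 1) :
    normalizationMap X.toScheme V ∈ D.support ↔ V ∈ componentPoints D.normSupport := by
  refine ⟨fun h => ?_, fun h => ⟨V, h.1, rfl⟩⟩
  have h1 := hD V hV h
  simp only [PDivisor.normSupport, pullbackSupport, Set.mem_iUnion, Set.mem_ofPred_eq] at h1
  obtain ⟨V', hV', h2⟩ := h1
  rw [D.mem_componentPoints_normSupport_iff, ← eq_of_specializes_of_coheight_eq_one hV hV'.1
    (specializes_iff_mem_closure.mpr h2)]
  exact hV'

/-- If each of the divisors has nonzero order along every prime divisor lying over its support, the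
common prime divisors are the common components of the supports of the pullbacks. -/
lemma PDivisor.commonDivisors_eq_of_pullsBack (hD : D.PullsBack) (hE : E.PullsBack) :
    D.commonDivisors E = componentPoints D.normSupport ∩ componentPoints E.normSupport := by
  ext V
  constructor
  · rintro ⟨hV, h1, h2⟩
    exact ⟨(hD.mem_support_iff hV).mp h1, (hE.mem_support_iff hV).mp h2⟩
  · rintro ⟨h1, h2⟩
    have hV := ((D.mem_componentPoints_normSupport_iff V).mp h1).1
    exact ⟨hV, (hD.mem_support_iff hV).mpr h1, (hE.mem_support_iff hV).mpr h2⟩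

end Main

end

end CycleIntersection

open CycleIntersection in
theorem mainTheorem1 {k : Type u} [Field k] (X : Variety k) (D E : PDivisor X.toScheme) :
    (∀ S : Set (normalization X.toScheme),
      S = {V | Order.coheight V = 1 ∧
        normalizationMap X.toScheme V ∈ D.support ∩ E.support} →
      S.Finite ∧ D.tameSum E S ∈ ratEquivsOn (D.support ∩ E.support) ∧
        D.inter E.cycle - E.inter D.cycle = boundary (D.tameSum E S)) ∧
    (D.PullsBack → E.PullsBack → ∀ S : Set (normalization X.toScheme),
      S = componentPoints D.normSupport ∩ componentPoints E.normSupport →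
      S.Finite ∧ D.tameSum E S ∈ ratEquivsOn (D.support ∩ E.support) ∧
        D.inter E.cycle - E.inter D.cycle = boundary (D.tameSum E S)) := by
  refine ⟨?_, fun hD hE => ?_⟩
  · rintro S rfl
    exact D.inter_sub_inter_eq_boundary E
  · rintro S rfl
    rw [← D.commonDivisors_eq_of_pullsBack E hD hE]
    exact D.inter_sub_inter_eq_boundary E
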